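/- **Theorem** (decremental $+2$-additive approximate distances for pairs at distance at most $d$). There is a randomized decremental data structure, given by fixed programs (for initialization, for deletions and for queries) of a word RAM with fair coin flips, that does the following. Its input is an unweighted undirected graph $G$ with $n$ vertices and $m$ edges, given as a list of its edges, together with an integer $d\ge 1$. The word size $w$ is arbitrary, subject to $2^w\ge (n+2)^c$ for a fixed constant $c$ and $2^w>d$. The data structure then serves any sequence, fixed in advance (oblivious adversary), of deletions of edges present in the current graph and of distance queries, interleaved arbitrarily. * **Approximation.** For every outcome of the coin flips, all runs halt, and each query $(u,v)$ returns an estimate $\hat d(u,v)\in\mathbb N\cup\{\infty\}$ with $\hat d(u,v)\ge d_G(u,v)$, and with $$d_G(u,v)\le \hat d(u,v)\le d_G(u,v)+2\qquad\text{whenever } d_G(u,v)\le d,$$ where $d_G$ denotes distance in the graph $G$ that is current at the time of the query. * **Query time.** Every query takes at most $q$ steps, for an absolute constant $q$. * **Total update time.** The expected total number of steps spent on initialization and on all deletions together is $\tilde O(m^{1/2}n^{3/2}d)$ for graphs with $m=\Omega(n)$, where $n\ge1$ and $m$ is the number of edges before the first deletion. That is, there is an absolute constant $k$ such that for every $\kappa>0$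 there is a constant $C=C(\kappa)$ such that this expectation is at most $C\,m^{1/2}n^{3/2}d\,(\log n)^k$ whenever $m\ge\kappa n$. -/

import Mathlib

open scoped ENNReal
open MeasureTheory

namespace DecrementalAPSP

/-! ## A randomized word RAM

Structured programs over finitely many word registers and finitely many word-indexed arrays
(the registers and arrays that a program can touch are the ones written in its text).  A machine
word has `w` bits, is represented by a natural number below `2 ^ w`, and every elementary
operation on words costs one step.  Randomness comes from an infinite tape of fair coin flips,
read one bit at a time. -/

/-- Elementary binary operations on machine words. -/
inductive BinOp
  | add | sub | mul | div | mod | lt | eq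

/-- Value of an operation on words of `w` bits: arithmetic is modulo `2 ^ w`, subtraction is
truncated at `0`, division by `0` gives `0`, and comparisons return `0` or `1`. -/
def BinOp.eval (w : ℕ) : BinOp → ℕ → ℕ → ℕ
  | .add, x, y => (x + y) % 2 ^ w
  | .sub, x, y => x - y
  | .mul, x, y => (x * y) % 2 ^ w
  | .div, x, y => x / y
  | .mod, x, y => x % y
  | .lt, x, y => if x < y then 1 % 2 ^ w else 0
  | .eq, x, y => if x = y then 1 % 2 ^ w else 0

/-- Expressions: constants, registers, array cells, binary operations. -/
inductive Expr
  | const (c : ℕ)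
  | reg (x : ℕ)
  | load (a : ℕ) (i : Expr)
  | bin (o : BinOp) (e₁ e₂ : Expr)

/-- Programs.  `flip x` stores a fresh random bit in register `x`. -/
inductive Prog
  | skip
  | assign (x : ℕ) (e : Expr)
  | store (a : ℕ) (i e : Expr)
  | flip (x : ℕ)
  | seq (p₁ p₂ : Prog)
  | ite (e : Expr) (p₁ p₂ : Prog)
  | while (e : Expr) (p : Prog)

/-- A memory configuration: registers, arrays, and the number of coin flips read so far. -/
structure State where
  reg : ℕ → ℕ
  arr : ℕ → ℕ → ℕ
  pos : ℕ

/-- Value of an expression on words of `w` bits. -/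
def Expr.eval (w : ℕ) (s : State) : Expr → ℕ
  | .const c => c % 2 ^ w
  | .reg x => s.reg x
  | .load a i => s.arr a (i.eval w s)
  | .bin o e₁ e₂ => o.eval w (e₁.eval w s) (e₂.eval w s)

/-- Number of steps taken to evaluate an expression: one for each node. -/
def Expr.cost : Expr → ℕ
  | .const _ => 1
  | .reg _ => 1
  | .load _ i => i.cost + 1
  | .bin _ e₁ e₂ => e₁.cost + e₂.cost + 1

/-- The state with register `x` set to `v`. -/
def State.setReg (s : State) (x v : ℕ) : State :=
  { s with reg := Function.update s.reg x v }

/-- The state with cell `i` of array `a` set to `v`. -/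
def State.setArr (s : State) (a i v : ℕ) : State :=
  { s with arr := Function.update s.arr a (Function.update (s.arr a) i v) }

/-- Outcomes of all coin flips. -/
abbrev Tape : Type := ℕ → Bool

/-- The law of independent fair coin flips. -/
noncomputable def coinLaw : Measure Tape :=
  Measure.infinitePi fun _ : ℕ => (PMF.uniformOfFintype Bool).toMeasure

/-- `Exec w ω p s t s'`: on word size `w` and tape `ω`, the program `p` started in state `s`
halts after exactly `t` steps in state `s'`. -/
inductive Exec (w : ℕ) (ω : Tape) : Prog → State → ℕ → State → Prop
  | skip (s : State) : Exec w ω .skip s 1 s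
  | assign (x : ℕ) (e : Expr) (s : State) :
      Exec w ω (.assign x e) s (e.cost + 1) (s.setReg x (e.eval w s))
  | store (a : ℕ) (i e : Expr) (s : State) :
      Exec w ω (.store a i e) s (i.cost + e.cost + 1) (s.setArr a (i.eval w s) (e.eval w s))
  | flip (x : ℕ) (s : State) :
      Exec w ω (.flip x) s 1
        { s.setReg x (if ω s.pos then 1 % 2 ^ w else 0) with pos := s.pos + 1 }
  | seq {p₁ p₂ : Prog} {s₁ s₂ s₃ : State} {t₁ t₂ : ℕ} :
      Exec w ω p₁ s₁ t₁ s₂ → Exec w ω p₂ s₂ t₂ s₃ → Exec w ω (.seq p₁ p₂) s₁ (t₁ + t₂) s₃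
  | iteTrue {e : Expr} {p₁ p₂ : Prog} {s s' : State} {t : ℕ} :
      e.eval w s ≠ 0 → Exec w ω p₁ s t s' → Exec w ω (.ite e p₁ p₂) s (e.cost + 1 + t) s'
  | iteFalse {e : Expr} {p₁ p₂ : Prog} {s s' : State} {t : ℕ} :
      e.eval w s = 0 → Exec w ω p₂ s t s' → Exec w ω (.ite e p₁ p₂) s (e.cost + 1 + t) s'
  | whileTrue {e : Expr} {p : Prog} {s₁ s₂ s₃ : State} {t₁ t₂ : ℕ} :
      e.eval w s₁ ≠ 0 → Exec w ω p s₁ t₁ s₂ → Exec w ω (.while e p) s₂ t₂ s₃ →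
        Exec w ω (.while e p) s₁ (e.cost + 1 + t₁ + t₂) s₃
  | whileFalse {e : Expr} {p : Prog} {s : State} :
      e.eval w s = 0 → Exec w ω (.while e p) s (e.cost + 1) s

/-- Execution is deterministic once the tape is fixed: running time and final state are unique. -/
theorem Exec.unique {w : ℕ} {ω : Tape} {p : Prog} {s s₁ s₂ : State} {t₁ t₂ : ℕ}
    (h₁ : Exec w ω p s t₁ s₁) (h₂ : Exec w ω p s t₂ s₂) : t₁ = t₂ ∧ s₁ = s₂ := by
  induction h₁ generalizing t₂ s₂ with
  | skip s => cases h₂; exact ⟨rfl, rfl⟩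
  | assign x e s => cases h₂; exact ⟨rfl, rfl⟩
  | store a i e s => cases h₂; exact ⟨rfl, rfl⟩
  | flip x s => cases h₂; exact ⟨rfl, rfl⟩
  | seq _ _ ih₁ ih₂ =>
    cases h₂ with
    | seq g₁ g₂ =>
      obtain ⟨rfl, rfl⟩ := ih₁ g₁
      obtain ⟨rfl, rfl⟩ := ih₂ g₂
      exact ⟨rfl, rfl⟩
  | iteTrue hc _ ih =>
    cases h₂ with
    | iteTrue _ g => obtain ⟨rfl, rfl⟩ := ih g; exact ⟨rfl, rfl⟩
    | iteFalse hc' _ => exact absurd hc' hc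
  | iteFalse hc _ ih =>
    cases h₂ with
    | iteTrue hc' _ => exact absurd hc hc'
    | iteFalse _ g => obtain ⟨rfl, rfl⟩ := ih g; exact ⟨rfl, rfl⟩
  | whileTrue hc _ _ ih₁ ih₂ =>
    cases h₂ with
    | whileTrue _ g₁ g₂ =>
      obtain ⟨rfl, rfl⟩ := ih₁ g₁
      obtain ⟨rfl, rfl⟩ := ih₂ g₂
      exact ⟨rfl, rfl⟩
    | whileFalse hc' => exact absurd hc' hc
  | whileFalse hc =>
    cases h₂ with
    | whileTrue hc' _ _ => exact absurd hc hc'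
    | whileFalse _ => exact ⟨rfl, rfl⟩

/-! ## Decremental graphs and data structures -/

/-- The operations: delete the edge `{u, v}`; ask for a distance estimate between `u` and `v`. -/
inductive Op (n : ℕ)
  | delete (u v : Fin n)
  | query (u v : Fin n)

/-- Every deletion in the sequence removes an edge that is present at that time. -/
def Legal {n : ℕ} : SimpleGraph (Fin n) → List (Op n) → Prop
  | _, [] => True
  | G, .delete u v :: ops => G.Adj u v ∧ Legal (G.deleteEdges {s(u, v)}) ops
  | G, .query _ _ :: ops => Legal G ops

/-- The true distances (`⊤` if disconnected) asked for by the successive queries of the sequence,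
each taken in the graph that is current at the time of the query. -/
noncomputable def queryDists {n : ℕ} : SimpleGraph (Fin n) → List (Op n) → List ℕ∞
  | _, [] => []
  | G, .delete u v :: ops => queryDists (G.deleteEdges {s(u, v)}) ops
  | G, .query u v :: ops => G.edist u v :: queryDists G ops

/-- `E` lists every edge of `G` exactly once, in any order and either orientation. -/
def IsEdgeList {n : ℕ} (G : SimpleGraph (Fin n)) (E : List (Fin n × Fin n)) : Prop :=
  (E.map fun e => s(e.1, e.2)).Nodup ∧ ∀ x : Sym2 (Fin n),
    x ∈ G.edgeSet ↔ x ∈ E.map fun e => s(e.1, e.2)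

/-- A dynamic data structure: a program for initialization, one for deletions, one for queries. -/
structure DataStructure where
  init : Prog
  delete : Prog
  query : Prog

/-- The input memory: registers `0, 1, 2` hold the number of vertices, the number of edges and
the distance bound `d`; arrays `0` and `1` hold the endpoints of the listed edges; all other
memory is `0`. -/
def inputState (n d : ℕ) (E : List (Fin n × Fin n)) : State where
  reg x := if x = 0 then n else if x = 1 then E.length else if x = 2 then d else 0
  arr a i := if a = 0 then (E.map fun e => (e.1 : ℕ)).getD i 0
    else if a = 1 then (E.map fun e => (e.2 : ℕ)).getD i 0 else 0
  pos := 0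

/-- The state in which an operation with arguments `u`, `v` starts: they are put in registers
`0` and `1`. -/
def State.call (s : State) (u v : ℕ) : State := (s.setReg 0 u).setReg 1 v

/-- The answer of a query, read off its final state: register `0`, or `⊤` if register `1` is
`0`. -/
def State.answer (s : State) : ℕ∞ := if s.reg 1 = 0 then ⊤ else (s.reg 0 : ℕ∞)

/-- What is observed of a query: its running time and the returned estimate. -/
structure Reply where
  time : ℕ
  estimate : ℕ∞

/-- `D.Serves w ω s ops T R`: from state `s`, the data structure processes the operations `ops` one
after the other (each one halting), spends `T` steps in total on the deletions, and gives the
replies `R` to the successive queries. -/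
inductive DataStructure.Serves {n : ℕ} (D : DataStructure) (w : ℕ) (ω : Tape) :
    State → List (Op n) → ℕ → List Reply → Prop
  | nil (s : State) : Serves D w ω s [] 0 []
  | delete {u v : Fin n} {s s' : State} {ops : List (Op n)} {t T : ℕ} {R : List Reply} :
      Exec w ω D.delete (s.call u v) t s' → Serves D w ω s' ops T R →
        Serves D w ω s (.delete u v :: ops) (t + T) R
  | query {u v : Fin n} {s s' : State} {ops : List (Op n)} {t T : ℕ} {R : List Reply} :
      Exec w ω D.query (s.call u v) t s' → Serves D w ω s' ops T R →
        Serves D w ω s (.query u v :: ops) T (⟨t, s'.answer⟩ :: R)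

/-- `D.Run w ω d E ops T R`: on the graph with edge list `E` and the distance bound `d`, the data
structure initializes and then serves `ops` with replies `R`; its total update time, spent on
initialization and on all deletions, is `T`.  Both `T` and `R` are determined by the other data,
see `Exec.unique`. -/
def DataStructure.Run {n : ℕ} (D : DataStructure) (w : ℕ) (ω : Tape) (d : ℕ)
    (E : List (Fin n × Fin n)) (ops : List (Op n)) (T : ℕ) (R : List Reply) : Prop :=
  ∃ (t : ℕ) (s : State) (T' : ℕ), Exec w ω D.init (inputState n d E) t s ∧
    D.Serves w ω s ops T' R ∧ T = t + T'

/-- `a` is an estimate of the distance `δ` that never underestimates, with additive error at most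
`2` if `δ ≤ d`. -/
def IsAdditiveTwoEstimate (d : ℕ) (δ a : ℕ∞) : Prop :=
  δ ≤ a ∧ (δ ≤ d → a ≤ δ + 2)

end DecrementalAPSP

/-! Choose a random set of centers, each vertex independently with probability `p = 2 ^ (-j)`, where
`j` is least with `m ≤ 4 ^ j * n`; thus `p` is about `√(n / m)`. For every pair of a root `r` and a
vertex `v` keep a level `lev r v`, capped at `L = min d n + 3`, which starts at `0` and only grows,
as in Even–Shiloach trees. A level below the cap is kept, for `v ≠ r`, only while a witness
justifies it: * if `r` is a center, a neighbour `y` of `v` with `lev r y < lev r v`, searched in the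
full initial adjacency list of `v`; * if `r` is not a center but `v` has an adjacent center `z`, the
inequality `lev z r < lev r v`, a single comparison; * if neither holds, a neighbour `y` as in the
first case, searched in a list of neighbours of `v` that is built once, when `v` turns out to have
no adjacent center left.

Correctness. Following witnesses downwards gives `edist r v ≤ lev r v` once no pair is waiting to be
checked (`Conf.Inv.edist_le_lev`). Conversely a level never exceeds the distance if the root is a
center, nor the distance plus `2` otherwise (`Conf.Inv.raise`). The error does not accumulate: the
detour through an adjacent center is measured with an exact tree, so it exceeds the distance by at
most `2`, while a step to a neighbour on a shortest path merely inherits the bound.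

Running time. One level of a pair costs its scan list plus the pairs depending on it, and a pair has
at most `L` levels; a potential makes this precise. The expected `n * p` center roots work on all
`m` edges, which costs `L * n * p * m`. The other `n` roots work only on the lists of vertices
without adjacent center. A vertex of degree `k` has none with probability `(1 - p) ^ k`, so its list
has expected length `O(1 / p)`, and the cost is `L * n ^ 2 / p` in all. Both terms are `O(m ^ (1/2)
* n ^ (3/2) * L)` for the chosen `p`, without logarithmic factors.

Since the operations do not depend on the coins, the centers are independent of each graph in the
sequence. If deleting `{x, y}` leaves `x` with `k` neighbours, a list for `x` is needed only if `y`
is a center and none of the `k` others is, which has probability `p * (1 - p) ^ k`. The expected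
costs at `x` telescope along the function `degPot` of its degree, which is at most `2 / p`
(`integral_vertexCost_le`, `integral_opsCost_le`).

The data structure is an abstract configuration `Conf` with invariant `Conf.Inv`; `Rep` relates it
to memory. Programs are verified with the predicate `WP`, in which a loop pays for its steps by a
drop of potential. -/

namespace DecrementalAPSP

/-! ## Total correctness with running times -/

/-- The program `p` started in `s` halts, and its running time and final state satisfy `Q`. -/
def WP (w : ℕ) (ω : Tape) (p : Prog) (s : State) (Q : ℕ → State → Prop) : Prop :=
  ∃ t s', Exec w ω p s t s' ∧ Q t s'

section WP
variable {w : ℕ} {ω : Tape} {p p₁ p₂ : Prog} {s : State} {Q Q' : ℕ → State → Prop} {e : Expr}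

theorem WP.mono (h : WP w ω p s Q) (hQ : ∀ t s', Q t s' → Q' t s') : WP w ω p s Q' := by
  obtain ⟨t, s', h₁, h₂⟩ := h
  exact ⟨t, s', h₁, hQ _ _ h₂⟩

theorem WP.skip (h : Q 1 s) : WP w ω .skip s Q := ⟨_, _, .skip s, h⟩

theorem WP.assign {x : ℕ} (h : Q (e.cost + 1) (s.setReg x (e.eval w s))) :
    WP w ω (.assign x e) s Q := ⟨_, _, .assign x e s, h⟩

theorem WP.store {a : ℕ} {i : Expr}
    (h : Q (i.cost + e.cost + 1) (s.setArr a (i.eval w s) (e.eval w s))) :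
    WP w ω (.store a i e) s Q := ⟨_, _, .store a i e s, h⟩

theorem WP.flip {x : ℕ}
    (h : Q 1 { s.setReg x (if ω s.pos then 1 % 2 ^ w else 0) with pos := s.pos + 1 }) :
    WP w ω (.flip x) s Q := ⟨_, _, .flip x s, h⟩

theorem WP.seq (h : WP w ω p₁ s fun t₁ s₁ => WP w ω p₂ s₁ fun t₂ s₂ => Q (t₁ + t₂) s₂) :
    WP w ω (.seq p₁ p₂) s Q := by
  obtain ⟨t₁, s₁, h₁, t₂, s₂, h₂, h⟩ := h
  exact ⟨_, _, .seq h₁ h₂, h⟩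

theorem WP.ite (h₁ : e.eval w s ≠ 0 → WP w ω p₁ s fun t s' => Q (e.cost + 1 + t) s')
    (h₂ : e.eval w s = 0 → WP w ω p₂ s fun t s' => Q (e.cost + 1 + t) s') :
    WP w ω (.ite e p₁ p₂) s Q := by
  by_cases h : e.eval w s = 0
  · obtain ⟨t, s', g₁, g₂⟩ := h₂ h
    exact ⟨_, _, .iteFalse h g₁, g₂⟩
  · obtain ⟨t, s', g₁, g₂⟩ := h₁ h
    exact ⟨_, _, .iteTrue h g₁, g₂⟩

/-- A loop whose body pays for its running time with a potential.  The invariant relates the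
state to an abstract configuration of type `α`, on which the potential is defined. -/
theorem WP.while {α : Type*} (I : α → State → Prop) (Φ : α → ℕ) (c : α) (hI : I c s)
    (h : ∀ c s, I c s → e.eval w s ≠ 0 →
      WP w ω p s fun t s' => ∃ c', I c' s' ∧ e.cost + 1 + t + Φ c' ≤ Φ c) :
    WP w ω (.while e p) s fun t s' =>
      ∃ c', I c' s' ∧ e.eval w s' = 0 ∧ t + Φ c' ≤ Φ c + (e.cost + 1) := by
  -- Each iteration takes at least one step, so the potential strictly decreases; termination and
  -- the time bound come from the same induction.
  induction hm : Φ c using Nat.strong_induction_on generalizing c s with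
  | _ m ih =>
    by_cases he : e.eval w s = 0
    · exact ⟨_, _, .whileFalse he, c, hI, he, by omega⟩
    · obtain ⟨t, s', g₁, c', hI', hc⟩ := h c s hI he
      obtain ⟨t', s'', g₂, c'', hI'', he', hc'⟩ := ih (Φ c') (by omega) c' hI' rfl
      exact ⟨_, _, .whileTrue he g₁ g₂, c'', hI'', he', by omega⟩

/-- A counting loop: `n - i` iterations, each within `B` steps. -/
theorem WP.for {n i : ℕ} (I : ℕ → State → Prop) (B : ℕ) (hin : i ≤ n) (hI : I i s)
    (hlt : ∀ i s, I i s → (e.eval w s ≠ 0 ↔ i < n))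
    (h : ∀ i s, I i s → i < n → WP w ω p s fun t s' => I (i + 1) s' ∧ t ≤ B) :
    WP w ω (.while e p) s fun t s' =>
      I n s' ∧ t ≤ (n - i) * (B + e.cost + 1) + (e.cost + 1) := by
  refine (WP.while (I := fun i s => I i s ∧ i ≤ n) (Φ := fun i => (n - i) * (B + e.cost + 1))
    (c := i) ⟨hI, hin⟩ ?_).mono ?_
  · rintro i s ⟨hI, hi⟩ he
    have hi' := (hlt i s hI).1 he
    refine (h i s hI hi').mono ?_
    rintro t s' ⟨h₁, h₂⟩
    refine ⟨i + 1, ⟨h₁, hi'⟩, ?_⟩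
    obtain ⟨k, rfl⟩ := Nat.exists_eq_add_of_lt hi'
    rw [show i + k + 1 - (i + 1) = k by omega, show i + k + 1 - i = k + 1 by omega, Nat.succ_mul]
    omega
  · rintro t s' ⟨i', ⟨hI, hi⟩, he, ht⟩
    have : i' = n := by
      by_contra hne
      exact (hlt i' s' hI).2 (by omega) he
    subst this
    exact ⟨hI, by simpa using ht⟩

end WP

/-! ## Notation for programs -/

instance : Add Expr := ⟨.bin .add⟩
instance : Sub Expr := ⟨.bin .sub⟩
instance : Mul Expr := ⟨.bin .mul⟩
instance : Div Expr := ⟨.bin .div⟩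
instance : Mod Expr := ⟨.bin .mod⟩
instance (k : ℕ) : OfNat Expr k := ⟨.const k⟩

infixr:40 " ;; " => Prog.seq

section Eval
variable (w : ℕ) (s : State) (a b : Expr)

@[simp] theorem Expr.eval_add : (a + b).eval w s = (a.eval w s + b.eval w s) % 2 ^ w := rfl
@[simp] theorem Expr.eval_sub : (a - b).eval w s = a.eval w s - b.eval w s := rfl
@[simp] theorem Expr.eval_mul : (a * b).eval w s = (a.eval w s * b.eval w s) % 2 ^ w := rfl
@[simp] theorem Expr.eval_div : (a / b).eval w s = a.eval w s / b.eval w s := rfl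
@[simp] theorem Expr.eval_mod : (a % b).eval w s = a.eval w s % b.eval w s := rfl
@[simp] theorem Expr.eval_lt :
    (Expr.bin .lt a b).eval w s = if a.eval w s < b.eval w s then 1 % 2 ^ w else 0 := rfl
@[simp] theorem Expr.eval_eq :
    (Expr.bin .eq a b).eval w s = if a.eval w s = b.eval w s then 1 % 2 ^ w else 0 := rfl
@[simp] theorem Expr.eval_reg (x : ℕ) : (Expr.reg x).eval w s = s.reg x := rfl
@[simp] theorem Expr.eval_load (x : ℕ) : (Expr.load x a).eval w s = s.arr x (a.eval w s) := rfl
@[simp] theorem Expr.eval_ofNat (k : ℕ) : (no_index (OfNat.ofNat k) : Expr).eval w s = k % 2 ^ w := rfl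

@[simp] theorem Expr.cost_add : (a + b).cost = a.cost + b.cost + 1 := rfl
@[simp] theorem Expr.cost_sub : (a - b).cost = a.cost + b.cost + 1 := rfl
@[simp] theorem Expr.cost_mul : (a * b).cost = a.cost + b.cost + 1 := rfl
@[simp] theorem Expr.cost_div : (a / b).cost = a.cost + b.cost + 1 := rfl
@[simp] theorem Expr.cost_mod : (a % b).cost = a.cost + b.cost + 1 := rfl
@[simp] theorem Expr.cost_bin (o : BinOp) : (Expr.bin o a b).cost = a.cost + b.cost + 1 := rfl
@[simp] theorem Expr.cost_reg (x : ℕ) : (Expr.reg x).cost = 1 := rfl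
@[simp] theorem Expr.cost_load (x : ℕ) : (Expr.load x a).cost = a.cost + 1 := rfl
@[simp] theorem Expr.cost_ofNat (k : ℕ) : (no_index (OfNat.ofNat k) : Expr).cost = 1 := rfl

@[simp] theorem State.reg_setReg (x v y : ℕ) :
    (s.setReg x v).reg y = if y = x then v else s.reg y := by
  simp [State.setReg, Function.update_apply]
@[simp] theorem State.arr_setReg (x v : ℕ) : (s.setReg x v).arr = s.arr := rfl
@[simp] theorem State.pos_setReg (x v : ℕ) : (s.setReg x v).pos = s.pos := rfl
@[simp] theorem State.reg_setArr (x i v : ℕ) : (s.setArr x i v).reg = s.reg := rfl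
@[simp] theorem State.pos_setArr (x i v : ℕ) : (s.setArr x i v).pos = s.pos := rfl
@[simp] theorem State.arr_setArr (x i v y j : ℕ) :
    (s.setArr x i v).arr y j = if y = x ∧ j = i then v else s.arr y j := by
  simp only [State.setArr, Function.update_apply]
  split_ifs <;> simp_all

end Eval

/-! ## Index arithmetic -/

/-- Row-major indices and counters polynomial in `n` of low degree are below `2 ^ w`. -/
def Fits (n w : ℕ) : Prop := 2 ^ 36 * (n + 2) ^ 4 ≤ 2 ^ w

/-- Since `2 ≤ n + 2`, 36 of the 40 factors pay for the constant and four remain for the largest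
quantity stored, the potential of order `n ^ 4`. -/
theorem fits_of_pow_le {n w : ℕ} (h : (n + 2) ^ 40 ≤ 2 ^ w) : Fits n w := by
  refine le_trans ?_ h
  rw [show 40 = 36 + 4 from rfl, pow_add]
  exact Nat.mul_le_mul_right _ (Nat.pow_le_pow_left (by omega) _)

theorem Fits.lt {n w x : ℕ} (h : Fits n w) (hx : x < 2 ^ 36 * (n + 2) ^ 4) : x < 2 ^ w :=
  hx.trans_le h

theorem Fits.lt_sq {n w x : ℕ} (h : Fits n w) (hx : x ≤ 16 * (n + 2) ^ 2) : x < 2 ^ w := by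
  refine h.lt (hx.trans_lt ?_)
  have : 1 ≤ (n + 2) ^ 2 := Nat.one_le_pow _ _ (by omega)
  nlinarith

theorem Fits.one_mod {n w : ℕ} (h : Fits n w) : 1 % 2 ^ w = 1 :=
  Nat.mod_eq_of_lt (h.lt_sq (by nlinarith [Nat.one_le_pow 2 (n + 2) (by omega)]))

theorem Fits.small_mod {n w k : ℕ} (h : Fits n w) (hk : k ≤ 16) : k % 2 ^ w = k :=
  Nat.mod_eq_of_lt (h.lt_sq (by nlinarith [Nat.one_le_pow 2 (n + 2) (by omega)]))

theorem Fits.idx_mod {n w a b : ℕ} (h : Fits n w) (ha : a < 2 * n) (hb : b < n) :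
    (a * n % 2 ^ w + b) % 2 ^ w = a * n + b := by
  have : a * n + b < 2 ^ w := h.lt_sq (by nlinarith)
  rw [Nat.mod_eq_of_lt (a := a * n) (by omega), Nat.mod_eq_of_lt this]

theorem idx_inj {n a b a' b' : ℕ} (hb : b < n) (hb' : b' < n) :
    a * n + b = a' * n + b' ↔ a = a' ∧ b = b' := by
  constructor
  · intro h
    have h₁ := congrArg (· / n) h
    have h₂ := congrArg (· % n) h
    simp only [Nat.mul_add_mod', Nat.mod_eq_of_lt hb,
      Nat.mod_eq_of_lt hb'] at h₂
    refine ⟨?_, h₂⟩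
    subst h₂
    exact Nat.eq_of_mul_eq_mul_right (by omega : 0 < n) (by omega)
  · rintro ⟨rfl, rfl⟩; rfl

/-! ## Abstract configurations of the data structure -/

/-- Abstract memory contents: current graph, random centers (as a predicate and as a list), scan
lists and lists of dependents (static ones for `true`, for vertices without adjacent center for
`false`), position of the adjacent center of a vertex in its static list, levels and scan positions
for pairs (root, vertex), and the stack of pairs waiting to be checked. -/
structure Conf (n : ℕ) where
  G : SimpleGraph (Fin n)
  D : Fin n → Bool
  ds : List (Fin n)
  sl : Bool → Fin n → List (Fin n)
  dl : Bool → Fin n → List (Fin n)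
  zp : Fin n → ℕ
  lev : Fin n → Fin n → ℕ
  ptr : Fin n → Fin n → ℕ
  stk : List (Fin n × Fin n)

/-- Update of a function of two arguments at one point. -/
def upd2 {α β γ : Type*} [DecidableEq α] [DecidableEq β] (f : α → β → γ) (a : α) (b : β) (x : γ) :
    α → β → γ := fun a' b' => if a' = a ∧ b' = b then x else f a' b'

theorem upd2_self {α β γ : Type*} [DecidableEq α] [DecidableEq β] (f : α → β → γ) (a : α) (b : β)
    (x : γ) : upd2 f a b x a b = x := by simp [upd2]

theorem upd2_of_ne {α β γ : Type*} [DecidableEq α] [DecidableEq β] {f : α → β → γ} {a a' : α}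
    {b b' : β} {x : γ} (h : ¬ (a' = a ∧ b' = b)) : upd2 f a b x a' b' = f a' b' := by
  simp [upd2, h]

namespace Conf
variable {n : ℕ} (L : ℕ) (c : Conf n)

/-- The level of `v` for the root `r` is justified by a witness. -/
def OK (r v : Fin n) : Prop :=
  r = v ∨ L ≤ c.lev r v ∨
    -- The comparison is with the exact tree of `z`, so here the center is the root and `r` the
    -- vertex. That `z` is a center adjacent to `v` is left to the invariant `zp_ok`.
    (c.D r = false ∧ ∃ z, (c.sl true v)[c.zp v]? = some z ∧ c.lev z r < c.lev r v) ∨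
    ∃ y, (c.sl (c.D r) v)[c.ptr r v]? = some y ∧ c.G.Adj v y ∧ c.lev r y < c.lev r v

/-- The pairs whose witness may depend on the level of `(r, v)`. -/
def deps (r v : Fin n) : List (Fin n × Fin n) :=
  (c.dl (c.D r) v).map (fun y => (r, y)) ++
    -- A center `r` may be the recorded center of a neighbour `y`, and then the level of `(r, v)` is
    -- the witness of `(v, y)`. The static list of `r` contains all such `y`.
    bif c.D r then (c.sl true r).map (fun y => (v, y)) else []

/-- The invariant of the data structure.  The vertices in `X` may have lost their adjacent center,
the scan lists of the vertices in `Y` may be incomplete. -/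
structure Inv (X Y : Set (Fin n)) : Prop where
  sl_nodup : ∀ b v, (c.sl b v).Nodup
  dl_nodup : ∀ b v, (c.dl b v).Nodup
  mem_sl : ∀ v y, c.G.Adj v y → y ∈ c.sl true v
  mem_dl : ∀ b v y, y ∈ c.sl b v ↔ v ∈ c.dl b y
  sl_sub : ∀ v y, y ∈ c.sl false v → y ∈ c.sl true v
  zp_le : ∀ v, c.zp v ≤ (c.sl true v).length
  -- An entry once passed can never become an adjacent center again: edges only disappear and the
  -- centers are fixed. So each static list is searched once in total.
  zp_pre : ∀ v i y, i < c.zp v → (c.sl true v)[i]? = some y → c.G.Adj v y → c.D y = false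
  zp_ok : ∀ v ∉ X, ∀ y, (c.sl true v)[c.zp v]? = some y → c.G.Adj v y ∧ c.D y = true
  sl_empty : ∀ v, c.zp v < (c.sl true v).length → c.sl false v = []
  sl_full : ∀ v ∉ Y, c.zp v = (c.sl true v).length → ∀ y, c.G.Adj v y → y ∈ c.sl false v
  lev_self : ∀ v, c.lev v v = 0
  lev_le : ∀ r v, c.lev r v ≤ L
  -- Only this upper bound is invariant. The lower bound fails while pairs are waiting and is
  -- recovered from `work` when the stack is empty.
  lev_ub : ∀ r v, (c.lev r v : ℕ∞) ≤ c.G.edist r v + bif c.D r then 0 else 2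
  ptr_le : ∀ r v, c.ptr r v ≤ (c.sl (c.D r) v).length
  ptr_pre : ∀ r v i y, i < c.ptr r v → (c.sl (c.D r) v)[i]? = some y → c.G.Adj v y →
    c.lev r v ≤ c.lev r y
  work : ∀ r, ∀ v ∉ X, c.OK L r v ∨ (r, v) ∈ c.stk

/-- Weight of one level of the pair `(r, v)`. -/
def wt (r v : Fin n) : ℕ := 1 + 2 * (c.deps r v).length + (c.sl (c.D r) v).length

/-- Future work caused by the pair `(r, v)`. -/
def pairPot (r v : Fin n) : ℕ :=
  (L - c.lev r v) * c.wt r v + ((c.sl (c.D r) v).length - c.ptr r v)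

/-- Future work of the main loop, as long as the graph does not change. -/
def pot : ℕ := c.stk.length + ∑ p : Fin n × Fin n, c.pairPot L p.1 p.2

/-- The configuration after the level of `(r, v)` has been raised. -/
def raise (r v : Fin n) : Conf n :=
  { c with
    lev := upd2 c.lev r v (c.lev r v + 1)
    ptr := upd2 c.ptr r v 0
    stk := c.stk ++ c.deps r v }

/-- The configuration after the scan position of `(r, v)` has been advanced. -/
def advance (r v : Fin n) : Conf n :=
  { c with ptr := upd2 c.ptr r v (c.ptr r v + 1) }

end Conf

/-! ### Distances along one edge -/

theorem exists_adj_edist_add_one_le {V : Type*} {G : SimpleGraph V} {r v : V} (hne : r ≠ v) {k : ℕ}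
    (h : G.edist r v ≤ k) : ∃ y, G.Adj v y ∧ G.edist r y + 1 ≤ k := by
  have htop : G.edist r v ≠ ⊤ := ne_top_of_le_ne_top (ENat.natCast_ne_top k) h
  rw [SimpleGraph.edist_comm] at htop h
  -- The desired neighbour is the vertex after `v` on a shortest walk from `v` to `r`.
  obtain ⟨W, hW⟩ := SimpleGraph.exists_walk_of_edist_ne_top htop
  cases W with
  | nil => exact absurd rfl hne
  | cons hadj q =>
    refine ⟨_, hadj, ?_⟩
    rw [← hW] at h
    rw [SimpleGraph.edist_comm]
    refine le_trans ?_ h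
    simp only [SimpleGraph.Walk.length_cons, Nat.cast_add, Nat.cast_one]
    gcongr
    exact SimpleGraph.Walk.edist_le q

theorem edist_le_add_one_of_adj {V : Type*} {G : SimpleGraph V} {r v y : V} (h : G.Adj v y) :
    G.edist r v ≤ G.edist r y + 1 := by
  refine (SimpleGraph.edist_triangle (v := y)).trans ?_
  gcongr
  exact (SimpleGraph.edist_eq_one_iff_adj.2 h.symm).le

theorem sum_add_le_sum {ι : Type*} [Fintype ι] [DecidableEq ι] {f g : ι → ℕ} (i₀ : ι) {k : ℕ}
    (h : ∀ i, i ≠ i₀ → f i ≤ g i) (h₀ : f i₀ + k ≤ g i₀) : ∑ i, f i + k ≤ ∑ i, g i := by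
  rw [← Finset.add_sum_erase _ _ (Finset.mem_univ i₀), ← Finset.add_sum_erase _ g (Finset.mem_univ i₀)]
  have := Finset.sum_le_sum (s := Finset.univ.erase i₀) (f := f) (g := g)
    fun i hi => h i (Finset.ne_of_mem_erase hi)
  omega

/-! ### Approximation quality, and the invariant under the steps of the main loop -/

namespace Conf.Inv
variable {n L : ℕ} {c : Conf n} {X Y : Set (Fin n)}

theorem length_sl_le (h : c.Inv L X Y) (b v) : (c.sl b v).length ≤ n := by
  simpa using (h.sl_nodup b v).length_le_card

theorem length_dl_le (h : c.Inv L X Y) (b v) : (c.dl b v).length ≤ n := by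
  simpa using (h.dl_nodup b v).length_le_card

/-- Every pair off the stack with a level below the cap is at distance at most its level. -/
theorem edist_le_lev (h : c.Inv L ∅ ∅) (hstk : c.stk = []) {r v : Fin n} (hlt : c.lev r v < L) :
    c.G.edist r v ≤ c.lev r v := by
  -- The induction runs over the level, for all roots at once, because a witness through a center
  -- passes from the root `r` to the root `z`.
  induction hk : c.lev r v using Nat.strong_induction_on generalizing r v with
  | _ k ih =>
    have hOK : c.OK L r v := (h.work r v (by simp)).resolve_right (by simp [hstk])
    rcases hOK with rfl | hL | ⟨-, z, hz, hlev⟩ | ⟨y, -, hadj, hlev⟩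
    · simp
    · omega
    · have hadj := (h.zp_ok v (by simp) z hz).1
      have := ih (c.lev z r) (by omega) (by omega) rfl
      rw [SimpleGraph.edist_comm] at this
      refine (edist_le_add_one_of_adj hadj).trans ((add_le_add_left this 1).trans ?_)
      rw [← hk]; exact_mod_cast hlev
    · have := ih (c.lev r y) (by omega) (by omega) rfl
      refine (edist_le_add_one_of_adj hadj).trans ((add_le_add_left this 1).trans ?_)
      rw [← hk]; exact_mod_cast hlev

theorem pop (h : c.Inv L ∅ ∅) {l r v} (hs : c.stk = l ++ [(r, v)]) (hOK : c.OK L r v) :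
    ({ c with stk := l } : Conf n).Inv L ∅ ∅ := by
  refine { h with work := fun r' v' hv' => ?_ }
  rcases h.work r' v' hv' with h' | h'
  · exact .inl h'
  · rw [hs, List.mem_append, List.mem_singleton] at h'
    rcases h' with h' | h'
    · exact .inr h'
    · obtain ⟨rfl, rfl⟩ := Prod.mk.inj h'
      exact .inl hOK

/-- A rejected entry is either a dead edge or has too high a level. It stays rejected until `lev r
v` is raised, because other levels only grow and no edge returns. The pair stays on the stack, so it
still counts as waiting. -/
theorem advance (h : c.Inv L ∅ ∅) {r v y} (hs : (r, v) ∈ c.stk)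
    (hy : (c.sl (c.D r) v)[c.ptr r v]? = some y) (hn : c.G.Adj v y → c.lev r v ≤ c.lev r y) :
    (c.advance r v).Inv L ∅ ∅ := by
  have hlt : c.ptr r v < (c.sl (c.D r) v).length := (List.getElem?_eq_some_iff.1 hy).1
  refine { h with ptr_le := fun r' v' => ?_, ptr_pre := fun r' v' i y' hi => ?_,
                  work := fun r' v' hv' => ?_ }
  · by_cases hrv : r' = r ∧ v' = v
    · obtain ⟨rfl, rfl⟩ := hrv
      simpa [Conf.advance, upd2_self] using hlt
    · simpa [Conf.advance, upd2_of_ne hrv] using h.ptr_le r' v'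
  · by_cases hrv : r' = r ∧ v' = v
    · obtain ⟨rfl, rfl⟩ := hrv
      simp only [Conf.advance, upd2_self] at hi ⊢
      intro hy' hadj
      rcases Nat.lt_succ_iff_lt_or_eq.1 hi with hi | rfl
      · exact h.ptr_pre r' v' i y' hi hy' hadj
      · rw [hy] at hy'; cases hy'; exact hn hadj
    · simp only [Conf.advance, upd2_of_ne hrv] at hi ⊢
      exact h.ptr_pre r' v' i y' hi
  · by_cases hrv : r' = r ∧ v' = v
    · obtain ⟨rfl, rfl⟩ := hrv
      exact .inr hs
    · simpa [Conf.OK, Conf.advance, upd2_of_ne hrv] using h.work r' v' hv'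

/-- This is where the additive error is controlled. The hypothesis `hr` says that the search for a
witness has failed: either the recorded center does not justify the level, or there is none to
consult and the whole scan list has been rejected. Pairs that lose their witness are exactly among
the dependents being pushed. -/
theorem raise (h : c.Inv L ∅ ∅) {r v} (hs : (r, v) ∈ c.stk) (hne : r ≠ v) (hlt : c.lev r v < L)
    (hr : (c.D r = false ∧ ∃ z, (c.sl true v)[c.zp v]? = some z ∧ c.lev r v ≤ c.lev z r) ∨
      ((c.D r = false → (c.sl true v).length ≤ c.zp v) ∧ (c.sl (c.D r) v).length ≤ c.ptr r v)) :
    (c.raise r v).Inv L ∅ ∅ := by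
  have hmono : ∀ r' v', c.lev r' v' ≤ (c.raise r v).lev r' v' := fun r' v' => by
    simp only [Conf.raise, upd2]; split_ifs with hh
    · obtain ⟨rfl, rfl⟩ := hh; omega
    · rfl
  refine { h with lev_self := fun v' => ?_, lev_le := fun r' v' => ?_, lev_ub := fun r' v' => ?_,
                  ptr_le := fun r' v' => ?_, ptr_pre := fun r' v' i y' hi => ?_,
                  work := fun r' v' hv' => ?_ }
  · rw [← h.lev_self v']
    exact upd2_of_ne (by rintro ⟨rfl, rfl⟩; exact hne rfl)
  · by_cases hrv : r' = r ∧ v' = v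
    · obtain ⟨rfl, rfl⟩ := hrv
      simpa [Conf.raise, upd2_self] using hlt
    · simpa [Conf.raise, upd2_of_ne hrv] using h.lev_le r' v'
  · by_cases hrv : r' = r ∧ v' = v
    swap
    · simpa [Conf.raise, upd2_of_ne hrv] using h.lev_ub r' v'
    obtain ⟨rfl, rfl⟩ := hrv
    simp only [Conf.raise, upd2_self]
    by_contra hcon
    rw [not_le] at hcon
    have htop : c.G.edist r' v' ≠ ⊤ := by
      intro h'; rw [h'] at hcon; simp at hcon
    obtain ⟨k, hk⟩ := ENat.ne_top_iff_exists.1 htop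
    obtain ⟨y, hadj, hy⟩ := exists_adj_edist_add_one_le hne hk.symm.le
    have hytop : c.G.edist r' y ≠ ⊤ := by
      intro h'; rw [h'] at hy; simp at hy
    -- `y` is the neighbour of `v` on a shortest path to `r`, at distance `k' ≤ k - 1`.
    obtain ⟨k', hk'⟩ := ENat.ne_top_iff_exists.1 hytop
    have hyub := h.lev_ub r' y
    rw [← hk] at hcon
    rw [← hk'] at hy hyub
    -- With an adjacent center, `lev r v ≤ lev z r ≤ edist z r ≤ edist r v + 1`, so the raised level
    -- is at most `edist r v + 2`. The middle inequality has no error term because the root `z` is a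
    -- center.
    rcases hr with ⟨hD, z, hz, hzl⟩ | ⟨hD, hp⟩
    · have hzz := h.zp_ok v' (by simp) z hz
      have hzub := h.lev_ub z r'
      rw [hzz.2, SimpleGraph.edist_comm] at hzub
      have hrz := edist_le_add_one_of_adj (r := r') hzz.1.symm
      rw [← hk] at hrz
      simp only [hD, cond_true, cond_false, add_zero] at hcon hzub
      have h1 := hzub.trans hrz
      norm_cast at h1 hcon
      omega
    -- Otherwise the scan list contains every current neighbour, so `y` was rejected: `lev r v ≤ lev
    -- r y`. The bound for `y` then carries over to `lev r v + 1` with the same error.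
    · have hmem : y ∈ c.sl (c.D r') v' := by
        cases hb : c.D r' with
        | true => exact h.mem_sl _ _ hadj
        | false => exact h.sl_full v' (by simp) (le_antisymm (h.zp_le v') (hD hb)) y hadj
      obtain ⟨i, hi⟩ := List.mem_iff_getElem?.1 hmem
      have := h.ptr_pre r' v' i y
        ((List.getElem?_eq_some_iff.1 hi).1.trans_le hp) hi hadj
      cases hb : c.D r' <;> simp only [hb, cond_true, cond_false, add_zero] at hcon hyub <;>
        norm_cast at hcon hyub hy <;> omega
  · by_cases hrv : r' = r ∧ v' = v
    · obtain ⟨rfl, rfl⟩ := hrv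
      simp [Conf.raise, upd2_self]
    · simpa [Conf.raise, upd2_of_ne hrv] using h.ptr_le r' v'
  · by_cases hrv : r' = r ∧ v' = v
    · obtain ⟨rfl, rfl⟩ := hrv
      simp [Conf.raise, upd2_self] at hi
    · intro hy' hadj
      refine le_trans ?_ (hmono r' y')
      simp only [Conf.raise, upd2_of_ne hrv] at hi ⊢
      exact h.ptr_pre r' v' i y' hi hy' hadj
  · by_cases hrv : r' = r ∧ v' = v
    · obtain ⟨rfl, rfl⟩ := hrv
      exact .inr (List.mem_append_left _ hs)
    rcases h.work r' v' hv' with (rfl | hL | ⟨hD, z, hz, hzl⟩ | ⟨y, hy, hadj, hyl⟩) | hs'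
    · exact .inl (.inl rfl)
    · exact .inl (.inr (.inl (hL.trans (hmono _ _))))
    -- The level just raised was the one read through the center `z = r`; such a pair is among the
    -- second kind of dependents.
    · by_cases hzr : z = r ∧ r' = v
      · obtain ⟨rfl, rfl⟩ := hzr
        refine .inr (List.mem_append_right _ (List.mem_append_right _ ?_))
        have := h.zp_ok v' hv' z hz
        rw [this.2, cond_true]
        exact List.mem_map.2 ⟨v', h.mem_sl _ _ this.1.symm, rfl⟩
      · refine .inl (.inr (.inr (.inl ⟨hD, z, hz, ?_⟩)))
        simpa [Conf.raise, upd2_of_ne hzr, upd2_of_ne hrv] using hzl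
    · by_cases hyr : r' = r ∧ y = v
      · obtain ⟨rfl, rfl⟩ := hyr
        refine .inr (List.mem_append_right _ (List.mem_append_left _ ?_))
        exact List.mem_map.2 ⟨v', (h.mem_dl _ _ _).1 (List.mem_of_getElem? hy), rfl⟩
      · refine .inl (.inr (.inr (.inr ⟨y, ?_, hadj, ?_⟩)))
        · simpa [Conf.raise, upd2_of_ne hrv] using hy
        · simpa [Conf.raise, upd2_of_ne hrv, upd2_of_ne hyr] using hyl
    · exact .inr (List.mem_append_left _ hs')

end Conf.Inv

/-! ### Amortization of the main loop -/

namespace Conf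
variable {n L : ℕ} {c : Conf n}

theorem pot_pop {l r v} (hs : c.stk = l ++ [(r, v)]) :
    ({ c with stk := l } : Conf n).pot L + 1 ≤ c.pot L := by
  simp only [pot, hs, List.length_append, List.length_singleton]
  have : ∀ p : Fin n × Fin n, ({ c with stk := l } : Conf n).pairPot L p.1 p.2
    = c.pairPot L p.1 p.2 := fun _ => rfl
  simp only [this]
  omega

theorem pot_advance {r v} (hlt : c.ptr r v < (c.sl (c.D r) v).length) :
    (c.advance r v).pot L + 1 ≤ c.pot L := by
  have : ∑ p : Fin n × Fin n, (c.advance r v).pairPot L p.1 p.2 + 1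
      ≤ ∑ p : Fin n × Fin n, c.pairPot L p.1 p.2 := by
    refine sum_add_le_sum (r, v) (fun p hp => le_of_eq ?_) ?_
    · have : ¬ (p.1 = r ∧ p.2 = v) := fun h => hp (Prod.ext h.1 h.2)
      simp [pairPot, advance, upd2_of_ne this, wt, deps]
    · simp only [pairPot, advance, upd2_self, wt, deps]
      omega
  simp only [pot] at this ⊢
  simp only [advance] at this ⊢
  omega

/-- The pair gives up one copy of `wt`. Its list length pays for resetting the scan position to `0`,
one of its two multiples of the dependents pays for the growth of the stack, and the rest, `1 +
(c.deps r v).length`, is left for the running time. -/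
theorem pot_raise {r v} (hlt : c.lev r v < L) :
    (c.raise r v).pot L + (1 + (c.deps r v).length) ≤ c.pot L := by
  have : ∑ p : Fin n × Fin n, (c.raise r v).pairPot L p.1 p.2 + (1 + 2 * (c.deps r v).length)
      ≤ ∑ p : Fin n × Fin n, c.pairPot L p.1 p.2 := by
    refine sum_add_le_sum (r, v) (fun p hp => le_of_eq ?_) ?_
    · have : ¬ (p.1 = r ∧ p.2 = v) := fun h => hp (Prod.ext h.1 h.2)
      simp [pairPot, raise, upd2_of_ne this, wt, deps]
    · have hw : (c.raise r v).wt r v = c.wt r v := rfl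
      have hd : (L - c.lev r v) * c.wt r v = (L - (c.lev r v + 1)) * c.wt r v + c.wt r v := by
        rw [← Nat.succ_mul]; congr 1; omega
      simp only [pairPot, hw, hd]
      simp only [raise, upd2_self]
      simp only [wt]
      omega
  simp only [pot] at this ⊢
  have hl : (c.raise r v).stk.length = c.stk.length + (c.deps r v).length := by simp [raise]
  rw [hl]
  omega

end Conf

/-! ## Memory layout

Registers `3, 4, 5, 6` hold `n`, the level cap, the height of the stack and the number of centers.
Registers from `7` on are temporary. -/

/-- The state `s` stores the configuration `c`. -/
structure Rep {n : ℕ} (L : ℕ) (c : Conf n) (s : State) : Prop where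
  reg_n : s.reg 3 = n
  reg_L : s.reg 4 = L
  reg_sp : s.reg 5 = c.stk.length
  reg_cd : s.reg 6 = c.ds.length
  alive : ∀ u v : Fin n, (c.G.Adj u v ∧ s.arr 2 (u * n + v) = 1) ∨
    (¬ c.G.Adj u v ∧ s.arr 2 (u * n + v) = 0)
  inD : ∀ u : Fin n, s.arr 3 u = (c.D u).toNat
  ds : ∀ (i : ℕ) y, c.ds[i]? = some y → s.arr 4 i = y
  slc : ∀ b (v : Fin n), s.arr 6 (b.toNat * n + v) = (c.sl b v).length
  sl : ∀ b (v : Fin n) (i : ℕ) y, (c.sl b v)[i]? = some y →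
    s.arr 5 ((b.toNat * n + v) * n + i) = y
  dlc : ∀ b (v : Fin n), s.arr 8 (b.toNat * n + v) = (c.dl b v).length
  dl : ∀ b (v : Fin n) (i : ℕ) y, (c.dl b v)[i]? = some y →
    s.arr 7 ((b.toNat * n + v) * n + i) = y
  zp : ∀ v : Fin n, s.arr 9 v = c.zp v
  lev : ∀ r v : Fin n, s.arr 10 (r * n + v) = c.lev r v
  ptr : ∀ r v : Fin n, s.arr 11 (r * n + v) = c.ptr r v
  stk : ∀ (i : ℕ) p, c.stk[i]? = some p → s.arr 12 i = p.1 * n + p.2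

theorem Rep.congr {n L : ℕ} {c : Conf n} {s s' : State} (h : Rep L c s)
    (hr : ∀ k, 3 ≤ k → k ≤ 6 → s'.reg k = s.reg k) (ha : ∀ a, 2 ≤ a → s'.arr a = s.arr a) :
    Rep L c s' where
  reg_n := by rw [hr 3 (by norm_num) (by norm_num), h.reg_n]
  reg_L := by rw [hr 4 (by norm_num) (by norm_num), h.reg_L]
  reg_sp := by rw [hr 5 (by norm_num) (by norm_num), h.reg_sp]
  reg_cd := by rw [hr 6 (by norm_num) (by norm_num), h.reg_cd]
  alive := by rw [ha 2 (by norm_num)]; exact h.alive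
  inD := by rw [ha 3 (by norm_num)]; exact h.inD
  ds := by rw [ha 4 (by norm_num)]; exact h.ds
  slc := by rw [ha 6 (by norm_num)]; exact h.slc
  sl := by rw [ha 5 (by norm_num)]; exact h.sl
  dlc := by rw [ha 8 (by norm_num)]; exact h.dlc
  dl := by rw [ha 7 (by norm_num)]; exact h.dl
  zp := by rw [ha 9 (by norm_num)]; exact h.zp
  lev := by rw [ha 10 (by norm_num)]; exact h.lev
  ptr := by rw [ha 11 (by norm_num)]; exact h.ptr
  stk := by rw [ha 12 (by norm_num)]; exact h.stk

theorem Rep.setReg {n L : ℕ} {c : Conf n} {s : State} (h : Rep L c s) {k x : ℕ}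
    (hk : k < 3 ∨ 6 < k) : Rep L c (s.setReg k x) :=
  h.congr (fun j _ _ => by rw [State.reg_setReg, if_neg (by omega)]) fun _ _ => rfl

/-- Row-major index expression. -/
def idx (a b : Expr) : Expr := a * .reg 3 + b

@[simp] theorem cost_idx (a b : Expr) : (idx a b).cost = a.cost + b.cost + 3 := by
  simp [idx]; ring

theorem eval_idx {n w : ℕ} (hf : Fits n w) {s : State} (hn : s.reg 3 = n) {a b : Expr} {x y : ℕ}
    (ha : a.eval w s = x) (hx : x < 2 * n) (hb : b.eval w s = y) (hy : y < n) :
    (idx a b).eval w s = x * n + y := by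
  simp only [idx, Expr.eval_add, Expr.eval_mul, Expr.eval_reg, ha, hb, hn]
  exact hf.idx_mod hx hy

theorem bidx_lt {n : ℕ} (b : Bool) (v : Fin n) : b.toNat * n + v < 2 * n := by
  have := v.2
  cases b <;> simp <;> omega

theorem Fin.lt_two_mul {n : ℕ} (v : Fin n) : (v : ℕ) < 2 * n := by
  have := v.2; omega

theorem bidx_inj {n : ℕ} {b b' : Bool} {v v' : Fin n} :
    b.toNat * n + (v : ℕ) = b'.toNat * n + v' ↔ b = b' ∧ v = v' := by
  rw [idx_inj v.2 v'.2, Fin.val_inj]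
  cases b <;> cases b' <;> simp

/-! ## Pushing lists of pairs on the stack -/

/-- `s'` differs from `s` only in the registers `5` and `10` and the stack. -/
structure StackExt (s s' : State) : Prop where
  reg : ∀ k, k ≠ 5 → k ≠ 10 → s'.reg k = s.reg k
  arr : ∀ a, a ≠ 12 → s'.arr a = s.arr a
  pos : s'.pos = s.pos

theorem Rep.push {n L : ℕ} {c : Conf n} {s s' : State} (h : Rep L c s) (hE : StackExt s s')
    {l : List (Fin n × Fin n)} (hsp : s'.reg 5 = c.stk.length + l.length)
    (hstk : ∀ (i : ℕ) p, (c.stk ++ l)[i]? = some p → s'.arr 12 i = p.1 * n + p.2) :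
    Rep L { c with stk := c.stk ++ l } s' where
  reg_n := by rw [hE.reg 3 (by norm_num) (by norm_num), h.reg_n]
  reg_L := by rw [hE.reg 4 (by norm_num) (by norm_num), h.reg_L]
  reg_sp := by simp [hsp]
  reg_cd := by rw [hE.reg 6 (by norm_num) (by norm_num), h.reg_cd]
  alive := by rw [hE.arr 2 (by norm_num)]; exact h.alive
  inD := by rw [hE.arr 3 (by norm_num)]; exact h.inD
  ds := by rw [hE.arr 4 (by norm_num)]; exact h.ds
  slc := by rw [hE.arr 6 (by norm_num)]; exact h.slc
  sl := by rw [hE.arr 5 (by norm_num)]; exact h.sl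
  dlc := by rw [hE.arr 8 (by norm_num)]; exact h.dlc
  dl := by rw [hE.arr 7 (by norm_num)]; exact h.dl
  zp := by rw [hE.arr 9 (by norm_num)]; exact h.zp
  lev := by rw [hE.arr 10 (by norm_num)]; exact h.lev
  ptr := by rw [hE.arr 11 (by norm_num)]; exact h.ptr
  stk := hstk

/-- Push the values of `e` for the values `0, …, cnt - 1` of register `10`. -/
def pushLoop (cnt e : Expr) : Prog :=
  .assign 10 0 ;;
  .while (.bin .lt (.reg 10) cnt)
    (.store 12 (.reg 5) e ;; .assign 5 (.reg 5 + 1) ;; .assign 10 (.reg 10 + 1))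

/-- `cnt` and `e` are evaluated afresh in each iteration, hence the hypotheses about all states `s'`
that differ from `s` only in what the loop itself changes. -/
theorem wp_pushLoop {n w L : ℕ} {ω : Tape} (hf : Fits n w) {c : Conf n} {s : State} (hR : Rep L c s)
    {cnt e : Expr} (l : List (Fin n × Fin n)) (hlen : c.stk.length + l.length < 2 ^ w)
    (hcnt : ∀ s', StackExt s s' → cnt.eval w s' = l.length)
    (he : ∀ s' i p, StackExt s s' → s'.reg 10 = i → l[i]? = some p →
      e.eval w s' = p.1 * n + p.2) :
    WP w ω (pushLoop cnt e) s fun t s' => StackExt s s' ∧ Rep L { c with stk := c.stk ++ l } s' ∧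
      t ≤ (l.length + 1) * (cnt.cost + e.cost + 20) := by
  refine WP.seq (WP.assign ?_)
  refine (WP.for (n := l.length) (i := 0) (B := e.cost + 10)
    (I := fun i s' => StackExt s s' ∧ s'.reg 10 = i ∧ s'.reg 5 = c.stk.length + i ∧ i ≤ l.length ∧
      ∀ (j : ℕ) p, (c.stk ++ l.take i)[j]? = some p → s'.arr 12 j = p.1 * n + p.2)
    (Nat.zero_le _) ?_ ?_ ?_).mono ?_
  · refine ⟨⟨fun k h1 h2 => by simp [h2], fun a _ => rfl, rfl⟩, by simp, by simp [hR.reg_sp],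
      Nat.zero_le _, ?_⟩
    simpa using hR.stk
  · rintro i s' ⟨hE, h10, h5, hi, hst⟩
    simp [hcnt s' hE, h10, hf.one_mod]
  · rintro i s' ⟨hE, h10, h5, hi, hst⟩ hlt
    obtain ⟨p, hp⟩ : ∃ p, l[i]? = some p := ⟨_, List.getElem?_eq_getElem hlt⟩
    refine WP.seq (WP.store (WP.seq (WP.assign (WP.assign ⟨⟨⟨?_, ?_, ?_⟩, ?_, ?_, hlt, ?_⟩, ?_⟩))))
    · intro k h1 h2; simp [h1, h2, hE.reg k h1 h2]
    · intro a ha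
      funext j
      simp [ha, hE.arr a ha]
    · simp [hE.pos]
    · simp [h10, hf.one_mod]; exact Nat.mod_eq_of_lt (by omega)
    · simp [h5, hf.one_mod]; exact Nat.mod_eq_of_lt (by omega)
    · intro j q hq
      rw [List.take_add_one, hp, ← List.append_assoc] at hq
      simp only [State.arr_setReg, State.arr_setArr, Expr.eval_reg, h5, true_and]
      have hlen' : (c.stk ++ l.take i).length = c.stk.length + i := by
        simp; omega
      by_cases hj : j = c.stk.length + i
      · rw [if_pos hj, he s' i p hE h10 hp]
        rw [hj, ← hlen'] at hq
        simp at hq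
        rw [hq]
      · rw [if_neg hj]
        apply hst
        have : j < (c.stk ++ l.take i).length := by
          have := (List.getElem?_eq_some_iff.1 hq).1
          rw [List.length_append, hlen'] at this
          simp at this
          omega
        rw [List.getElem?_append_left this] at hq
        exact hq
    · simp; omega
  · rintro t s' ⟨⟨hE, h10, h5, -, hst⟩, ht⟩
    rw [List.take_length] at hst
    refine ⟨hE, hR.push hE h5 hst, ?_⟩
    simp at ht ⊢
    have : l.length * (e.cost + 10 + (1 + cnt.cost + 1) + 1) ≤ l.length * (cnt.cost + e.cost + 20) :=
      Nat.mul_le_mul_left _ (by omega)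
    rw [Nat.succ_mul]
    omega

/-! ## Appending an arc to the lists -/

/-- Append `y` to the scan list of `x` and `x` to the list of dependents of `y`. -/
def Conf.app {n : ℕ} (c : Conf n) (b : Bool) (x y : Fin n) : Conf n :=
  { c with
    sl := upd2 c.sl b x (c.sl b x ++ [y])
    dl := upd2 c.dl b y (c.dl b y ++ [x]) }

/-- The program for `Conf.app`; the arguments are the expressions for the two rows and vertices. -/
def appProg (kx ky x y : Expr) : Prog :=
  .store 5 (idx kx (.load 6 kx)) y ;; .store 6 kx (.load 6 kx + 1) ;;
  .store 7 (idx ky (.load 8 ky)) x ;; .store 8 ky (.load 8 ky + 1)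

/-- Rows have capacity `n` and no list is longer than that, so writing to the first free cell of one
row cannot hit another row. -/
theorem append_row {n : ℕ} {α : Type*} (f : α → ℕ) {A : ℕ → ℕ} {l : Bool → Fin n → List α}
    (hlen : ∀ b v, (l b v).length ≤ n)
    (h : ∀ b (v : Fin n) (i : ℕ) y, (l b v)[i]? = some y → A ((b.toNat * n + v) * n + i) = f y)
    {b : Bool} {x : Fin n} {y : α} (hx : (l b x).length < n)
    (b' : Bool) (v : Fin n) (i : ℕ) (z : α) (hz : (upd2 l b x (l b x ++ [y]) b' v)[i]? = some z) :
    (if (b'.toNat * n + v) * n + i = (b.toNat * n + x) * n + (l b x).length then f y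
      else A ((b'.toNat * n + v) * n + i)) = f z := by
  by_cases hbv : b' = b ∧ v = x
  · obtain ⟨rfl, rfl⟩ := hbv
    rw [upd2_self] at hz
    by_cases hi : i = (l b' v).length
    · subst hi
      simp at hz
      simp [hz]
    · have hlt := (List.getElem?_eq_some_iff.1 hz).1
      simp at hlt
      rw [List.getElem?_append_left (by omega)] at hz
      rw [if_neg (by omega)]
      exact h _ _ _ _ hz
  · rw [upd2_of_ne hbv] at hz
    have hlt := (List.getElem?_eq_some_iff.1 hz).1
    have := hlen b' v
    rw [if_neg, h _ _ _ _ hz]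
    rw [idx_inj (by omega) hx, bidx_inj]
    exact fun h => hbv h.1

theorem count_row {n : ℕ} {α : Type*} {A : ℕ → ℕ} {l : Bool → Fin n → List α}
    (h : ∀ b (v : Fin n), A (b.toNat * n + v) = (l b v).length) {b : Bool} {x : Fin n} {y : α}
    (b' : Bool) (v : Fin n) :
    (if b'.toNat * n + v = b.toNat * n + x then (l b x).length + 1 else A (b'.toNat * n + v)) =
      (upd2 l b x (l b x ++ [y]) b' v).length := by
  by_cases hbv : b' = b ∧ v = x
  · rw [if_pos (bidx_inj.2 hbv)]; obtain ⟨rfl, rfl⟩ := hbv; simp [upd2_self]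
  · rw [if_neg (fun h => hbv (bidx_inj.1 h)), upd2_of_ne hbv, h]

/-- The two states differ at most in the arrays `5, …, 8`. -/
def ListExt (s s' : State) : Prop :=
  s'.reg = s.reg ∧ s'.pos = s.pos ∧ ∀ a, a < 5 ∨ 8 < a → s'.arr a = s.arr a

theorem wp_appProg {n w L : ℕ} {ω : Tape} (hf : Fits n w) {c : Conf n} {s : State} (hR : Rep L c s)
    {b : Bool} {x y : Fin n} {ekx eky ex ey : Expr}
    (hkx : ∀ s', ListExt s s' → ekx.eval w s' = b.toNat * n + x)
    (hky : ∀ s', ListExt s s' → eky.eval w s' = b.toNat * n + y)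
    (hx : ∀ s', ListExt s s' → ex.eval w s' = x) (hy : ∀ s', ListExt s s' → ey.eval w s' = y)
    (hsl : ∀ b v, (c.sl b v).length ≤ n) (hdl : ∀ b v, (c.dl b v).length ≤ n)
    (hslx : (c.sl b x).length < n) (hdly : (c.dl b y).length < n) :
    WP w ω (appProg ekx eky ex ey) s fun t s' => ListExt s s' ∧ Rep L (c.app b x y) s' ∧
      t ≤ 4 * (ekx.cost + eky.cost + ex.cost + ey.cost + 10) := by
  have hE0 : ListExt s s := ⟨rfl, rfl, fun _ _ => rfl⟩
  have hE1 : ∀ {s₁} a i v, ListExt s s₁ → 5 ≤ a → a ≤ 8 → ListExt s (s₁.setArr a i v) := by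
    rintro s₁ a i v ⟨h1, h2, h3⟩ ha ha'
    refine ⟨by simp [h1], by simp [h2], fun k hk => ?_⟩
    funext j
    rw [State.arr_setArr, if_neg (by omega), h3 k hk]
  have hlen : ∀ {m}, m < n → (m + 1) % 2 ^ w = m + 1 := fun h =>
    Nat.mod_eq_of_lt (hf.lt_sq (by nlinarith))
  have e1 : (idx ekx (.load 6 ekx)).eval w s = (b.toNat * n + x) * n + (c.sl b x).length :=
    eval_idx hf hR.reg_n (hkx s hE0) (bidx_lt b x) (by simp [hkx s hE0, hR.slc]) hslx
  refine WP.seq (WP.store ?_)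
  rw [e1, hy s hE0]
  set s₁ := s.setArr 5 ((b.toNat * n + x) * n + (c.sl b x).length) y with hs₁
  have hE₁ : ListExt s s₁ := hE1 _ _ _ hE0 (by norm_num) (by norm_num)
  have e2 : (Expr.load 6 ekx + 1).eval w s₁ = (c.sl b x).length + 1 := by
    simp only [Expr.eval_add, Expr.eval_load, Expr.eval_ofNat, hkx s₁ hE₁, hf.one_mod]
    simp [hs₁, hR.slc, hlen hslx]
  refine WP.seq (WP.store ?_)
  rw [hkx s₁ hE₁, e2]
  set s₂ := s₁.setArr 6 (b.toNat * n + x) ((c.sl b x).length + 1) with hs₂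
  have hE₂ : ListExt s s₂ := hE1 _ _ _ hE₁ (by norm_num) (by norm_num)
  have e3 : (idx eky (.load 8 eky)).eval w s₂ = (b.toNat * n + y) * n + (c.dl b y).length :=
    eval_idx hf (by simp [hs₂, hs₁, hR.reg_n]) (hky s₂ hE₂) (bidx_lt b y)
      (by rw [Expr.eval_load, hky s₂ hE₂]; simp [hs₂, hs₁, hR.dlc]) hdly
  refine WP.seq (WP.store ?_)
  rw [e3, hx s₂ hE₂]
  set s₃ := s₂.setArr 7 ((b.toNat * n + y) * n + (c.dl b y).length) x with hs₃
  have hE₃ : ListExt s s₃ := hE1 _ _ _ hE₂ (by norm_num) (by norm_num)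
  have e4 : (Expr.load 8 eky + 1).eval w s₃ = (c.dl b y).length + 1 := by
    simp only [Expr.eval_add, Expr.eval_load, Expr.eval_ofNat, hky s₃ hE₃, hf.one_mod]
    simp [hs₁, hs₂, hs₃, hR.dlc, hlen hdly]
  refine WP.store ?_
  rw [hky s₃ hE₃, e4]
  refine ⟨hE1 _ _ _ hE₃ (by norm_num) (by norm_num), ?_, by simp; omega⟩
  constructor
  · simp [hs₁, hs₂, hs₃, hR.reg_n]
  · simp [hs₁, hs₂, hs₃, hR.reg_L]
  · simp [hs₁, hs₂, hs₃, hR.reg_sp, Conf.app]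
  · simp [hs₁, hs₂, hs₃, hR.reg_cd, Conf.app]
  · simpa [hs₁, hs₂, hs₃, Conf.app] using hR.alive
  · simpa [hs₁, hs₂, hs₃, Conf.app] using hR.inD
  · simpa [hs₁, hs₂, hs₃, Conf.app] using hR.ds
  · simpa [hs₁, hs₂, hs₃, Conf.app] using count_row hR.slc
  · simpa [hs₁, hs₂, hs₃, Conf.app] using append_row (fun y : Fin n => (y : ℕ)) hsl hR.sl hslx
  · simpa [hs₁, hs₂, hs₃, Conf.app] using count_row hR.dlc
  · simpa [hs₁, hs₂, hs₃, Conf.app] using append_row (fun y : Fin n => (y : ℕ)) hdl hR.dl hdly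
  · simpa [hs₁, hs₂, hs₃, Conf.app] using hR.zp
  · simpa [hs₁, hs₂, hs₃, Conf.app] using hR.lev
  · simpa [hs₁, hs₂, hs₃, Conf.app] using hR.ptr
  · simpa [hs₁, hs₂, hs₃, Conf.app] using hR.stk

/-! ## The main loop -/

/-- The row of the scan list of the current pair. -/
def rowE : Expr := idx (.reg 23) (.reg 22)

def popProg : Prog := .assign 5 (.reg 5 - 1)

def advanceProg : Prog := .store 11 (.reg 20) (.load 11 (.reg 20) + 1)

def raiseProg : Prog :=
  .store 10 (.reg 20) (.load 10 (.reg 20) + 1) ;; .store 11 (.reg 20) 0 ;;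
  pushLoop (.load 8 rowE) (idx (.reg 21) (.load 7 (idx rowE (.reg 10)))) ;;
  .ite (.reg 23)
    (pushLoop (.load 6 (idx 1 (.reg 21)))
      (idx (.reg 22) (.load 5 (idx (idx 1 (.reg 21)) (.reg 10))))) .skip

/-- Check the pair on the top of the stack. -/
def checkProg : Prog :=
  .assign 20 (.load 12 (.reg 5 - 1)) ;; .assign 21 (.reg 20 / .reg 3) ;;
  .assign 22 (.reg 20 % .reg 3) ;; .assign 23 (.load 3 (.reg 21)) ;;
  .ite (.bin .eq (.reg 21) (.reg 22) + (1 - .bin .lt (.load 10 (.reg 20)) (.reg 4)))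
    popProg
    (.ite ((1 - .reg 23) * .bin .lt (.load 9 (.reg 22)) (.load 6 (idx 1 (.reg 22))))
      (.ite (.bin .lt (.load 10 (idx (.load 5 (idx (idx 1 (.reg 22)) (.load 9 (.reg 22))))
          (.reg 21))) (.load 10 (.reg 20)))
        popProg raiseProg)
      (.ite (.bin .lt (.load 11 (.reg 20)) (.load 6 rowE))
        (.assign 24 (.load 5 (idx rowE (.load 11 (.reg 20)))) ;;
          .ite (.load 2 (idx (.reg 22) (.reg 24)) *
              .bin .lt (.load 10 (idx (.reg 21) (.reg 24))) (.load 10 (.reg 20)))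
            popProg advanceProg)
        raiseProg))

def runProg : Prog := .while (.reg 5) checkProg

/-- The two configurations differ at most in the levels, the scan positions and the stack. -/
def Conf.SameLists {n : ℕ} (c c' : Conf n) : Prop :=
  c' = { c with lev := c'.lev, ptr := c'.ptr, stk := c'.stk }

/-- The state `s` stores `c`, and the pair `(r, v)` in registers. -/
structure Top {n : ℕ} (L : ℕ) (c : Conf n) (r v : Fin n) (s : State) : Prop where
  rep : Rep L c s
  r20 : s.reg 20 = r * n + v
  r21 : s.reg 21 = r
  r22 : s.reg 22 = v
  r23 : s.reg 23 = (c.D r).toNat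

/-! ### Verification of the main loop -/

section
variable {n w L : ℕ} {ω : Tape} {c : Conf n} {s : State} {r v : Fin n}

theorem upd2_idx (f : Fin n → Fin n → ℕ) {A : ℕ → ℕ} (h : ∀ r v : Fin n, A (r * n + v) = f r v)
    (r v : Fin n) (x : ℕ) (r' v' : Fin n) :
    (if (r' : ℕ) * n + v' = r * n + v then x else A (r' * n + v')) = upd2 f r v x r' v' := by
  simp only [idx_inj v'.2 v.2, Fin.val_inj, upd2, h]

theorem Rep.setLev (h : Rep L c s) (x : ℕ) :
    Rep L { c with lev := upd2 c.lev r v x } (s.setArr 10 (r * n + v) x) :=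
  { h with lev := by simpa using upd2_idx c.lev h.lev r v x }

theorem Rep.setPtr (h : Rep L c s) (x : ℕ) :
    Rep L { c with ptr := upd2 c.ptr r v x } (s.setArr 11 (r * n + v) x) :=
  { h with ptr := by simpa using upd2_idx c.ptr h.ptr r v x }

theorem wp_pop (hf : Fits n w) (hT : Rep L c s) {l} (hs : c.stk = l ++ [(r, v)]) :
    WP w ω popProg s fun t s' => Rep L { c with stk := l } s' ∧ t ≤ 4 := by
  refine WP.assign ⟨?_, by simp⟩
  have h5 : (Expr.reg 5 - 1).eval w s = l.length := by
    simp [hT.reg_sp, hs, hf.one_mod]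
  rw [h5]
  exact { hT with
    reg_sp := by simp
    stk := fun i p hp => hT.stk i p (by
      rw [hs, List.getElem?_append_left (List.getElem?_eq_some_iff.1 hp).1]; exact hp) }

theorem wp_advance (hf : Fits n w) (hT : Top L c r v s) (hptr : c.ptr r v < n) :
    WP w ω advanceProg s fun t s' => Rep L (c.advance r v) s' ∧ t ≤ 10 := by
  have hlt : (c.ptr r v + 1) % 2 ^ w = c.ptr r v + 1 :=
    Nat.mod_eq_of_lt (hf.lt_sq (by nlinarith))
  refine WP.store ⟨?_, by simp⟩
  have e : (Expr.load 11 (.reg 20) + 1).eval w s = c.ptr r v + 1 := by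
    simp [hT.r20, hT.rep.ptr, hf.one_mod, hlt]
  rw [e, Expr.eval_reg, hT.r20]
  exact hT.rep.setPtr _

theorem Top.of_stackExt {c' : Conf n} {s' : State} (hT : Top L c r v s) (hE : StackExt s s')
    (hR : Rep L c' s') (hD : c'.D = c.D) : Top L c' r v s' where
  rep := hR
  r20 := by rw [hE.reg 20 (by norm_num) (by norm_num), hT.r20]
  r21 := by rw [hE.reg 21 (by norm_num) (by norm_num), hT.r21]
  r22 := by rw [hE.reg 22 (by norm_num) (by norm_num), hT.r22]
  r23 := by rw [hE.reg 23 (by norm_num) (by norm_num), hT.r23, hD]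

theorem eval_row (hf : Fits n w) (h3 : s.reg 3 = n) {b : Bool} (h23 : s.reg 23 = b.toNat)
    (h22 : s.reg 22 = v) : rowE.eval w s = b.toNat * n + v :=
  eval_idx hf h3 (by simp [h23]) (by have := v.2; cases b <;> simp <;> omega) (by simp [h22]) v.2

theorem eval_row_true (hf : Fits n w) {s : State} (hn : s.reg 3 = n) {e : Expr} {x : Fin n}
    (he : e.eval w s = x) : (idx 1 e).eval w s = true.toNat * n + x :=
  eval_idx hf hn (by simp [hf.one_mod]) (by have := x.2; simp; omega) he x.2

theorem wp_raise (hf : Fits n w) (hL : L ≤ n + 3) (hT : Top L c r v s) (hlt : c.lev r v < L)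
    (hlen : c.stk.length + (c.deps r v).length < 2 ^ w) (hsl : ∀ b v, (c.sl b v).length ≤ n)
    (hdl : ∀ b v, (c.dl b v).length ≤ n) :
    WP w ω raiseProg s fun t s' => Rep L (c.raise r v) s' ∧
      t ≤ 200 * (1 + (c.deps r v).length) := by
  have hlev : (Expr.load 10 (.reg 20) + 1).eval w s = c.lev r v + 1 := by
    have : (c.lev r v + 1) % 2 ^ w = c.lev r v + 1 :=
      Nat.mod_eq_of_lt (hf.lt_sq (by nlinarith))
    simp [hT.r20, hT.rep.lev, hf.one_mod, this]
  refine WP.seq (WP.store (WP.seq (WP.store (WP.seq ?_))))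
  rw [hlev]
  simp only [Expr.eval_reg, State.reg_setArr, hT.r20, Expr.eval_ofNat, Nat.zero_mod]
  set c₁ : Conf n := { c with lev := upd2 c.lev r v (c.lev r v + 1), ptr := upd2 c.ptr r v 0 }
    with hc₁
  set s₁ := (s.setArr 10 (r * n + v) (c.lev r v + 1)).setArr 11 (r * n + v) 0 with hs₁
  have hT₁ : Top L c₁ r v s₁ :=
    ⟨(hT.rep.setLev (c.lev r v + 1)).setPtr 0, hT.r20, hT.r21, hT.r22, hT.r23⟩
  have hdeps : (c.deps r v).length =
      (c.dl (c.D r) v).length + (bif c.D r then (c.sl true r).length else 0) := by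
    cases h : c.D r <;> simp [Conf.deps, h]
  refine (wp_pushLoop hf hT₁.rep ((c.dl (c.D r) v).map fun y => (r, y)) ?_ ?_ ?_).mono ?_
  · simp [hc₁]; omega
  · intro s' hE
    rw [Expr.eval_load, eval_row hf ((hE.reg 3 (by norm_num) (by norm_num)).trans hT₁.rep.reg_n)
      ((hE.reg 23 (by norm_num) (by norm_num)).trans hT₁.r23)
      ((hE.reg 22 (by norm_num) (by norm_num)).trans hT₁.r22), hE.arr 8 (by norm_num),
      hT₁.rep.dlc, List.length_map]
  · intro s' i p hE hi hp
    obtain ⟨y, hy, rfl⟩ : ∃ y, (c.dl (c.D r) v)[i]? = some y ∧ (r, y) = p := by simpa using hp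
    have h3 := (hE.reg 3 (by norm_num) (by norm_num)).trans hT₁.rep.reg_n
    have hin : i < n := (List.getElem?_eq_some_iff.1 hy).1.trans_le (hdl _ _)
    refine eval_idx hf h3 ((hE.reg 21 (by norm_num) (by norm_num)).trans hT₁.r21)
      (Fin.lt_two_mul r) ?_ y.2
    rw [Expr.eval_load, eval_idx (b := .reg 10) hf h3 (eval_row hf h3
      ((hE.reg 23 (by norm_num) (by norm_num)).trans hT₁.r23)
      ((hE.reg 22 (by norm_num) (by norm_num)).trans hT₁.r22)) (bidx_lt _ _) hi hin,
      hE.arr 7 (by norm_num)]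
    exact hT₁.rep.dl _ _ _ _ hy
  rintro t₁ s₂ ⟨hE, hR₂, ht₁⟩
  set c₂ : Conf n := { c₁ with stk := c₁.stk ++ (c.dl (c.D r) v).map fun y => (r, y) } with hc₂
  have hT₂ : Top L c₂ r v s₂ := hT₁.of_stackExt hE hR₂ rfl
  -- Only a center root has dependents of the second kind, those that use it as an adjacent center.
  refine WP.ite (fun h23 => ?_) (fun h23 => WP.skip ?_)
  · have hD : c.D r = true := by
      rw [Expr.eval_reg, hT₂.r23] at h23
      revert h23
      change (c.D r).toNat ≠ 0 → _
      cases c.D r <;> simp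
    refine (wp_pushLoop hf hT₂.rep ((c.sl true r).map fun y => (v, y)) ?_ ?_ ?_).mono ?_
    · simp [hc₁, hc₂]; simp [hD] at hdeps; rw [hD]; omega
    · intro s' hE'
      rw [Expr.eval_load, eval_row_true (e := .reg 21) hf ((hE'.reg 3 (by norm_num) (by norm_num)).trans
        hT₂.rep.reg_n) ((hE'.reg 21 (by norm_num) (by norm_num)).trans hT₂.r21),
        hE'.arr 6 (by norm_num), hT₂.rep.slc, List.length_map]
    · intro s' i p hE' hi hp
      obtain ⟨y, hy, rfl⟩ : ∃ y, (c.sl true r)[i]? = some y ∧ (v, y) = p := by simpa using hp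
      have h3 := (hE'.reg 3 (by norm_num) (by norm_num)).trans hT₂.rep.reg_n
      have hin : i < n := (List.getElem?_eq_some_iff.1 hy).1.trans_le (hsl _ _)
      refine eval_idx hf h3 ((hE'.reg 22 (by norm_num) (by norm_num)).trans hT₂.r22)
        (Fin.lt_two_mul v) ?_ y.2
      rw [Expr.eval_load, eval_idx (b := .reg 10) hf h3 (eval_row_true (e := .reg 21) hf h3
        ((hE'.reg 21 (by norm_num) (by norm_num)).trans hT₂.r21)) (bidx_lt _ _) hi hin,
        hE'.arr 5 (by norm_num)]
      exact hT₂.rep.sl _ _ _ _ hy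
    · rintro t₃ s₃ ⟨hE', hR₃, ht₃⟩
      refine ⟨?_, ?_⟩
      · simpa [hc₁, hc₂, Conf.raise, Conf.deps, hD] using hR₃
      · simp [rowE] at ht₁ ht₃ ⊢
        simp [hD] at hdeps ht₁
        rw [hdeps]
        nlinarith
  · have hD : c.D r = false := by
      rw [Expr.eval_reg, hT₂.r23] at h23
      revert h23
      change (c.D r).toNat = 0 → _
      cases c.D r <;> simp
    refine ⟨?_, ?_⟩
    · simpa [hc₁, hc₂, Conf.raise, Conf.deps, hD] using hT₂.rep
    · simp [rowE] at ht₁ ⊢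
      simp [hD] at hdeps ht₁
      rw [hdeps]
      nlinarith

/-- Each branch ends in a pop, an advance or a raise, and the corresponding drop of potential, times
`500`, pays for the branch and its tests. The surplus `10` covers the test of the surrounding loop.
-/
theorem wp_check (hf : Fits n w) (hL : L ≤ n + 3) (hR : Rep L c s) (hI : c.Inv L ∅ ∅)
    (hpot : c.pot L < 2 ^ w) (hne : c.stk ≠ []) :
    WP w ω checkProg s fun t s' => ∃ c', (Rep L c' s' ∧ c'.Inv L ∅ ∅ ∧ c.SameLists c') ∧
      t + 10 + 500 * c'.pot L ≤ 500 * c.pot L := by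
  obtain ⟨l, ⟨r, v⟩, hs⟩ := (List.eq_nil_or_concat c.stk).resolve_left hne
  rw [List.concat_eq_append] at hs
  have hmem : (r, v) ∈ c.stk := by simp [hs]
  have hn : 0 < n := r.pos
  have hsp : s.reg 5 - 1 = l.length := by simp [hR.reg_sp, hs]
  have hcode : s.arr 12 l.length = r * n + v := hR.stk _ (r, v) (by simp [hs])
  have hdiv : ((r : ℕ) * n + v) / n = r := by
    rw [Nat.add_comm, Nat.add_mul_div_right _ _ hn, Nat.div_eq_of_lt v.2, Nat.zero_add]
  have hmod : ((r : ℕ) * n + v) % n = v := by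
    rw [Nat.mul_add_mod', Nat.mod_eq_of_lt v.2]
  refine WP.seq (WP.assign (WP.seq (WP.assign (WP.seq (WP.assign (WP.seq (WP.assign ?_)))))))
  simp only [Expr.eval_load, Expr.eval_sub, Expr.eval_reg, Expr.eval_ofNat, hf.one_mod, hsp, hcode,
    Expr.eval_div, Expr.eval_mod, State.reg_setReg, State.arr_setReg, if_true, hR.reg_n, hdiv, hmod,
    Nat.reduceEqDiff, if_false, hR.inD]
  set s₁ := (((s.setReg 20 (r * n + v)).setReg 21 r).setReg 22 v).setReg 23 (c.D r).toNat with hs₁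
  have hT : Top L c r v s₁ :=
    ⟨((((hR.setReg (by norm_num)).setReg (by norm_num)).setReg (by norm_num)).setReg (by norm_num)),
      by simp [hs₁], by simp [hs₁], by simp [hs₁], by simp [hs₁]⟩
  clear_value s₁
  have h3 := hT.rep.reg_n
  -- Conditions are coded arithmetically: sums for disjunctions, products for conjunctions, `1 - _`
  -- for negations.
  have e1 : (Expr.bin .eq (.reg 21) (.reg 22) +
      (1 - .bin .lt (.load 10 (.reg 20)) (.reg 4))).eval w s₁ =
      (if r = v then 1 else 0) + (1 - if c.lev r v < L then 1 else 0) := by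
    simp only [Expr.eval_add, Expr.eval_sub, Expr.eval_eq, Expr.eval_lt, Expr.eval_reg,
      Expr.eval_load, Expr.eval_ofNat, hT.r20, hT.r21, hT.r22, hT.rep.reg_L, hT.rep.lev, hf.one_mod,
      Fin.val_inj]
    exact hf.small_mod (by split_ifs <;> norm_num)
  have hpop : c.OK L r v → WP w ω popProg s₁ fun t s' =>
      (∃ c', (Rep L c' s' ∧ c'.Inv L ∅ ∅ ∧ c.SameLists c') ∧ t + 300 + 500 * c'.pot L ≤
        500 * c.pot L) := fun hOK => by
    refine (wp_pop hf hT.rep hs).mono ?_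
    rintro t s' ⟨hR', ht⟩
    have := Conf.pot_pop (L := L) hs
    exact ⟨_, ⟨hR', hI.pop hs hOK, rfl⟩, by omega⟩
  have hraise : r ≠ v → c.lev r v < L →
      ((c.D r = false ∧ ∃ z, (c.sl true v)[c.zp v]? = some z ∧ c.lev r v ≤ c.lev z r) ∨
      ((c.D r = false → (c.sl true v).length ≤ c.zp v) ∧ (c.sl (c.D r) v).length ≤ c.ptr r v)) →
      WP w ω raiseProg s₁ fun t s' =>
      (∃ c', (Rep L c' s' ∧ c'.Inv L ∅ ∅ ∧ c.SameLists c') ∧ t + 300 + 500 * c'.pot L ≤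
        500 * c.pot L) := fun hrv hlt h => by
    have hp := Conf.pot_raise (c := c) hlt
    refine (wp_raise hf hL hT hlt ?_ hI.length_sl_le hI.length_dl_le).mono ?_
    -- The stack height is a summand of the potential, so the raised configuration's stack fits in a
    -- word because its potential is below the old one.
    · have : (c.raise r v).stk.length ≤ (c.raise r v).pot L := Nat.le_add_right _ _
      simp [Conf.raise] at this
      change _ ≤ (c.raise r v).pot L at this
      omega
    · rintro t s' ⟨hR', ht⟩
      exact ⟨_, ⟨hR', hI.raise hmem hrv hlt h, rfl⟩, by omega⟩
  refine WP.ite (fun h1 => ?_) (fun h1 => ?_)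
  · rw [e1] at h1
    refine (hpop ?_).mono ?_
    · split_ifs at h1 with ha hb hb
      · exact .inl ha
      · exact .inl ha
      · omega
      · exact .inr (.inl (by omega))
    · rintro t s' ⟨c', hc', ht⟩
      refine ⟨c', hc', ?_⟩
      simp only [Expr.cost_load, Expr.cost_reg, Expr.cost_add, Expr.cost_sub, Expr.cost_bin,
        Expr.cost_div, Expr.cost_mod, Expr.cost_ofNat]
      omega
  rw [e1] at h1
  have hrv : r ≠ v := fun h => by simp [h] at h1
  have hlt : c.lev r v < L := by
    by_contra h; simp [h] at h1
  have h1v : (idx 1 (.reg 22)).eval w s₁ = true.toNat * n + v :=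
    eval_row_true (e := .reg 22) hf h3 hT.r22
  have e2 : ((1 - Expr.reg 23) * .bin .lt (.load 9 (.reg 22)) (.load 6 (idx 1 (.reg 22)))).eval w s₁
      = (1 - (c.D r).toNat) * if c.zp v < (c.sl true v).length then 1 else 0 := by
    simp only [Expr.eval_mul, Expr.eval_sub, Expr.eval_lt, Expr.eval_reg, Expr.eval_load, h1v,
      Expr.eval_ofNat, hT.r23, hT.r22, hT.rep.zp, hT.rep.slc, hf.one_mod]
    exact hf.small_mod (by cases c.D r <;> split_ifs <;> norm_num)
  refine WP.ite (fun h2 => ?_) (fun h2 => ?_)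
  · rw [e2] at h2
    have hD : c.D r = false := by
      cases h : c.D r
      · rfl
      · simp [h] at h2
    have hz : c.zp v < (c.sl true v).length := by
      by_contra h; simp [h] at h2
    have hz' := List.getElem?_eq_getElem hz
    set z := (c.sl true v)[c.zp v] with hzdef
    have e3 : (Expr.bin .lt (.load 10 (idx (.load 5 (idx (idx 1 (.reg 22)) (.load 9 (.reg 22))))
          (.reg 21))) (.load 10 (.reg 20))).eval w s₁ =
        if c.lev z r < c.lev r v then 1 else 0 := by
      have hz5 : (Expr.load 5 (idx (idx 1 (.reg 22)) (.load 9 (.reg 22)))).eval w s₁ = z := by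
        rw [Expr.eval_load, eval_idx hf h3 h1v (bidx_lt _ _)
          (by simp only [Expr.eval_load, Expr.eval_reg, hT.r22, hT.rep.zp])
          (hz.trans_le (hI.length_sl_le _ _))]
        exact hT.rep.sl _ _ _ _ hz'
      rw [Expr.eval_lt, Expr.eval_load, eval_idx hf h3 hz5 (Fin.lt_two_mul z) (b := .reg 21) hT.r21
        r.2, Expr.eval_load, Expr.eval_reg, hT.r20, hT.rep.lev, hT.rep.lev, hf.one_mod]
    refine WP.ite (fun h3 => (hpop ?_).mono ?_) (fun h3 => (hraise hrv hlt ?_).mono ?_)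
    · rw [e3] at h3
      exact .inr (.inr (.inl ⟨hD, z, hz', by by_contra h; simp [h] at h3⟩))
    · rintro t s' ⟨c', hc', ht⟩
      refine ⟨c', hc', ?_⟩
      simp only [Expr.cost_load, Expr.cost_reg, Expr.cost_add, Expr.cost_sub, Expr.cost_bin,
        Expr.cost_div, Expr.cost_mod, Expr.cost_ofNat, Expr.cost_mul, cost_idx]
      omega
    · rw [e3] at h3
      exact .inl ⟨hD, z, hz', by by_contra h; simp [not_le.1 h] at h3⟩
    · rintro t s' ⟨c', hc', ht⟩
      refine ⟨c', hc', ?_⟩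
      simp only [Expr.cost_load, Expr.cost_reg, Expr.cost_add, Expr.cost_sub, Expr.cost_bin,
        Expr.cost_div, Expr.cost_mod, Expr.cost_ofNat, Expr.cost_mul, cost_idx]
      omega
  rw [e2] at h2
  have hfull : c.D r = false → (c.sl true v).length ≤ c.zp v := fun hD => by
    by_contra h; simp [hD, not_le.1 h] at h2
  have hrow : rowE.eval w s₁ = (c.D r).toNat * n + v := eval_row hf h3 hT.r23 hT.r22
  have e4 : (Expr.bin .lt (.load 11 (.reg 20)) (.load 6 rowE)).eval w s₁ =
      if c.ptr r v < (c.sl (c.D r) v).length then 1 else 0 := by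
    simp only [Expr.eval_lt, Expr.eval_load, hrow, Expr.eval_reg, hT.r20, hT.rep.ptr, hT.rep.slc,
      hf.one_mod]
  refine WP.ite (fun h4 => ?_) (fun h4 => (hraise hrv hlt ?_).mono ?_)
  · rw [e4] at h4
    have hp : c.ptr r v < (c.sl (c.D r) v).length := by
      by_contra h; simp [h] at h4
    have hp' := List.getElem?_eq_getElem hp
    set y := (c.sl (c.D r) v)[c.ptr r v] with hydef
    have hpn := hp.trans_le (hI.length_sl_le _ _)
    have hy5 : (Expr.load 5 (idx rowE (.load 11 (.reg 20)))).eval w s₁ = y := by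
      rw [Expr.eval_load, eval_idx hf h3 hrow (bidx_lt _ _)
        (by simp only [Expr.eval_load, Expr.eval_reg, hT.r20, hT.rep.ptr]) hpn]
      exact hT.rep.sl _ _ _ _ hp'
    refine WP.seq (WP.assign ?_)
    rw [hy5]
    set s₂ := s₁.setReg 24 y with hs₂
    have hT₂ : Top L c r v s₂ := ⟨hT.rep.setReg (by norm_num), by simp [hs₂, hT.r20],
      by simp [hs₂, hT.r21], by simp [hs₂, hT.r22], by simp [hs₂, hT.r23]⟩
    have h24 : s₂.reg 24 = y := by simp [hs₂]
    clear_value s₂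
    have e5 : (Expr.load 2 (idx (.reg 22) (.reg 24)) *
        .bin .lt (.load 10 (idx (.reg 21) (.reg 24))) (.load 10 (.reg 20))).eval w s₂ =
        s₂.arr 2 (v * n + y) * if c.lev r y < c.lev r v then 1 else 0 := by
      rw [Expr.eval_mul, Expr.eval_load, eval_idx (a := .reg 22) (b := .reg 24) hf hT₂.rep.reg_n
        hT₂.r22 (Fin.lt_two_mul v) h24 y.2, Expr.eval_lt, Expr.eval_load,
        eval_idx (a := .reg 21) (b := .reg 24) hf hT₂.rep.reg_n hT₂.r21 (Fin.lt_two_mul r) h24 y.2,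
        Expr.eval_load, Expr.eval_reg, hT₂.r20, hT₂.rep.lev, hT₂.rep.lev, hf.one_mod]
      apply hf.small_mod
      rcases hT₂.rep.alive v y with ⟨-, h⟩ | ⟨-, h⟩ <;> rw [h] <;> split_ifs <;> norm_num
    refine WP.ite (fun h5 => ?_) (fun h5 => ?_)
    · rw [e5] at h5
      refine (wp_pop hf hT₂.rep hs).mono ?_
      have hOK : c.OK L r v := by
        refine .inr (.inr (.inr ⟨y, hp', ?_, by by_contra h; simp [h] at h5⟩))
        rcases hT₂.rep.alive v y with ⟨h, -⟩ | ⟨-, h⟩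
        · exact h
        · simp [h] at h5
      rintro t s' ⟨hR', ht⟩
      have := Conf.pot_pop (L := L) hs
      refine ⟨_, ⟨hR', hI.pop hs hOK, rfl⟩, ?_⟩
      simp only [Expr.cost_load, Expr.cost_reg, Expr.cost_add, Expr.cost_sub, Expr.cost_bin,
        Expr.cost_div, Expr.cost_mod, Expr.cost_ofNat, Expr.cost_mul, cost_idx, rowE]
      omega
    · rw [e5] at h5
      refine (wp_advance hf hT₂ hpn).mono ?_
      rintro t s' ⟨hR', ht⟩
      have := Conf.pot_advance (L := L) hp
      refine ⟨_, ⟨hR', hI.advance hmem hp' fun hadj => ?_, rfl⟩, ?_⟩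
      · rcases hT₂.rep.alive v y with ⟨-, h⟩ | ⟨h, -⟩
        · by_contra h'; simp [h, not_le.1 h'] at h5
        · exact absurd hadj h
      simp only [Expr.cost_load, Expr.cost_reg, Expr.cost_add, Expr.cost_sub, Expr.cost_bin,
        Expr.cost_div, Expr.cost_mod, Expr.cost_ofNat, Expr.cost_mul, cost_idx, rowE]
      omega
  · rw [e4] at h4
    exact .inr ⟨hfull, by by_contra h; simp [not_le.1 h] at h4⟩
  · rintro t s' ⟨c', hc', ht⟩
    refine ⟨c', hc', ?_⟩
    simp only [Expr.cost_load, Expr.cost_reg, Expr.cost_add, Expr.cost_sub, Expr.cost_bin,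
      Expr.cost_div, Expr.cost_mod, Expr.cost_ofNat, Expr.cost_mul, cost_idx, rowE]
    omega

theorem Conf.SameLists.trans {c₁ c₂ c₃ : Conf n} (h₁ : c₁.SameLists c₂) (h₂ : c₂.SameLists c₃) :
    c₁.SameLists c₃ := by
  rw [Conf.SameLists] at *
  rw [h₂, h₁]

theorem wp_run (hf : Fits n w) (hL : L ≤ n + 3) (hR : Rep L c s) (hI : c.Inv L ∅ ∅)
    (hpot : c.pot L < 2 ^ w) :
    WP w ω runProg s fun t s' => ∃ c', Rep L c' s' ∧ c'.Inv L ∅ ∅ ∧ c.SameLists c' ∧ c'.stk = [] ∧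
      t + 500 * c'.pot L ≤ 500 * c.pot L + 2 := by
  refine (WP.while (c := c) (fun c' s' => Rep L c' s' ∧ c'.Inv L ∅ ∅ ∧ c.SameLists c' ∧
    c'.pot L ≤ c.pot L) (fun c' => 500 * c'.pot L) ⟨hR, hI, rfl, le_rfl⟩ ?_).mono ?_
  · rintro c' s' ⟨hR', hI', hS, hp⟩ hne
    rw [Expr.eval_reg, hR'.reg_sp] at hne
    refine (wp_check hf hL hR' hI' (by omega) (fun h => hne (by simp [h]))).mono ?_
    rintro t s'' ⟨c'', ⟨h1, h2, h3⟩, ht⟩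
    exact ⟨c'', ⟨h1, h2, hS.trans h3, by omega⟩, by simp; omega⟩
  · rintro t s' ⟨c', ⟨hR', hI', hS, hp⟩, he, ht⟩
    rw [Expr.eval_reg, hR'.reg_sp, List.length_eq_zero_iff] at he
    exact ⟨c', hR', hI', hS, he, by simpa using ht⟩

end

/-! ## Refreshing a vertex -/

namespace Conf
variable {n : ℕ} (L : ℕ) (c : Conf n)

/-- Future work on the search for adjacent centers of `x`. -/
def zpot (x : Fin n) : ℕ :=
  ((c.sl true x).length - c.zp x) +
    if c.zp x < (c.sl true x).length then (c.sl true x).length else 0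

/-- Total potential. -/
def tot : ℕ := c.pot L + ∑ x, c.zpot x

/-- Change of the position of the center of `x`. -/
def setZp (x : Fin n) (k : ℕ) : Conf n := { c with zp := Function.update c.zp x k }

/-- Degree of a vertex in the current graph. -/
noncomputable def deg (x : Fin n) : ℕ := (c.G.neighborSet x).ncard

open Classical in
/-- Work caused by `x` when its last adjacent center disappears. -/
noncomputable def buildCost (x : Fin n) : ℕ :=
  if c.zp x < (c.sl true x).length ∧ ∀ y, c.G.Adj x y → c.D y = false
  then c.deg x * (n * (3 * L + 1)) else 0

variable {c L}

/-- For each of the `n` roots, the longer list of `x` adds at most `L` to the weighted levels and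
`1` to the remaining scan, and the additional dependent of `y` adds at most `2 * L`. -/
theorem pot_app (x y : Fin n) : (c.app false x y).pot L ≤ c.pot L + n * (3 * L + 1) := by
  have h : ∀ p : Fin n × Fin n, (c.app false x y).pairPot L p.1 p.2 ≤
      c.pairPot L p.1 p.2 + ((if p.2 = x then L + 1 else 0) + if p.2 = y then 2 * L else 0) := by
    rintro ⟨r, v⟩
    have h1 : ((c.app false x y).sl (c.D r) v).length ≤
        (c.sl (c.D r) v).length + if v = x then 1 else 0 := by
      simp only [app, upd2]; split_ifs <;> simp_all
    have h2 : ((c.app false x y).deps r v).length ≤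
        (c.deps r v).length + if v = y then 1 else 0 := by
      cases hD : c.D r <;> simp only [deps, app, upd2, hD] <;> split_ifs <;> simp_all
    have h3 : (c.app false x y).wt r v ≤
        c.wt r v + ((if v = x then 1 else 0) + 2 * if v = y then 1 else 0) := by
      have : (c.app false x y).wt r v = 1 + 2 * ((c.app false x y).deps r v).length +
        ((c.app false x y).sl (c.D r) v).length := rfl
      rw [this, wt]; omega
    have h4 := Nat.mul_le_mul_left (L - c.lev r v) h3
    have h5 : (L - c.lev r v) * ((if v = x then 1 else 0) + 2 * if v = y then 1 else 0) ≤
      L * ((if v = x then 1 else 0) + 2 * if v = y then 1 else 0) :=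
      Nat.mul_le_mul_right _ (Nat.sub_le _ _)
    have h6 : L * ((if v = x then 1 else 0) + 2 * if v = y then 1 else 0) =
      (if v = x then L else 0) + if v = y then 2 * L else 0 := by
      split_ifs <;> ring
    have h7 : (c.app false x y).pairPot L r v = (L - c.lev r v) * (c.app false x y).wt r v +
      (((c.app false x y).sl (c.D r) v).length - c.ptr r v) := rfl
    have h8 : (if v = x then L + 1 else 0) = (if v = x then L else 0) + if v = x then 1 else 0 := by
      split_ifs <;> rfl
    simp only [h7, h8]
    rw [pairPot]
    rw [Nat.mul_add _ (c.wt r v)] at h4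
    rw [h6] at h5
    omega
  have hsum := Finset.sum_le_sum (s := Finset.univ) fun p _ => h p
  rw [Finset.sum_add_distrib, Finset.sum_add_distrib, Fintype.sum_prod_type (f := fun p =>
    if p.2 = x then L + 1 else 0), Fintype.sum_prod_type (f := fun p =>
    if p.2 = y then 2 * L else 0)] at hsum
  simp only [Finset.sum_ite_eq', Finset.mem_univ, if_true, Finset.sum_const, Finset.card_univ,
    Fintype.card_fin, smul_eq_mul] at hsum
  have : (c.app false x y).stk = c.stk := rfl
  rw [pot, pot, this]
  have e : n * (L + 1) + n * (2 * L) = n * (3 * L + 1) := by ring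
  omega

theorem zpot_app (x y v : Fin n) : (c.app false x y).zpot v = c.zpot v := by
  simp [zpot, app, upd2]

/-- The search for a center pays one unit per passed entry. The conditional summand of `zpot` is
released when the static list is exhausted, and pays for traversing that list once more to build the
scan list. -/
theorem sum_zpot_setZp {x : Fin n} {k : ℕ} (hk : c.zp x ≤ k) (hk' : k ≤ (c.sl true x).length) :
    ∑ v, (c.setZp x k).zpot v + ((k - c.zp x) +
      if c.zp x < (c.sl true x).length ∧ k = (c.sl true x).length then (c.sl true x).length else 0)
      ≤ ∑ v, c.zpot v := by
  refine sum_add_le_sum x (fun v hv => le_of_eq ?_) ?_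
  · simp [zpot, setZp, hv]
  · simp only [zpot, setZp, Function.update_self]
    split_ifs <;> omega

/-! ### The invariant under the steps of a refresh -/

namespace Inv
variable {X Y : Set (Fin n)}

theorem setZp (h : c.Inv L X Y) {x y : Fin n} (hX : x ∈ X) (hY : x ∈ Y)
    (hy : (c.sl true x)[c.zp x]? = some y) (hn : c.G.Adj x y → c.D y = false) :
    (c.setZp x (c.zp x + 1)).Inv L X Y := by
  have hlt := (List.getElem?_eq_some_iff.1 hy).1
  have hne : ∀ v, v ≠ x → (c.setZp x (c.zp x + 1)).zp v = c.zp v := fun v hv => by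
    simp [Conf.setZp, hv]
  have hself : (c.setZp x (c.zp x + 1)).zp x = c.zp x + 1 := by simp [Conf.setZp]
  refine { h with zp_le := fun v => ?_, zp_pre := fun v i z hi hz hadj => ?_, zp_ok := fun v hv z hz => ?_,
                  sl_empty := fun v hv => ?_, sl_full := fun v hv hzp => ?_,
                  work := fun r v hv => ?_ }
  · by_cases hvx : v = x
    · subst hvx; rw [hself]; exact hlt
    · rw [hne v hvx]; exact h.zp_le v
  · by_cases hvx : v = x
    · subst hvx
      rw [hself] at hi
      rcases Nat.lt_succ_iff_lt_or_eq.1 hi with hi | rfl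
      · exact h.zp_pre v i z hi hz hadj
      · obtain rfl : y = z := Option.some.inj (hy.symm.trans hz)
        exact hn hadj
    · rw [hne v hvx] at hi; exact h.zp_pre v i z hi hz hadj
  · rw [hne v (fun h => hv (h ▸ hX))] at hz
    exact h.zp_ok v hv z hz
  · refine h.sl_empty v (lt_of_le_of_lt ?_ hv)
    by_cases hvx : v = x
    · subst hvx; rw [hself]; omega
    · rw [hne v hvx]
  · rw [hne v (fun h => hv (h ▸ hY))] at hzp
    exact h.sl_full v hv hzp
  · have := h.work r v hv
    rwa [OK, ← hne v (fun h => hv (h ▸ hX))] at this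

/-- Entries are appended at the end, so all scan positions and the entries before them keep their
meaning. Membership of `x` in `X` suspends the claims about witnesses of pairs at `x`, whose scan
list is changing. -/
theorem app (h : c.Inv L X Y) {x y : Fin n} (hX : x ∈ X) (hzp : c.zp x = (c.sl true x).length)
    (hy : y ∈ c.sl true x) (hy' : y ∉ c.sl false x) : (c.app false x y).Inv L X Y := by
  have hslt : ∀ v, (c.app false x y).sl true v = c.sl true v := fun v => by
    simp [Conf.app, upd2]
  have hslx : (c.app false x y).sl false x = c.sl false x ++ [y] := by
    simp [Conf.app, upd2]
  have hslv : ∀ b v, v ≠ x → (c.app false x y).sl b v = c.sl b v := fun b v hv => by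
    simp [Conf.app, upd2, hv]
  have hsub : ∀ b v z, z ∈ c.sl b v → z ∈ (c.app false x y).sl b v := fun b v z hz => by
    simp only [Conf.app, upd2]; split_ifs with hh
    · obtain ⟨rfl, rfl⟩ := hh; exact List.mem_append_left _ hz
    · exact hz
  have hget : ∀ b v i, i < (c.sl b v).length →
      ((c.app false x y).sl b v)[i]? = (c.sl b v)[i]? := fun b v i hi => by
    simp only [Conf.app, upd2]; split_ifs with hh
    · obtain ⟨rfl, rfl⟩ := hh; exact List.getElem?_append_left hi
    · rfl
  have hmem : x ∉ c.dl false y := fun hh => hy' ((h.mem_dl _ _ _).2 hh)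
  refine { h with sl_nodup := fun b v => ?_, dl_nodup := fun b v => ?_, mem_sl := fun v z hz => ?_,
                  mem_dl := fun b v z => ?_, sl_sub := fun v z hz => ?_, zp_le := fun v => ?_,
                  zp_pre := fun v i z hi hz => ?_, zp_ok := fun v hv z hz => ?_,
                  sl_empty := fun v hv => ?_, sl_full := fun v hv hzp z hz => ?_,
                  ptr_le := fun r v => ?_, ptr_pre := fun r v i z hi hz => ?_,
                  work := fun r v hv => ?_ }
  · simp only [Conf.app, upd2]; split_ifs with hh
    · exact List.nodup_append.2 ⟨h.sl_nodup _ _, List.nodup_singleton _, by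
        rintro a ha _ hb rfl; simp at hb; exact hy' (hb ▸ ha)⟩
    · exact h.sl_nodup _ _
  · simp only [Conf.app, upd2]; split_ifs with hh
    · exact List.nodup_append.2 ⟨h.dl_nodup _ _, List.nodup_singleton _, by
        rintro a ha _ hb rfl; simp at hb; exact hmem (hb ▸ ha)⟩
    · exact h.dl_nodup _ _
  · rw [hslt]; exact h.mem_sl v z hz
  · simp only [Conf.app, upd2]
    have := h.mem_dl b v z
    by_cases hb : b = false <;> by_cases hv : v = x <;> by_cases hz : z = y <;>
      simp_all
  · rw [hslt]
    by_cases hv : v = x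
    · subst hv
      rw [hslx, List.mem_append, List.mem_singleton] at hz
      rcases hz with hz | rfl
      · exact h.sl_sub v z hz
      · exact hy
    · rw [hslv _ v hv] at hz; exact h.sl_sub v z hz
  · rw [hslt]; exact h.zp_le v
  · rw [hslt] at hz; exact h.zp_pre v i z hi hz
  · rw [hslt] at hz; exact h.zp_ok v hv z hz
  · rw [hslt] at hv
    have hvx : v ≠ x := by rintro rfl; exact absurd hv (by simp [Conf.app, hzp])
    rw [hslv _ v hvx]; exact h.sl_empty v hv
  · rw [hslt] at hzp
    exact hsub _ _ _ (h.sl_full v hv hzp z hz)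
  · refine (h.ptr_le r v).trans ?_
    change _ ≤ (upd2 c.sl false x (c.sl false x ++ [y]) (c.D r) v).length
    simp only [upd2]; split_ifs with hh
    · rw [hh.1, hh.2]; simp
    · rfl
  · replace hz : ((c.app false x y).sl (c.D r) v)[i]? = some z := hz
    rw [hget _ _ _ (lt_of_lt_of_le hi (h.ptr_le r v))] at hz
    exact h.ptr_pre r v i z hi hz
  · have hvx : v ≠ x := fun h => hv (h ▸ hX)
    have := h.work r v hv
    rwa [OK, ← hslv _ v hvx, ← hslv _ v hvx] at this

end Inv

end Conf

/-- The row of the static list of the vertex in register `11`. -/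
def rowX : Expr := idx 1 (.reg 11)

/-- Has the vertex in register `11` not exhausted its static list? -/
def hitE : Expr := .bin .lt (.load 9 (.reg 11)) (.load 6 rowX)

/-- The entry of the static list at the position of the center. -/
def zE : Expr := .load 5 (idx rowX (.load 9 (.reg 11)))

def scanProg : Prog :=
  .while (hitE * (1 - .load 2 (idx (.reg 11) zE) * .load 3 zE))
    (.store 9 (.reg 11) (.load 9 (.reg 11) + 1))

def buildProg : Prog :=
  .assign 12 0 ;;
  .while (.bin .lt (.reg 12) (.load 6 rowX))
    (.assign 13 (.load 5 (idx rowX (.reg 12))) ;;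
      .ite (.load 2 (idx (.reg 11) (.reg 13)))
        (appProg (.reg 11) (.reg 13) (.reg 11) (.reg 13)) .skip ;;
      .assign 12 (.reg 12 + 1))

/-- Search the next adjacent center of the vertex in register `11`, build its scan list if there
is none, and push all its pairs. -/
def refreshProg : Prog :=
  .ite hitE (scanProg ;; .ite hitE .skip buildProg) .skip ;;
  pushLoop (.reg 3) (idx (.reg 10) (.reg 11))

/-! ### Correctness and cost of a refresh -/

section
variable {n w L : ℕ} {ω : Tape} {c : Conf n} {s : State} {x : Fin n} {X Y : Set (Fin n)}

theorem eval_rowX (hf : Fits n w) (hn : s.reg 3 = n) (hx : s.reg 11 = x) :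
    rowX.eval w s = true.toNat * n + x := eval_row_true (e := .reg 11) hf hn hx

theorem eval_hitE (hf : Fits n w) (hR : Rep L c s) (hx : s.reg 11 = x) :
    hitE.eval w s = if c.zp x < (c.sl true x).length then 1 else 0 := by
  simp only [hitE, Expr.eval_lt, Expr.eval_load, eval_rowX hf hR.reg_n hx, Expr.eval_reg, hx,
    hR.zp, hR.slc, hf.one_mod]

theorem eval_zE (hf : Fits n w) (hR : Rep L c s) (hx : s.reg 11 = x)
    (hlen : (c.sl true x).length ≤ n) {y} (hy : (c.sl true x)[c.zp x]? = some y) :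
    zE.eval w s = y := by
  rw [zE, Expr.eval_load, eval_idx hf hR.reg_n (eval_rowX hf hR.reg_n hx) (bidx_lt _ _)
    (by simp only [Expr.eval_load, Expr.eval_reg, hx, hR.zp])
    ((List.getElem?_eq_some_iff.1 hy).1.trans_le hlen)]
  exact hR.sl _ _ _ _ hy

theorem Rep.setZp (h : Rep L c s) (k : ℕ) : Rep L (c.setZp x k) (s.setArr 9 x k) :=
  { h with
    zp := fun v => by
      simp only [State.arr_setArr, true_and, Conf.setZp, Function.update_apply, Fin.val_inj, h.zp] }

/-- The loop stops at the first entry that is both a live neighbour and a center, or at the end of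
the list. Past the end `zE` reads a meaningless cell, but the factor `hitE` is then `0`. -/
theorem wp_scan (hf : Fits n w) (hR : Rep L c s) (hI : c.Inv L X Y) (hX : x ∈ X) (hY : x ∈ Y)
    (hx : s.reg 11 = x) :
    WP w ω scanProg s fun t s' => ∃ k, Rep L (c.setZp x k) s' ∧ (c.setZp x k).Inv L X Y ∧
      s'.reg = s.reg ∧ s'.pos = s.pos ∧ c.zp x ≤ k ∧ k ≤ (c.sl true x).length ∧
      (∀ y, (c.sl true x)[k]? = some y → c.G.Adj x y ∧ c.D y = true) ∧
      t ≤ 100 * (k - c.zp x) + 100 := by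
  have hself : c.setZp x (c.zp x) = c := by simp [Conf.setZp]
  refine (WP.while (c := c.zp x) (fun k s' => Rep L (c.setZp x k) s' ∧ (c.setZp x k).Inv L X Y ∧
      s'.reg = s.reg ∧ s'.pos = s.pos ∧ c.zp x ≤ k ∧ k ≤ (c.sl true x).length)
      (fun k => 100 * ((c.sl true x).length - k))
      ⟨by rwa [hself], by rwa [hself], rfl, rfl, le_rfl, hI.zp_le x⟩ ?_).mono ?_
  · rintro k s' ⟨hR', hI', hreg, hpos, hk, hkl⟩ he
    have hx' : s'.reg 11 = x := by rw [hreg, hx]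
    have hkx : (c.setZp x k).zp x = k := by simp [Conf.setZp]
    rw [Expr.eval_mul, eval_hitE hf hR' hx', hkx] at he
    have hlt : k < (c.sl true x).length := by
      by_contra h
      change ¬ k < ((c.setZp x k).sl true x).length at h
      simp [h] at he
    have hy := List.getElem?_eq_getElem hlt
    set y := (c.sl true x)[k] with hydef
    have hlen := hI.length_sl_le true x
    have hz : zE.eval w s' = y := eval_zE hf hR' hx' hlen (by rw [hkx]; exact hy)
    have hkn : (k + 1) % 2 ^ w = k + 1 := Nat.mod_eq_of_lt (hf.lt_sq (by nlinarith))
    have hev : (Expr.load 9 (.reg 11) + 1).eval w s' = k + 1 := by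
      simp only [Expr.eval_add, Expr.eval_load, Expr.eval_reg, hx', hR'.zp, hkx, Expr.eval_ofNat,
        hf.one_mod, hkn]
    refine WP.store ⟨k + 1, ⟨?_, ?_, by simp [hreg], by simp [hpos], by omega, hlt⟩, ?_⟩
    · rw [hev, Expr.eval_reg, hx']
      have := hR'.setZp (x := x) (k + 1)
      simpa [Conf.setZp] using this
    · have := hI'.setZp hX hY (y := y) (by rw [hkx]; exact hy) (fun hadj => by
        rcases hR'.alive x y with ⟨-, h⟩ | ⟨h, -⟩
        · have hDy : c.D y = false := by
            by_contra hD
            have hD' : (c.setZp x k).D y = true := Bool.eq_true_of_not_eq_false hD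
            rw [Expr.eval_sub, Expr.eval_mul, Expr.eval_load, eval_idx (a := .reg 11) hf hR'.reg_n
              hx' (Fin.lt_two_mul x) hz y.2, Expr.eval_load, hz, h, hR'.inD, hD'] at he
            simp [hf.one_mod] at he
          exact hDy
        · exact absurd hadj h)
      rw [hkx] at this
      simpa [Conf.setZp] using this
    · simp [hitE, zE, rowX]; omega
  · rintro t s' ⟨k, ⟨hR', hI', hreg, hpos, hk, hkl⟩, he, ht⟩
    refine ⟨k, hR', hI', hreg, hpos, hk, hkl, fun y hy => ?_, ?_⟩
    · have hx' : s'.reg 11 = x := by rw [hreg, hx]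
      have hkx : (c.setZp x k).zp x = k := by simp [Conf.setZp]
      have hlt : k < ((c.setZp x k).sl true x).length := (List.getElem?_eq_some_iff.1 hy).1
      have hz : zE.eval w s' = y := eval_zE hf hR' hx' (hI.length_sl_le true x)
        (by rw [hkx]; exact hy)
      rw [Expr.eval_mul, eval_hitE hf hR' hx', hkx, if_pos hlt,
        Expr.eval_sub, Expr.eval_mul, Expr.eval_load, eval_idx (a := .reg 11) hf hR'.reg_n
        hx' (Fin.lt_two_mul x) hz y.2, Expr.eval_load, hz, hR'.inD] at he
      have hle : ∀ a, (1 * (1 % 2 ^ w - a)) % 2 ^ w = 1 - a := fun a => by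
        rw [hf.one_mod, one_mul]; exact hf.small_mod (by omega)
      change (1 * (1 % 2 ^ w - _)) % 2 ^ w = 0 at he
      rw [hle] at he
      rcases hR'.alive x y with ⟨hadj, h⟩ | ⟨-, h⟩
      · refine ⟨hadj, ?_⟩
        rw [h] at he
        by_contra hD
        have hD' : (c.setZp x k).D y = false := Bool.eq_false_of_not_eq_true hD
        simp [hD'] at he
      · rw [h] at he; simp at he
    · simp [hitE, zE, rowX] at ht; omega

/-- The list built consists of current neighbours of `x` only, so `pot_app` is charged at most `deg
x` times, whereas the running time is proportional to the static list and is paid by `zpot`. The new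
list is complete, so `x` leaves `Y`. -/
theorem wp_build (hf : Fits n w) (hR : Rep L c s) (hI : c.Inv L X Y) (hX : x ∈ X)
    (hzp : c.zp x = (c.sl true x).length) (he : c.sl false x = []) (hx : s.reg 11 = x) :
    WP w ω buildProg s fun t s' => ∃ c', Rep L c' s' ∧ c'.Inv L X (Y \ {x}) ∧
      c' = { c with sl := c'.sl, dl := c'.dl } ∧ c'.sl true = c.sl true ∧
      (∀ k, k ≠ 12 → k ≠ 13 → s'.reg k = s.reg k) ∧ s'.pos = s.pos ∧
      c'.tot L ≤ c.tot L + c.deg x * (n * (3 * L + 1)) ∧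
      t ≤ 200 * ((c.sl true x).length + 1) := by
  set N := (c.sl true x).length with hN
  have hNn : N ≤ n := hI.length_sl_le true x
  refine WP.seq (WP.assign ?_)
  refine (WP.for (n := N) (i := 0) (B := 150) (I := fun i s' => ∃ c', Rep L c' s' ∧ c'.Inv L X Y ∧
      c' = { c with sl := c'.sl, dl := c'.dl } ∧ c'.sl true = c.sl true ∧
      (∀ k, k ≠ 12 → k ≠ 13 → s'.reg k = s.reg k) ∧ s'.pos = s.pos ∧ s'.reg 12 = i ∧
      (∀ y ∈ c'.sl false x, c.G.Adj x y ∧ y ∈ (c.sl true x).take i) ∧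
      (∀ y ∈ (c.sl true x).take i, c.G.Adj x y → y ∈ c'.sl false x) ∧
      c'.tot L ≤ c.tot L + (c'.sl false x).length * (n * (3 * L + 1)))
      (Nat.zero_le _) ?_ ?_ ?_).mono ?_
  · refine ⟨c, hR.setReg (by norm_num), hI, rfl, rfl, fun k h _ => by simp [h], rfl, by simp, ?_, ?_, ?_⟩
    · simp [he]
    · simp
    · simp [he]
  · rintro i s' ⟨c', hR', -, hc', hsl, hreg, -, h12, -⟩
    rw [Expr.eval_lt, Expr.eval_load, eval_rowX (x := x) hf hR'.reg_n
      ((hreg 11 (by norm_num) (by norm_num)).trans hx), hR'.slc, hsl, Expr.eval_reg, h12,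
      hf.one_mod]
    simp [hN]
  · rintro i s' ⟨c', hR', hI', hc', hsl, hreg, hpos, h12, hs1, hs2, htot⟩ hi
    have hx' := (hreg 11 (by norm_num) (by norm_num)).trans hx
    have hG : c'.G = c.G := by rw [hc']
    have hy := List.getElem?_eq_getElem hi
    set y := (c.sl true x)[i] with hydef
    have hy' : (c'.sl true x)[i]? = some y := by rw [hsl]; exact hy
    have ey : (Expr.load 5 (idx rowX (.reg 12))).eval w s' = y := by
      rw [Expr.eval_load, eval_idx (b := .reg 12) hf hR'.reg_n (eval_rowX hf hR'.reg_n hx')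
        (bidx_lt _ _) h12 (hi.trans_le hNn)]
      exact hR'.sl _ _ _ _ hy'
    have hi1 : (i + 1) % 2 ^ w = i + 1 := Nat.mod_eq_of_lt (hf.lt_sq (by nlinarith))
    have htake : (c.sl true x).take (i + 1) = (c.sl true x).take i ++ [y] := by
      rw [List.take_add_one, hy]; rfl
    refine WP.seq (WP.assign ?_)
    rw [ey]
    set s₁ := s'.setReg 13 y with hs₁
    have hR₁ : Rep L c' s₁ := hR'.setReg (by norm_num)
    have hx₁ : s₁.reg 11 = x := by simp [hs₁, hx']
    have h13 : s₁.reg 13 = y := by simp [hs₁]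
    have h12₁ : s₁.reg 12 = i := by simp [hs₁, h12]
    have hpos₁ : s₁.pos = s.pos := by simp [hs₁, hpos]
    have hreg₁ : ∀ k, k ≠ 12 → k ≠ 13 → s₁.reg k = s.reg k := fun k h1 h2 => by
      simp [hs₁, h2, hreg k h1 h2]
    clear_value s₁
    have ealive : (Expr.load 2 (idx (.reg 11) (.reg 13))).eval w s₁ = s₁.arr 2 (x * n + y) := by
      rw [Expr.eval_load, eval_idx (a := .reg 11) (b := .reg 13) hf hR₁.reg_n hx₁
        (Fin.lt_two_mul x) h13 y.2]
    refine WP.seq (WP.ite (fun hal => ?_) (fun hal => ?_))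
    · rw [ealive] at hal
      have hadj : c.G.Adj x y := by
        rcases hR₁.alive x y with ⟨h, -⟩ | ⟨-, h⟩
        · rwa [hG] at h
        · exact absurd h hal
      -- The static list has no repetitions, so its entry at position `i` was not copied before.
      have hnot : y ∉ c'.sl false x := fun hmem => by
        have h2 := (hs1 y hmem).2
        obtain ⟨j, hj⟩ := List.mem_iff_getElem?.1 h2
        have hjlt := (List.getElem?_eq_some_iff.1 hj).1
        rw [List.length_take] at hjlt
        rw [List.getElem?_take_of_lt (by omega)] at hj
        have := (hI.sl_nodup true x).getElem_inj_iff (i := j) (j := i) (hi := by omega) (hj := hi)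
        have hje := (List.getElem?_eq_some_iff.1 hj).2
        rw [hje] at this
        have := this.1 hydef
        omega
      have hmemy : y ∈ c'.sl true x := List.mem_of_getElem? hy'
      have hzp' : c'.zp x = (c'.sl true x).length := by rw [hsl, ← hN, ← hzp, hc']
      have hI₂ := hI'.app hX hzp' hmemy hnot
      -- There is room for another entry because the extended list would still be without
      -- repetitions.
      have hl1 : (c'.sl false x).length < n := by
        have h1 := hI₂.length_sl_le false x
        have h2 : ((c'.app false x y).sl false x).length = (c'.sl false x).length + 1 := by
          simp [Conf.app, upd2_self]
        omega
      have hl2 : (c'.dl false y).length < n := by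
        have h1 := hI₂.length_dl_le false y
        have h2 : ((c'.app false x y).dl false y).length = (c'.dl false y).length + 1 := by
          simp [Conf.app, upd2_self]
        omega
      refine (wp_appProg hf hR₁ (b := false) (x := x) (y := y)
        (fun s' hE => by simp [hE.1, hx₁]) (fun s' hE => by simp [hE.1, h13])
        (fun s' hE => by simp [hE.1, hx₁]) (fun s' hE => by simp [hE.1, h13])
        hI'.length_sl_le hI'.length_dl_le hl1 hl2).mono ?_
      rintro t s₂ ⟨hE, hR₂, ht⟩
      refine WP.assign ⟨⟨_, hR₂.setReg (by norm_num), hI₂, ?_, ?_, ?_, ?_, ?_, ?_, ?_, ?_⟩, ?_⟩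
      · exact congrArg (fun d : Conf n => d.app false x y) hc'
      · rw [← hsl]; funext v; simp [Conf.app, upd2]
      · intro k h1 h2; simp [h1, hE.1, hreg₁ k h1 h2]
      · simp [hE.2.1, hpos₁]
      · simp [hE.1, h12₁, hf.one_mod, hi1]
      · intro z hz
        have : z ∈ c'.sl false x ++ [y] := by simpa [Conf.app, upd2_self] using hz
        rw [htake]
        rcases List.mem_append.1 this with h | h
        · exact ⟨(hs1 z h).1, List.mem_append_left _ (hs1 z h).2⟩
        · exact ⟨by rw [List.mem_singleton.1 h]; exact hadj, List.mem_append_right _ h⟩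
      · intro z hz hz'
        rw [htake] at hz
        have : z ∈ c'.sl false x ++ [y] := by
          rcases List.mem_append.1 hz with h | h
          · exact List.mem_append_left _ (hs2 z h hz')
          · exact List.mem_append_right _ h
        simpa [Conf.app, upd2_self] using this
      · have h1 := Conf.pot_app (L := L) (c := c') x y
        have h2 : (c'.app false x y).tot L ≤ c'.tot L + n * (3 * L + 1) := by
          simp only [Conf.tot, Conf.zpot_app]; omega
        have h3 : ((c'.app false x y).sl false x).length = (c'.sl false x).length + 1 := by
          simp [Conf.app, upd2_self]
        rw [h3, Nat.succ_mul]
        omega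
      · simp [rowX] at ht ⊢; omega
    · rw [ealive] at hal
      have hadj : ¬ c.G.Adj x y := by
        rcases hR₁.alive x y with ⟨-, h⟩ | ⟨h, -⟩
        · rw [h] at hal; exact absurd hal one_ne_zero
        · rwa [hG] at h
      refine WP.skip (WP.assign ⟨⟨c', hR₁.setReg (by norm_num), hI', hc', hsl, ?_, ?_, ?_, ?_, ?_,
        htot⟩, ?_⟩)
      · intro k h1 h2; simp [h1, hreg₁ k h1 h2]
      · simp [hpos₁]
      · simp [h12₁, hf.one_mod, hi1]
      · intro z hz
        rw [htake]
        exact ⟨(hs1 z hz).1, List.mem_append_left _ (hs1 z hz).2⟩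
      · intro z hz hz'
        rw [htake] at hz
        rcases List.mem_append.1 hz with h | h
        · exact hs2 z h hz'
        · rw [List.mem_singleton.1 h] at hz'; exact absurd hz' hadj
      · simp [rowX]
  · rintro t s' ⟨⟨c', hR', hI', hc', hsl, hreg, hpos, -, hs1, hs2, htot⟩, ht⟩
    have hG : c'.G = c.G := by rw [hc']
    rw [hN, List.take_length] at hs1 hs2
    refine ⟨c', hR', { hI' with sl_full := fun v hv hz y hy => ?_ }, hc', hsl, hreg, hpos, ?_, ?_⟩
    · by_cases hvx : v = x
      · subst hvx
        rw [hG] at hy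
        exact hs2 y (hI.mem_sl v y hy) hy
      · exact hI'.sl_full v (fun h => hv ⟨h, hvx⟩) hz y hy
    · refine htot.trans (Nat.add_le_add_left (Nat.mul_le_mul_right _ ?_) _)
      rw [← List.toFinset_card_of_nodup (hI'.sl_nodup false x), ← Set.ncard_coe_finset]
      exact Set.ncard_le_ncard (fun y hy => (hs1 y (by simpa using hy)).1) (Set.toFinite _)
    · simp [rowX] at ht ⊢; omega

/-- Push the pairs `(r, x)` for all roots `r`. -/
theorem wp_pushAll (hf : Fits n w) (hR : Rep L c s) (hI : c.Inv L X Y)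
    (hz : ∀ y, (c.sl true x)[c.zp x]? = some y → c.G.Adj x y ∧ c.D y = true)
    (hstk : c.stk.length + n < 2 ^ w) (hx : s.reg 11 = x) :
    WP w ω (pushLoop (.reg 3) (idx (.reg 10) (.reg 11))) s fun t s' => ∃ c', Rep L c' s' ∧
      c'.Inv L (X \ {x}) Y ∧ StackExt s s' ∧ c' = { c with stk := c'.stk } ∧
      c'.stk.length = c.stk.length + n ∧ c'.tot L = c.tot L + n ∧ t ≤ 50 * (n + 1) := by
  refine (wp_pushLoop hf hR ((List.finRange n).map fun r => (r, x)) (by simpa using hstk) ?_ ?_).mono ?_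
  · intro s' hE
    simp [hE.reg 3 (by norm_num) (by norm_num), hR.reg_n]
  · intro s' i p hE hi hp
    obtain ⟨r, hr, rfl⟩ : ∃ r, (List.finRange n)[i]? = some r ∧ (r, x) = p := by
      simpa only [List.getElem?_map, Option.map_eq_some_iff] using hp
    have hri : (r : ℕ) = i := by
      have := (List.getElem?_eq_some_iff.1 hr).2
      rw [← this]; simp
    exact eval_idx (a := .reg 10) (b := .reg 11) hf
      ((hE.reg 3 (by norm_num) (by norm_num)).trans hR.reg_n) (by rw [Expr.eval_reg, hi, hri])
      (Fin.lt_two_mul r) ((hE.reg 11 (by norm_num) (by norm_num)).trans hx) x.2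
  · rintro t s' ⟨hE, hR', ht⟩
    refine ⟨_, hR', ?_, hE, rfl, by simp, ?_, ?_⟩
    · refine { hI with zp_ok := fun v hv => ?_, work := fun r v hv => ?_ }
      · by_cases hvx : v = x
        · subst hvx; exact hz
        · exact hI.zp_ok v (fun h => hv ⟨h, hvx⟩)
      · by_cases hvx : v = x
        · subst hvx
          exact .inr (List.mem_append_right _ (List.mem_map.2 ⟨r, List.mem_finRange r, rfl⟩))
        · rcases hI.work r v (fun h => hv ⟨h, hvx⟩) with h | h
          · exact .inl h
          · exact .inr (List.mem_append_left _ h)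
    · simp only [Conf.tot, Conf.pot, List.length_append, List.length_map, List.length_finRange]
      have e1 : ∀ l, ∀ p : Fin n × Fin n, ({ c with stk := l } : Conf n).pairPot L p.1 p.2
        = c.pairPot L p.1 p.2 := fun _ _ => rfl
      have e2 : ∀ l, ∀ p : Fin n, ({ c with stk := l } : Conf n).zpot p = c.zpot p :=
        fun _ _ => rfl
      simp only [e1, e2]
      omega
    · simp at ht; omega

/-- The two configurations agree, except for scan lists built for vertices without adjacent center
and the position of the center of `x`. -/
structure Conf.SearchExt (c c' : Conf n) (x : Fin n) : Prop where
  G : c'.G = c.G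
  D : c'.D = c.D
  ds : c'.ds = c.ds
  sl : c'.sl true = c.sl true
  zp : ∀ v, v ≠ x → c'.zp v = c.zp v

theorem wp_search (hf : Fits n w) (hR : Rep L c s) (hI : c.Inv L X ∅) (hX : x ∈ X)
    (hx : s.reg 11 = x) :
    WP w ω (.ite hitE (scanProg ;; .ite hitE .skip buildProg) .skip) s fun t s' => ∃ c',
      Rep L c' s' ∧ c'.Inv L X ∅ ∧ c.SearchExt c' x ∧ c'.stk = c.stk ∧
      (∀ y, (c'.sl true x)[c'.zp x]? = some y → c'.G.Adj x y ∧ c'.D y = true) ∧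
      (∀ k, k ≠ 12 → k ≠ 13 → s'.reg k = s.reg k) ∧ s'.pos = s.pos ∧
      t + 500 * c'.tot L ≤ 500 * (c.tot L + c.buildCost L x) + 400 := by
  have hcost : hitE.cost = 9 := by simp [hitE, rowX]
  refine WP.ite (fun h => ?_) (fun h => ?_)
  swap
  · rw [eval_hitE hf hR hx] at h
    have hzp : (c.sl true x).length ≤ c.zp x := by
      by_contra h'; simp [not_le.1 h'] at h
    refine WP.skip ⟨c, hR, hI, ⟨rfl, rfl, rfl, rfl, fun _ _ => rfl⟩, rfl, fun y hy => ?_,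
      fun _ _ _ => rfl, rfl, by omega⟩
    rw [List.getElem?_eq_none hzp] at hy
    simp at hy
  rw [eval_hitE hf hR hx] at h
  have hlt : c.zp x < (c.sl true x).length := by
    by_contra h'; simp [h'] at h
  -- During the search `x` is put into `Y`: once its static list is exhausted, its scan list is
  -- incomplete until it has been built.
  have hI₀ : c.Inv L X {x} := { hI with sl_full := fun v _ => hI.sl_full v (by simp) }
  refine WP.seq ((wp_scan hf hR hI₀ hX (by simp) hx).mono ?_)
  rintro t₁ s₁ ⟨k, hR₁, hI₁, hreg₁, hpos₁, hk, hkl, hz, ht₁⟩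
  have hx₁ : s₁.reg 11 = x := by rw [hreg₁, hx]
  have hkx : (c.setZp x k).zp x = k := by simp [Conf.setZp]
  have hzs := Conf.sum_zpot_setZp hk hkl
  have htot : (c.setZp x k).tot L = c.pot L + ∑ v, (c.setZp x k).zpot v := rfl
  have htot₀ : c.tot L = c.pot L + ∑ v, c.zpot v := rfl
  refine WP.ite (fun h => ?_) (fun h => ?_)
  · rw [eval_hitE hf hR₁ hx₁, hkx] at h
    have hklt : k < (c.sl true x).length := by
      by_contra h'
      change ¬ k < ((c.setZp x k).sl true x).length at h'
      simp [h'] at h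
    refine WP.skip ⟨_, hR₁, { hI₁ with sl_full := fun v hv hzp => ?_ }, ⟨rfl, rfl, rfl, rfl,
      fun v hv => by simp [Conf.setZp, hv]⟩, rfl, ?_, fun _ _ _ => by rw [hreg₁], hpos₁, ?_⟩
    · refine hI₁.sl_full v ?_ hzp
      rintro rfl
      rw [hkx] at hzp
      exact absurd hzp (ne_of_lt hklt)
    · rw [hkx]; exact hz
    · omega
  · rw [eval_hitE hf hR₁ hx₁, hkx] at h
    have hklt : k = (c.sl true x).length := by
      by_contra h'
      have : k < ((c.setZp x k).sl true x).length := lt_of_le_of_ne hkl h'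
      simp [this] at h
    have hno : ∀ y, c.G.Adj x y → c.D y = false := fun y hy => by
      obtain ⟨i, hi⟩ := List.mem_iff_getElem?.1 (hI.mem_sl x y hy)
      have hi' := (List.getElem?_eq_some_iff.1 hi).1
      exact hI₁.zp_pre x i y (by rw [hkx]; omega) hi hy
    have hbc : c.buildCost L x = c.deg x * (n * (3 * L + 1)) := by
      rw [Conf.buildCost, if_pos ⟨hlt, hno⟩]
    refine (wp_build hf hR₁ hI₁ hX (by rw [hkx]; exact hklt) (hI.sl_empty x hlt) hx₁).mono ?_
    rintro t₂ s₂ ⟨c', hR₂, hI₂, hc', hsl, hreg₂, hpos₂, htot₂, ht₂⟩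
    have hzp' : c'.zp = (c.setZp x k).zp := by rw [hc']
    refine ⟨c', hR₂, by simpa using hI₂, ⟨by rw [hc']; rfl, by rw [hc']; rfl, by rw [hc']; rfl, hsl,
      fun v hv => by rw [hzp']; simp [Conf.setZp, hv]⟩, by rw [hc']; rfl, fun y hy => ?_, 
      fun k h1 h2 => by rw [hreg₂ k h1 h2, hreg₁], hpos₂.trans hpos₁, ?_⟩
    · rw [hsl, hzp', hkx] at hy
      change (c.sl true x)[k]? = some y at hy
      rw [List.getElem?_eq_none hklt.ge] at hy
      simp at hy
    · have hdeg : (c.setZp x k).deg x = c.deg x := rfl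
      have hsl' : ((c.setZp x k).sl true x).length = (c.sl true x).length := rfl
      rw [hdeg] at htot₂
      rw [hsl'] at ht₂
      rw [if_pos ⟨hlt, hklt⟩] at hzs
      omega

theorem wp_refresh (hf : Fits n w) (hR : Rep L c s) (hI : c.Inv L X ∅) (hX : x ∈ X)
    (hstk : c.stk.length + n < 2 ^ w) (hx : s.reg 11 = x) :
    WP w ω refreshProg s fun t s' => ∃ c', Rep L c' s' ∧ c'.Inv L (X \ {x}) ∅ ∧
      c.SearchExt c' x ∧ c'.stk.length = c.stk.length + n ∧
      (∀ k, k ≠ 5 → k ≠ 10 → k ≠ 12 → k ≠ 13 → s'.reg k = s.reg k) ∧ s'.pos = s.pos ∧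
      t + 500 * c'.tot L ≤ 500 * (c.tot L + c.buildCost L x + 2 * n + 1) := by
  refine WP.seq ((wp_search hf hR hI hX hx).mono ?_)
  rintro t₁ s₁ ⟨c₁, hR₁, hI₁, hE₁, hs₁, hz₁, hreg₁, hpos₁, ht₁⟩
  refine (wp_pushAll hf hR₁ hI₁ hz₁ (by rwa [hs₁])
    ((hreg₁ 11 (by norm_num) (by norm_num)).trans hx)).mono ?_
  rintro t₂ s₂ ⟨c₂, hR₂, hI₂, hE₂, hc₂, hs₂, htot, ht₂⟩
  refine ⟨c₂, hR₂, hI₂, ?_, by rw [hs₂, hs₁], fun k h1 h2 h3 h4 => ?_, hE₂.pos.trans hpos₁, ?_⟩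
  · rw [hc₂]; exact ⟨hE₁.G, hE₁.D, hE₁.ds, hE₁.sl, hE₁.zp⟩
  · rw [hE₂.reg k h1 h2, hreg₁ k h3 h4]
  · omega

end

/-! ## Deletions -/

section
variable {n w L : ℕ} {ω : Tape} {c : Conf n} {s : State} {x y u v : Fin n} {X Y : Set (Fin n)}

/-- The center of `x`, if any, is `y`. -/
def Conf.Dirty (c : Conf n) (x y : Fin n) : Prop :=
  ∀ z, (c.sl true x)[c.zp x]? = some z → z = y

/-- The configuration after the deletion of the edge `{u, v}`. -/
def Conf.cut (c : Conf n) (u v : Fin n) : Conf n :=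
  { c with
    G := c.G.deleteEdges {s(u, v)}
    stk := (c.stk ++ c.ds.map fun r => (r, u)) ++ c.ds.map fun r => (r, v) }

/-- All levels remain valid upper bounds, as distances only increase. Witnesses are lost only at `u`
and `v`: for center roots these pairs are pushed at once, and for the other roots an endpoint loses
one only if it is dirty, that is, if it has no recorded center or has just lost it. Dirty endpoints
go into `X`. -/
theorem Conf.Inv.cut (h : c.Inv L ∅ ∅) (hstk : c.stk = []) (hD : ∀ r, c.D r = true → r ∈ c.ds) :
    (c.cut u v).Inv L {x | x = u ∧ c.Dirty u v ∨ x = v ∧ c.Dirty v u} ∅ := by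
  have hle : ∀ {x y}, (c.cut u v).G.Adj x y → c.G.Adj x y := fun hxy =>
    (SimpleGraph.deleteEdges_adj.1 hxy).1
  have hdir : ∀ {x y}, c.G.Adj x y → ¬ (c.cut u v).G.Adj x y → x = u ∧ y = v ∨ x = v ∧ y = u :=
    fun hxy hn => by
      by_contra hne
      exact hn (SimpleGraph.deleteEdges_adj.2 ⟨hxy, by simpa using hne⟩)
  refine { h with mem_sl := fun x y hxy => h.mem_sl x y (hle hxy),
                  zp_pre := fun x i y hi hy hxy => h.zp_pre x i y hi hy (hle hxy),
                  zp_ok := fun x hx y hy => ?_,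
                  sl_full := fun x hx hz y hy => h.sl_full x hx hz y (hle hy),
                  lev_ub := fun r x => (h.lev_ub r x).trans ?_,
                  ptr_pre := fun r x i y hi hy hxy => h.ptr_pre r x i y hi hy (hle hxy),
                  work := fun r x hx => ?_ }
  · have hok := h.zp_ok x (by simp) y hy
    refine ⟨?_, hok.2⟩
    by_contra hn
    have hy' : (c.sl true x)[c.zp x]? = some y := hy
    refine hx ?_
    rcases hdir hok.1 hn with ⟨rfl, rfl⟩ | ⟨rfl, rfl⟩
    · exact .inl ⟨rfl, fun z hz => Option.some.inj (hz.symm.trans hy')⟩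
    · exact .inr ⟨rfl, fun z hz => Option.some.inj (hz.symm.trans hy')⟩
  · exact add_le_add_left (SimpleGraph.edist_anti (SimpleGraph.deleteEdges_le _)) _
  · have hOK : c.OK L r x := (h.work r x (by simp)).resolve_right (by simp [hstk])
    rcases hOK with hrx | hL | hst | ⟨y, hy, hadj, hlev⟩
    · exact .inl (.inl hrx)
    · exact .inl (.inr (.inl hL))
    · exact .inl (.inr (.inr (.inl hst)))
    · by_cases hn : (c.cut u v).G.Adj x y
      · exact .inl (.inr (.inr (.inr ⟨y, hy, hn, hlev⟩)))
      -- A vertex that is not dirty has a recorded center, so its list for ordinary roots is empty.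
      -- A neighbour witness at it can only belong to a center root.
      have hDr : ∀ {a b}, ¬ c.Dirty a b → x = a → c.D r = true := fun {a b} hd hxa => by
        subst hxa
        by_contra hDr
        rw [Bool.not_eq_true] at hDr
        rw [Conf.Dirty] at hd
        push Not at hd
        obtain ⟨z, hz, -⟩ := hd
        rw [hDr, h.sl_empty x (List.getElem?_eq_some_iff.1 hz).1] at hy
        simp at hy
      right
      rcases hdir hadj hn with ⟨rfl, rfl⟩ | ⟨rfl, rfl⟩
      · have := hD r (hDr (fun hd => hx (.inl ⟨rfl, hd⟩)) rfl)
        exact List.mem_append_left _ (List.mem_append_right _ (List.mem_map.2 ⟨r, this, rfl⟩))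
      · have := hD r (hDr (fun hd => hx (.inr ⟨rfl, hd⟩)) rfl)
        exact List.mem_append_right _ (List.mem_map.2 ⟨r, this, rfl⟩)

theorem Conf.Inv.pot_le (h : c.Inv L X Y) :
    c.pot L ≤ c.stk.length + n * n * (L * (5 * n + 1) + n) := by
  refine Nat.add_le_add_left ?_ _
  have hp : ∀ p ∈ (Finset.univ : Finset (Fin n × Fin n)),
      c.pairPot L p.1 p.2 ≤ L * (5 * n + 1) + n := fun p _ => by
    have h1 := h.length_sl_le (c.D p.1) p.2
    have h2 := h.length_dl_le (c.D p.1) p.2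
    have h3 := h.length_sl_le true p.1
    have h4 : (c.deps p.1 p.2).length ≤ 2 * n := by
      cases hD : c.D p.1 <;> simp [Conf.deps, hD] at * <;> omega
    refine Nat.add_le_add (Nat.mul_le_mul (Nat.sub_le _ _) ?_) ((Nat.sub_le _ _).trans h1)
    rw [Conf.wt]; omega
  refine (Finset.sum_le_card_nsmul _ _ _ hp).trans (le_of_eq ?_)
  simp

/-- The main loop needs this to keep the stack height below `2 ^ w`; it rests on the crude bound of
order `n ^ 4` for the potential. -/
theorem Conf.Inv.pot_lt (hf : Fits n w) (hL : L ≤ n + 3) (h : c.Inv L X Y)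
    (hstk : c.stk.length ≤ 4 * (n + 2) ^ 2) : c.pot L < 2 ^ w := by
  refine hf.lt (h.pot_le.trans_lt ?_)
  have h1 : n * n * (L * (5 * n + 1) + n) ≤ (n + 2) ^ 2 * (((n + 2) * 2) * (5 * (n + 2)) + (n + 2) ^ 2) := by
    refine Nat.mul_le_mul (by nlinarith) (Nat.add_le_add (Nat.mul_le_mul (by omega) (by omega)) (by nlinarith))
  have h2 : (n + 2) ^ 2 * (((n + 2) * 2) * (5 * (n + 2)) + (n + 2) ^ 2) = 11 * (n + 2) ^ 4 := by ring
  have h3 : (n + 2) ^ 2 ≤ (n + 2) ^ 4 := Nat.pow_le_pow_right (by omega) (by norm_num)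
  have h4 : 0 < (n + 2) ^ 4 := by positivity
  omega

/-- Refresh the vertex in register `11` if the deletion of its edge to the vertex in register `15`
requires it. -/
def condRefreshProg : Prog :=
  .ite ((1 - hitE) + .bin .eq zE (.reg 15)) refreshProg .skip

def deleteProg : Prog :=
  .store 2 (idx (.reg 0) (.reg 1)) 0 ;; .store 2 (idx (.reg 1) (.reg 0)) 0 ;;
  pushLoop (.reg 6) (idx (.load 4 (.reg 10)) (.reg 0)) ;;
  pushLoop (.reg 6) (idx (.load 4 (.reg 10)) (.reg 1)) ;;
  .assign 11 (.reg 0) ;; .assign 15 (.reg 1) ;; condRefreshProg ;;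
  .assign 11 (.reg 1) ;; .assign 15 (.reg 0) ;; condRefreshProg ;; runProg

open Classical in
theorem wp_condRefresh (hf : Fits n w) (hR : Rep L c s) (hI : c.Inv L X ∅)
    (hX : x ∈ X ↔ c.Dirty x y) (hstk : c.stk.length + n < 2 ^ w) (hx : s.reg 11 = x)
    (hy : s.reg 15 = y) :
    WP w ω condRefreshProg s fun t s' => ∃ c', Rep L c' s' ∧ c'.Inv L (X \ {x}) ∅ ∧
      c.SearchExt c' x ∧ c'.stk.length ≤ c.stk.length + n ∧
      (∀ k, k ≠ 5 → k ≠ 10 → k ≠ 12 → k ≠ 13 → s'.reg k = s.reg k) ∧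
      t + 500 * c'.tot L ≤
        500 * (c.tot L + (if c.Dirty x y then c.buildCost L x + (2 * n + 1) else 0) + 1) := by
  have hcost : ((1 - hitE) + .bin .eq zE (.reg 15) : Expr).cost ≤ 50 := by
    simp [hitE, zE, rowX]
  have he : ((1 - hitE) + .bin .eq zE (.reg 15) : Expr).eval w s ≠ 0 ↔ c.Dirty x y := by
    simp only [Expr.eval_add, Expr.eval_sub, Expr.eval_ofNat, eval_hitE hf hR hx, Expr.eval_eq,
      Expr.eval_reg, hf.one_mod]
    rw [hf.small_mod (by split_ifs <;> norm_num)]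
    by_cases hlt : c.zp x < (c.sl true x).length
    · have hz := List.getElem?_eq_getElem hlt
      rw [if_pos hlt, eval_zE hf hR hx (hI.length_sl_le true x) hz, hy]
      simp only [Conf.Dirty, hz]
      simp [Fin.val_inj]
    -- With an exhausted list `zE` reads an arbitrary cell, which is harmless because the first
    -- summand of the test is already `1`.
    · rw [if_neg hlt]
      have : c.Dirty x y := fun z hz => absurd (List.getElem?_eq_some_iff.1 hz).1 hlt
      simp [this]
  refine WP.ite (fun h => ?_) (fun h => ?_)
  · have hd := he.1 h
    refine (wp_refresh hf hR hI (hX.2 hd) hstk hx).mono ?_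
    rintro t s' ⟨c', hR', hI', hE, hs, hreg, -, ht⟩
    refine ⟨c', hR', hI', hE, hs.le, hreg, ?_⟩
    rw [if_pos hd]
    omega
  · have hd : ¬ c.Dirty x y := fun hd => he.2 hd h
    refine WP.skip ⟨c, hR, ?_, ⟨rfl, rfl, rfl, rfl, fun _ _ => rfl⟩, by omega,
      fun _ _ _ _ _ => rfl, ?_⟩
    · rwa [Set.sdiff_singleton_eq_self (fun h => hd (hX.1 h))]
    · rw [if_neg hd]
      omega

theorem Rep.cutGraph (hR : Rep L c s) :
    Rep L { c with G := c.G.deleteEdges {s(u, v)} }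
      ((s.setArr 2 (u * n + v) 0).setArr 2 (v * n + u) 0) :=
  { hR with
    alive := fun x y => by
      simp only [State.arr_setArr, true_and, idx_inj y.2 u.2, idx_inj y.2 v.2, Fin.val_inj]
      rw [SimpleGraph.deleteEdges_adj]
      have := hR.alive x y
      by_cases h1 : x = v ∧ y = u
      · right; simp [h1]
      by_cases h2 : x = u ∧ y = v
      · right; simp [h2]
      have h3 : s(x, y) ∉ ({s(u, v)} : Set (Sym2 (Fin n))) := by
        simp only [Set.mem_singleton_iff, Sym2.eq_iff]; tauto
      simpa [h1, h2, h3] using this }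

theorem wp_pushCenters (hf : Fits n w) (hR : Rep L c s) (hstk : c.stk.length + c.ds.length < 2 ^ w)
    {k : ℕ} (hk : k < 2) (hx : s.reg k = x) :
    WP w ω (pushLoop (.reg 6) (idx (.load 4 (.reg 10)) (.reg k))) s fun t s' =>
      Rep L { c with stk := c.stk ++ c.ds.map fun r => (r, x) } s' ∧ StackExt s s' ∧
      t ≤ 50 * (c.ds.length + 1) := by
  refine (wp_pushLoop hf hR (c.ds.map fun r => (r, x)) (by simpa using hstk) ?_ ?_).mono ?_
  · intro s' hE
    simp [hE.reg 6 (by norm_num) (by norm_num), hR.reg_cd]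
  · intro s' i p hE hi hp
    obtain ⟨r, hr, rfl⟩ : ∃ r, c.ds[i]? = some r ∧ (r, x) = p := by
      simpa only [List.getElem?_map, Option.map_eq_some_iff] using hp
    refine eval_idx (b := .reg k) hf ((hE.reg 3 (by norm_num) (by norm_num)).trans hR.reg_n) ?_
      (Fin.lt_two_mul r) ((hE.reg k (by omega) (by omega)).trans hx) x.2
    rw [Expr.eval_load, Expr.eval_reg, hi, hE.arr 4 (by norm_num)]
    exact hR.ds i r hr
  · rintro t s' ⟨hE, hR', ht⟩
    refine ⟨hR', hE, ?_⟩
    simp at ht; omega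

end

/-! ### Amortized cost of a deletion -/

section
variable {n w L : ℕ} {ω : Tape} {c : Conf n} {s : State} {x y u v : Fin n}

/-- The graph after a deletion. -/
abbrev cutEdge (G : SimpleGraph (Fin n)) (u v : Fin n) : SimpleGraph (Fin n) :=
  G.deleteEdges {s(u, v)}

open Classical in
/-- Bound for the work caused at `x` when the edge `{x, y}` is deleted, `G'` being the remaining
graph and `D` the set of centers. -/
noncomputable def vertexCost (L : ℕ) (D : Fin n → Bool) (G G' : SimpleGraph (Fin n))
    (x y : Fin n) : ℕ :=
  (if D y = true ∨ ∀ z, G.Adj x z → D z = false then 2 * n + 1 else 0) +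
    if D y = true ∧ ∀ z, G'.Adj x z → D z = false
    then (G'.neighborSet x).ncard * (n * (3 * L + 1)) else 0

/-- Bound for the amortized cost of a deletion. -/
noncomputable def deleteCost (L : ℕ) (D : Fin n → Bool) (G : SimpleGraph (Fin n))
    (u v : Fin n) : ℕ :=
  4 * {r | D r = true}.ncard + vertexCost L D G (cutEdge G u v) u v +
    vertexCost L D G (cutEdge G u v) v u + 6

-- The left side depends on the history of the data structure, the right side only on the centers
-- and two graphs of the fixed sequence. This makes the expectation computable: a dirty vertex has
-- `y` as its center or has no adjacent center at all, and a list is built only if the center `y`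
-- was the last one.
open Classical in
theorem dirtyCost_le (hI : c.Inv L ∅ ∅) {c' : Conf n} (hzp : c'.zp x = c.zp x)
    (hsl : c'.sl true = c.sl true) (hD : c'.D = c.D) :
    (if c.Dirty x y then c'.buildCost L x + (2 * n + 1) else 0) ≤
      vertexCost L c.D c.G c'.G x y := by
  by_cases hd : c.Dirty x y
  swap
  · simp [hd]
  rw [if_pos hd, vertexCost, add_comm]
  refine Nat.add_le_add ?_ ?_
  · rw [if_pos]
    rcases h : (c.sl true x)[c.zp x]? with _ | z
    · right
      intro z hz
      obtain ⟨i, hi⟩ := List.mem_iff_getElem?.1 (hI.mem_sl x z hz)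
      have := (List.getElem?_eq_some_iff.1 hi).1
      rw [List.getElem?_eq_none_iff] at h
      exact hI.zp_pre x i z (by omega) hi hz
    · left
      rw [← hd z h]
      exact (hI.zp_ok x (by simp) z h).2
  · rw [Conf.buildCost]
    split_ifs with h1 h2 h2
    · rfl
    · rw [hzp, hsl, hD] at h1
      have hz := List.getElem?_eq_getElem h1.1
      exact absurd ⟨by rw [← hd _ hz]; exact (hI.zp_ok x (by simp) _ hz).2, h1.2⟩ h2
    · exact Nat.zero_le _
    · exact Nat.zero_le _

/-- The state `s` stores the configuration `c`, which is ready for the next operation. -/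
structure Ready (L : ℕ) (c : Conf n) (s : State) : Prop where
  rep : Rep L c s
  inv : c.Inv L ∅ ∅
  stk : c.stk = []
  mem_ds : ∀ r, r ∈ c.ds ↔ c.D r = true
  ds_nodup : c.ds.Nodup

theorem Ready.length_ds (h : Ready L c s) : c.ds.length = {r | c.D r = true}.ncard := by
  rw [← List.toFinset_card_of_nodup h.ds_nodup, ← Set.ncard_coe_finset]
  congr 1; ext r; simp [h.mem_ds]

theorem Rep.call (hR : Rep L c s) (a b : ℕ) : Rep L c (s.call a b) :=
  (hR.setReg (by norm_num)).setReg (by norm_num)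

/-- The summand `4 * |D|` of `deleteCost` covers the pairs of center roots pushed at the two
endpoints, in time and in potential; the two vertex costs cover the refreshes. The remaining work is
paid by the drop of `tot`. -/
theorem wp_delete (hf : Fits n w) (hL : L ≤ n + 3) (h : Ready L c s) (hadj : c.G.Adj u v) :
    WP w ω deleteProg (s.call u v) fun t s' => ∃ c', Ready L c' s' ∧ c'.G = cutEdge c.G u v ∧
      c'.D = c.D ∧ t + 500 * c'.tot L ≤ 500 * (c.tot L + deleteCost L c.D c.G u v) := by
  classical
  have hne : u ≠ v := hadj.ne
  set s₀ := s.call u v with hs₀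
  have hR₀ : Rep L c s₀ := h.rep.call u v
  have h0 : s₀.reg 0 = u := by simp [hs₀, State.call]
  have h1 : s₀.reg 1 = v := by simp [hs₀, State.call]
  clear_value s₀
  have hdn : c.ds.length ≤ n := by simpa using h.ds_nodup.length_le_card
  have hbig : ∀ k, k ≤ 8 * (n + 2) → k < 2 ^ w := fun k hk => hf.lt_sq (by nlinarith)
  refine WP.seq (WP.store (WP.seq (WP.store ?_)))
  have hi1 : (idx (.reg 0) (.reg 1)).eval w s₀ = u * n + v :=
    eval_idx (a := .reg 0) (b := .reg 1) hf hR₀.reg_n h0 (Fin.lt_two_mul u) h1 v.2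
  have hi2 : (idx (.reg 1) (.reg 0)).eval w (s₀.setArr 2 (u * n + v) 0) = v * n + u :=
    eval_idx (a := .reg 1) (b := .reg 0) hf hR₀.reg_n h1 (Fin.lt_two_mul v) h0 u.2
  rw [hi1, Expr.eval_ofNat, Nat.zero_mod, hi2, Expr.eval_ofNat, Nat.zero_mod]
  have hR₁ := hR₀.cutGraph (u := u) (v := v)
  set s₁ := (s₀.setArr 2 (u * n + v) 0).setArr 2 (v * n + u) 0 with hs₁
  have h0₁ : s₁.reg 0 = u := by simp [hs₁, h0]
  have h1₁ : s₁.reg 1 = v := by simp [hs₁, h1]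
  clear_value s₁
  refine WP.seq ((wp_pushCenters hf hR₁ (by simp [h.stk]; exact hbig _ (by omega)) (by norm_num)
    h0₁).mono ?_)
  rintro t₂ s₂ ⟨hR₂, hE₂, ht₂⟩
  have h1₂ := (hE₂.reg 1 (by norm_num) (by norm_num)).trans h1₁
  refine WP.seq ((wp_pushCenters hf hR₂ (by simp [h.stk]; exact hbig _ (by omega)) (by norm_num)
    h1₂).mono ?_)
  rintro t₃ s₃ ⟨hR₃, hE₃, ht₃⟩
  have h0₃ : s₃.reg 0 = u := (hE₃.reg 0 (by norm_num) (by norm_num)).trans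
    ((hE₂.reg 0 (by norm_num) (by norm_num)).trans h0₁)
  have h1₃ : s₃.reg 1 = v := (hE₃.reg 1 (by norm_num) (by norm_num)).trans h1₂
  change Rep L (c.cut u v) s₃ at hR₃
  change t₂ ≤ 50 * (c.ds.length + 1) at ht₂
  change t₃ ≤ 50 * (c.ds.length + 1) at ht₃
  have hI₃ := h.inv.cut (u := u) (v := v) h.stk fun r hr => (h.mem_ds r).2 hr
  set X : Set (Fin n) := {x | x = u ∧ c.Dirty u v ∨ x = v ∧ c.Dirty v u} with hX
  have hlen₃ : (c.cut u v).stk.length = 2 * c.ds.length := by simp [Conf.cut, h.stk]; omega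
  have htot₃ : (c.cut u v).tot L = c.tot L + 2 * c.ds.length := by
    have e1 : ∀ p : Fin n × Fin n, (c.cut u v).pairPot L p.1 p.2 = c.pairPot L p.1 p.2 :=
      fun _ => rfl
    have e2 : ∀ p : Fin n, (c.cut u v).zpot p = c.zpot p := fun _ => rfl
    simp only [Conf.tot, Conf.pot, e1, e2, hlen₃, h.stk, List.length_nil]
    omega
  refine WP.seq (WP.assign (WP.seq (WP.assign (WP.seq ?_))))
  simp only [Expr.eval_reg, State.reg_setReg, h0₃, h1₃, OfNat.one_ne_ofNat, if_false]
  set s₄ := (s₃.setReg 11 u).setReg 15 v with hs₄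
  have hR₄ : Rep L (c.cut u v) s₄ := (hR₃.setReg (by norm_num)).setReg (by norm_num)
  refine (wp_condRefresh (x := u) (y := v) hf hR₄ hI₃ ?_ (by rw [hlen₃]; exact hbig _ (by omega))
    (by simp [hs₄]) (by simp [hs₄])).mono ?_
  · have : (c.cut u v).Dirty u v ↔ c.Dirty u v := Iff.rfl
    rw [this]; simp [hX, hne]
  rintro t₅ s₅ ⟨c₅, hR₅, hI₅, hE₅, hlen₅, hreg₅, ht₅⟩
  have h0₅ : s₅.reg 0 = u := by
    rw [hreg₅ 0 (by norm_num) (by norm_num) (by norm_num) (by norm_num)]; simp [hs₄, h0₃]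
  have h1₅ : s₅.reg 1 = v := by
    rw [hreg₅ 1 (by norm_num) (by norm_num) (by norm_num) (by norm_num)]; simp [hs₄, h1₃]
  refine WP.seq (WP.assign (WP.seq (WP.assign (WP.seq ?_))))
  simp only [Expr.eval_reg, State.reg_setReg, h0₅, h1₅, OfNat.zero_ne_ofNat, if_false]
  set s₆ := (s₅.setReg 11 v).setReg 15 u with hs₆
  have hR₆ : Rep L c₅ s₆ := (hR₅.setReg (by norm_num)).setReg (by norm_num)
  have hz₅ : c₅.zp v = c.zp v := hE₅.zp v hne.symm
  have hsl₅ : c₅.sl true = c.sl true := hE₅.sl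
  have hdv : c₅.Dirty v u ↔ c.Dirty v u := by rw [Conf.Dirty, Conf.Dirty, hz₅, hsl₅]
  refine (wp_condRefresh (x := v) (y := u) hf hR₆ hI₅ ?_ (hbig _ (by omega))
    (by simp [hs₆]) (by simp [hs₆])).mono ?_
  · rw [hdv]; simp [hX, hne.symm]
  rintro t₇ s₇ ⟨c₇, hR₇, hI₇, hE₇, hlen₇, -, ht₇⟩
  have hX₇ : (X \ {u}) \ {v} = ∅ := by
    ext x; simp [hX]; tauto
  rw [hX₇] at hI₇
  -- Both endpoints are now in order, so the full invariant holds again and the waiting pairs can be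
  -- processed.
  refine (wp_run hf hL hR₇ hI₇ (hI₇.pot_lt hf hL ?_)).mono ?_
  · nlinarith
  rintro t₈ s₈ ⟨c₈, hR₈, hI₈, hS, hstk₈, ht₈⟩
  have hG₇ : c₇.G = cutEdge c.G u v := hE₇.G.trans hE₅.G
  have hD₇ : c₇.D = c.D := hE₇.D.trans hE₅.D
  have hds₇ : c₇.ds = c.ds := hE₇.ds.trans hE₅.ds
  have hD₈ : c₈.D = c.D := by rw [hS]; exact hD₇
  have hds₈ : c₈.ds = c.ds := by rw [hS]; exact hds₇
  refine ⟨c₈, ⟨hR₈, hI₈, hstk₈, by rw [hds₈, hD₈]; exact h.mem_ds, by rw [hds₈]; exact h.ds_nodup⟩,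
    by rw [hS]; exact hG₇, hD₈, ?_⟩
  have hzsum : ∑ x, c₈.zpot x = ∑ x, c₇.zpot x := by rw [hS]; rfl
  have hc₈ : c₈.tot L = c₈.pot L + ∑ x, c₇.zpot x := by rw [Conf.tot, hzsum]
  have hc₇ : c₇.tot L = c₇.pot L + ∑ x, c₇.zpot x := rfl
  have hdc₁ : (if (c.cut u v).Dirty u v then (c.cut u v).buildCost L u + (2 * n + 1) else 0) ≤
      vertexCost L c.D c.G (cutEdge c.G u v) u v := by
    have := dirtyCost_le (x := u) (y := v) h.inv (c' := c.cut u v) rfl rfl rfl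
    exact this
  have hdc₂ : (if c₅.Dirty v u then c₅.buildCost L v + (2 * n + 1) else 0) ≤
      vertexCost L c.D c.G (cutEdge c.G u v) v u := by
    have := dirtyCost_le (x := v) (y := u) h.inv (c' := c₅) hz₅ hsl₅ hE₅.D
    rw [hE₅.G] at this
    rw [← if_congr hdv rfl rfl] at this
    exact this
  rw [deleteCost, ← h.length_ds]
  simp only [cost_idx, Expr.cost_reg, Expr.cost_ofNat]
  omega

/-! ## Queries -/

def queryProg : Prog :=
  .assign 10 (.load 10 (idx (.reg 0) (.reg 1))) ;; .assign 0 (.reg 10) ;;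
  .assign 1 (.bin .lt (.reg 10) (.reg 4))

theorem wp_query (hf : Fits n w) (h : Ready L c s) :
    WP w ω queryProg (s.call u v) fun t s' => Ready L c s' ∧ t ≤ 30 ∧
      s'.answer = if c.lev u v < L then (c.lev u v : ℕ∞) else ⊤ := by
  have hR := h.rep.call u v
  have he : (Expr.load 10 (idx (.reg 0) (.reg 1))).eval w (s.call u v) = c.lev u v := by
    rw [Expr.eval_load, eval_idx (a := .reg 0) (b := .reg 1) (x := u) (y := v) hf hR.reg_n
      (by simp [State.call]) (Fin.lt_two_mul u) (by simp [State.call]) v.2, hR.lev]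
  refine WP.seq (WP.assign (WP.seq (WP.assign (WP.assign ⟨?_, by simp, ?_⟩))))
  · exact ⟨((hR.setReg (by norm_num)).setReg (by norm_num)).setReg (by norm_num), h.inv, h.stk,
      h.mem_ds, h.ds_nodup⟩
  · rw [he]
    simp only [State.answer, State.reg_setReg, Expr.eval_reg, Expr.eval_lt, if_true, hf.one_mod]
    simp only [Nat.reduceEqDiff, if_false, OfNat.ofNat_ne_zero, zero_ne_one, hR.reg_L]
    split_ifs <;> simp_all

theorem edist_lt_of_ne_top {G : SimpleGraph (Fin n)} (h : G.edist u v ≠ ⊤) :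
    G.edist u v < n := by
  obtain ⟨p, hp, hlen⟩ := (SimpleGraph.edist_ne_top_iff_reachable.1 h).exists_path_of_dist
  have := hp.length_lt
  rw [Fintype.card_fin] at this
  refine lt_of_le_of_lt (SimpleGraph.Walk.edist_le p) ?_
  exact_mod_cast this

/-- A distance that is at most `d` is finite, hence also below `n`. Adding `2` therefore stays below
the cap `min d n + 3`, and a capped level may safely be reported as `⊤`. -/
theorem Ready.estimate {d : ℕ} (h : Ready (min d n + 3) c s) :
    IsAdditiveTwoEstimate d (c.G.edist u v)
      (if c.lev u v < min d n + 3 then (c.lev u v : ℕ∞) else ⊤) := by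
  have hub : (c.lev u v : ℕ∞) ≤ c.G.edist u v + 2 :=
    (h.inv.lev_ub u v).trans (by gcongr; cases c.D u <;> simp)
  split_ifs with hlt
  · exact ⟨h.inv.edist_le_lev h.stk hlt, fun _ => hub⟩
  · refine ⟨le_top, fun hd => absurd ?_ hlt⟩
    have hne : c.G.edist u v ≠ ⊤ := ne_top_of_le_ne_top (ENat.natCast_ne_top d) hd
    have hn := edist_lt_of_ne_top hne
    obtain ⟨k, hk⟩ := ENat.ne_top_iff_exists.1 hne
    rw [← hk] at hd hn hub
    norm_cast at hd hn hub
    omega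

/-! ## Sequences of operations -/

/-- Bound for the amortized cost of a sequence of operations. -/
noncomputable def opsCost (L : ℕ) (D : Fin n → Bool) :
    SimpleGraph (Fin n) → List (Op n) → ℕ
  | _, [] => 0
  | G, .delete u v :: ops => deleteCost L D G u v + opsCost L D (cutEdge G u v) ops
  | G, .query _ _ :: ops => opsCost L D G ops

theorem exists_serves (hf : Fits n w) {d : ℕ} {D : DataStructure} (hdel : D.delete = deleteProg)
    (hq : D.query = queryProg) {ops : List (Op n)} (h : Ready (min d n + 3) c s)
    (hleg : Legal c.G ops) :
    ∃ T R, D.Serves w ω s ops T R ∧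
      List.Forall₂ (fun δ r => IsAdditiveTwoEstimate d δ r.estimate ∧ r.time ≤ 30)
        (queryDists c.G ops) R ∧
      T ≤ 500 * (c.tot (min d n + 3) + opsCost (min d n + 3) c.D c.G ops) := by
  induction ops generalizing c s with
  | nil => exact ⟨0, [], .nil s, .nil, Nat.zero_le _⟩
  | cons op ops ih =>
    cases op with
    | delete u v =>
      obtain ⟨t, s', hex, c', hr, hG, hD, ht⟩ := wp_delete (w := w) (ω := ω) hf (by omega) h hleg.1
      obtain ⟨T, R, hS, hF, hT⟩ := ih hr (by rw [hG]; exact hleg.2)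
      refine ⟨t + T, R, .delete (by rwa [hdel]) hS, by rw [hG] at hF; exact hF, ?_⟩
      rw [hG, hD] at hT
      rw [opsCost]
      omega
    | query u v =>
      obtain ⟨t, s', hex, hr, ht, hans⟩ := wp_query (w := w) (ω := ω) (u := u) (v := v) hf h
      obtain ⟨T, R, hS, hF, hT⟩ := ih hr hleg
      refine ⟨T, _, .query (by rwa [hq]) hS, .cons ⟨?_, ht⟩ hF, hT⟩
      rw [hans]
      exact h.estimate

end

/-! ## Initialization -/

/-- Number of coin flips for each vertex: a vertex becomes a center with probability `2 ^ (-j)`. -/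
noncomputable def sampleExp (n m : ℕ) : ℕ := sInf {j | m ≤ 4 ^ j * n}

/-- The vertices all of whose coin flips succeed. -/
def centers {n : ℕ} (ω : Tape) (j : ℕ) (r : Fin n) : Bool :=
  decide (∀ t < j, ω (r * j + t) = true)

/-- The empty configuration. -/
def Conf.empty (n : ℕ) : Conf n :=
  ⟨⊥, fun _ => false, [], fun _ _ => [], fun _ _ => [], fun _ => 0, fun _ _ => 0, fun _ _ => 0, []⟩

/-- Set up the constants and the number of coin flips. -/
def setupProg : Prog :=
  .assign 3 (.reg 0) ;; .assign 7 (.reg 1) ;;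
  .ite (.bin .lt (.reg 2) (.reg 0)) (.assign 4 (.reg 2 + 3)) (.assign 4 (.reg 0 + 3)) ;;
  .assign 9 1 ;;
  .while (.bin .lt (.reg 9 * .reg 3) (.reg 7))
    (.assign 9 (.reg 9 * 4) ;; .assign 8 (.reg 8 + 1))

/-- Flip the coins of all vertices. -/
def sampleProg : Prog :=
  .assign 11 0 ;;
  .while (.bin .lt (.reg 11) (.reg 3))
    (.assign 12 1 ;; .assign 13 0 ;;
      .while (.bin .lt (.reg 13) (.reg 8))
        (.flip 14 ;; .assign 12 (.reg 12 * .reg 14) ;; .assign 13 (.reg 13 + 1)) ;;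
      .ite (.reg 12) (.store 3 (.reg 11) 1 ;; .store 4 (.reg 6) (.reg 11) ;;
        .assign 6 (.reg 6 + 1)) .skip ;;
      .assign 11 (.reg 11 + 1))

/-- Insert the edge between the vertices in registers `12` and `13`. -/
def addEdgeProg : Prog :=
  .store 2 (idx (.reg 12) (.reg 13)) 1 ;; .store 2 (idx (.reg 13) (.reg 12)) 1 ;;
  appProg (idx 1 (.reg 12)) (idx 1 (.reg 13)) (.reg 12) (.reg 13) ;;
  appProg (idx 1 (.reg 13)) (idx 1 (.reg 12)) (.reg 13) (.reg 12)

/-- Read the edges. -/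
def edgesProg : Prog :=
  .assign 11 0 ;;
  .while (.bin .lt (.reg 11) (.reg 7))
    (.assign 12 (.load 0 (.reg 11)) ;; .assign 13 (.load 1 (.reg 11)) ;;
      addEdgeProg ;; .assign 11 (.reg 11 + 1))

/-- Refresh all vertices. -/
def refreshAllProg : Prog :=
  .assign 11 0 ;;
  .while (.bin .lt (.reg 11) (.reg 3)) (refreshProg ;; .assign 11 (.reg 11 + 1))

def initProg : Prog := setupProg ;; sampleProg ;; edgesProg ;; refreshAllProg ;; runProg

section
variable {n w L d : ℕ} {ω : Tape} {c : Conf n} {s : State} {x y u v : Fin n}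
  {E : List (Fin n × Fin n)}

theorem rep_empty (h3 : s.reg 3 = n) (h4 : s.reg 4 = L) (h5 : s.reg 5 = 0) (h6 : s.reg 6 = 0)
    (ha : ∀ a i, 2 ≤ a → s.arr a i = 0) : Rep L (Conf.empty n) s where
  reg_n := h3
  reg_L := h4
  reg_sp := h5
  reg_cd := h6
  alive := fun u v => .inr ⟨fun h => h, ha _ _ (by norm_num)⟩
  inD := fun u => ha _ _ (by norm_num)
  ds := fun i y h => by simp [Conf.empty] at h
  slc := fun b v => ha _ _ (by norm_num)
  sl := fun b v i y h => by simp [Conf.empty] at h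
  dlc := fun b v => ha _ _ (by norm_num)
  dl := fun b v i y h => by simp [Conf.empty] at h
  zp := fun v => ha _ _ (by norm_num)
  lev := fun r v => ha _ _ (by norm_num)
  ptr := fun r v => ha _ _ (by norm_num)
  stk := fun i p h => by simp [Conf.empty] at h

theorem wp_setup (hf : Fits n w) (hn : 0 < n) (hm : E.length ≤ n * n) :
    WP w ω setupProg (inputState n d E) fun t s' => Rep (min d n + 3) (Conf.empty n) s' ∧
      s'.reg 7 = E.length ∧ s'.reg 8 = sampleExp n E.length ∧ s'.pos = 0 ∧
      s'.arr = (inputState n d E).arr ∧ t ≤ 50 * (E.length + 1) := by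
  set m := E.length with hmdef
  have hsq : ∀ k, k ≤ 16 * (n * n) + 16 → k % 2 ^ w = k := fun k hk =>
    Nat.mod_eq_of_lt (hf.lt_sq (by nlinarith))
  set s₀ := inputState n d E with hs₀
  have h0 : s₀.reg 0 = n := rfl
  have h1 : s₀.reg 1 = m := rfl
  have h2 : s₀.reg 2 = d := rfl
  have hr : ∀ k, 2 < k → s₀.reg k = 0 := fun k hk => by
    simp [hs₀, inputState, show k ≠ 0 by omega, show k ≠ 1 by omega, show k ≠ 2 by omega]
  have hp : s₀.pos = 0 := rfl
  have harr : ∀ a i, 2 ≤ a → s₀.arr a i = 0 := fun a i ha => by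
    simp [hs₀, inputState, show a ≠ 0 by omega, show a ≠ 1 by omega]
  clear_value s₀
  have hloop : ∀ s₁ : State, s₁.reg 3 = n → s₁.reg 4 = min d n + 3 → s₁.reg 5 = 0 →
      s₁.reg 6 = 0 → s₁.reg 7 = m → s₁.reg 8 = 0 → s₁.pos = 0 → s₁.arr = s₀.arr →
      WP w ω (.assign 9 1 ;; .while (.bin .lt (.reg 9 * .reg 3) (.reg 7))
        (.assign 9 (.reg 9 * 4) ;; .assign 8 (.reg 8 + 1))) s₁ fun t s' =>
          Rep (min d n + 3) (Conf.empty n) s' ∧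
          s'.reg 7 = m ∧ s'.reg 8 = sampleExp n m ∧ s'.pos = 0 ∧
          s'.arr = s₀.arr ∧ t ≤ 30 * (m + 1) := by
    intro s₁ g3 g4 g5 g6 g7 g8 gp ga
    refine WP.seq (WP.assign ?_)
    refine (WP.while (c := 0) (fun i s' => s'.reg 3 = n ∧ s'.reg 4 = min d n + 3 ∧ s'.reg 5 = 0 ∧
      s'.reg 6 = 0 ∧ s'.reg 7 = m ∧ s'.reg 8 = i ∧ s'.reg 9 = 4 ^ i ∧ s'.pos = 0 ∧
      s'.arr = s₀.arr ∧ ∀ k < i, 4 ^ k * n < m) (fun i => 30 * (m - i)) ?_ ?_).mono ?_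
    · simp [g3, g4, g5, g6, g7, g8, gp, ga, hf.one_mod]
    · rintro i s' ⟨k3, k4, k5, k6, k7, k8, k9, kp, ka, hk⟩ he
      -- The previous power passed the test, so `4 ^ (i - 1) * n < m ≤ n * n`; the current power is
      -- small enough not to overflow.
      have hi : 4 ^ i ≤ 4 * n := by
        rcases i with _ | i
        · omega
        · have := hk i (by omega)
          rw [pow_succ]
          have : 4 ^ i < n := Nat.lt_of_mul_lt_mul_right (this.trans_le hm)
          omega
      have h4n : 4 ^ i * n ≤ 4 * (n * n) := by nlinarith
      have hlt : 4 ^ i * n < m := by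
        by_contra hge
        rw [Expr.eval_lt, Expr.eval_mul, Expr.eval_reg, Expr.eval_reg, Expr.eval_reg, k9, k3, k7,
          hsq _ (by omega), if_neg hge] at he
        exact he rfl
      have him : i < m := (Nat.lt_pow_self (by norm_num : 1 < 4)).trans_le
        ((Nat.le_mul_of_pos_right _ hn).trans hlt.le)
      refine WP.seq (WP.assign (WP.assign ⟨i + 1, ?_, ?_⟩))
      · have e1 : (4 ^ i * (4 % 2 ^ w)) % 2 ^ w = 4 ^ (i + 1) := by
          rw [hf.small_mod (k := 4) (by norm_num), ← pow_succ, hsq]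
          have : n ≤ n * n := Nat.le_mul_of_pos_right _ hn
          rw [pow_succ]; omega
        have e2 : (i + 1 % 2 ^ w) % 2 ^ w = i + 1 := by
          rw [hf.one_mod, hsq]; omega
        simp only [Expr.eval_mul, Expr.eval_add, Expr.eval_reg, Expr.eval_ofNat, State.reg_setReg,
          State.pos_setReg, State.arr_setReg, k3, k4, k5, k6, k7, k8, k9, kp, ka, Nat.reduceEqDiff,
          if_false, if_true, e1, e2, true_and]
        intro k hk'
        rcases Nat.lt_succ_iff_lt_or_eq.1 hk' with h | rfl
        · exact hk k h
        · exact hlt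
      · simp; omega
    · rintro t s' ⟨i, ⟨k3, k4, k5, k6, k7, k8, k9, kp, ka, hk⟩, he, ht⟩
      have hi : 4 ^ i ≤ 4 * n := by
        rcases i with _ | i
        · omega
        · have := hk i (by omega)
          rw [pow_succ]
          have : 4 ^ i < n := Nat.lt_of_mul_lt_mul_right (this.trans_le hm)
          omega
      have h4n : 4 ^ i * n ≤ 4 * (n * n) := by nlinarith
      have hge : m ≤ 4 ^ i * n := by
        by_contra hlt
        rw [Expr.eval_lt, Expr.eval_mul, Expr.eval_reg, Expr.eval_reg, Expr.eval_reg, k9, k3, k7,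
          hsq _ (by omega), if_pos (not_le.1 hlt), hf.one_mod] at he
        exact one_ne_zero he
      refine ⟨rep_empty k3 k4 k5 k6 (fun a i h => by rw [ka]; exact harr a i h), k7, ?_, kp, ka, ?_⟩
      · rw [k8]
        refine le_antisymm (le_csInf ⟨i, hge⟩ fun k hk' => ?_) (Nat.sInf_le hge)
        by_contra hlt
        have := hk k (by omega)
        have hk'' : m ≤ 4 ^ k * n := hk'
        omega
      · simp at ht ⊢; omega
  refine WP.seq (WP.assign (WP.seq (WP.assign (WP.seq (WP.ite (fun h => WP.assign ?_)
    fun h => WP.assign ?_)))))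
  · have hdn : d < n := by
      by_contra hge
      simp [h2, h0, hge] at h
    refine (hloop _ (by simp [h0]) ?_ (by simp [hr]) (by simp [hr]) (by simp [h1]) (by simp [hr])
      (by simp [hp]) (by simp)).mono ?_
    · simp only [Expr.eval_add, Expr.eval_reg, Expr.eval_ofNat, State.reg_setReg, if_true,
        hf.small_mod (show 3 ≤ 16 by norm_num), Nat.reduceEqDiff, if_false, h2, h0]
      rw [hsq (d + 3) (by have := Nat.le_mul_of_pos_right n hn; omega), min_eq_left hdn.le]
    · rintro t s' ⟨g1, g2, g3, g4, g5, ht⟩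
      exact ⟨g1, g2, g3, g4, g5, by simp at ht ⊢; omega⟩
  · have hdn : n ≤ d := by
      by_contra hge
      simp [h2, h0, not_le.1 hge, hf.one_mod] at h
    refine (hloop _ (by simp [h0]) ?_ (by simp [hr]) (by simp [hr]) (by simp [h1]) (by simp [hr])
      (by simp [hp]) (by simp)).mono ?_
    · simp only [Expr.eval_add, Expr.eval_reg, Expr.eval_ofNat, State.reg_setReg, if_true,
        hf.small_mod (show 3 ≤ 16 by norm_num), Nat.reduceEqDiff, if_false, h0]
      rw [hsq (n + 3) (by have := Nat.le_mul_of_pos_right n hn; omega), min_eq_right hdn]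
    · rintro t s' ⟨g1, g2, g3, g4, g5, ht⟩
      exact ⟨g1, g2, g3, g4, g5, by simp at ht ⊢; omega⟩

/-- The configuration with a new set of centers. -/
def Conf.setD (c : Conf n) (D : Fin n → Bool) (ds : List (Fin n)) : Conf n :=
  { c with D := D, ds := ds }

/-- Vertex `i` reads the tape on the block from `i * j` to `(i + 1) * j`, whatever the outcomes, so
different vertices use disjoint coins. -/
theorem wp_coin {i j : ℕ} (hf : Fits n w) (hj : j < 2 ^ w) (h8 : s.reg 8 = j) (h12 : s.reg 12 = 1)
    (h13 : s.reg 13 = 0) (hpos : s.pos = i * j) :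
    WP w ω (.while (.bin .lt (.reg 13) (.reg 8))
        (.flip 14 ;; .assign 12 (.reg 12 * .reg 14) ;; .assign 13 (.reg 13 + 1))) s fun t s' =>
      (s'.reg 12 = if ∀ t < j, ω (i * j + t) = true then 1 else 0) ∧ s'.pos = (i + 1) * j ∧
      s'.arr = s.arr ∧ (∀ k, k < 12 → s'.reg k = s.reg k) ∧ t ≤ 20 * (j + 1) := by
  refine (WP.for (n := j) (i := 0) (B := 10) (I := fun t s' =>
      (s'.reg 12 = if ∀ t' < t, ω (i * j + t') = true then 1 else 0) ∧ s'.pos = i * j + t ∧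
      s'.arr = s.arr ∧ (∀ k, k < 12 → s'.reg k = s.reg k) ∧ s'.reg 13 = t) (Nat.zero_le _)
      ?_ ?_ ?_).mono ?_
  · exact ⟨by simp [h12], by simp [hpos], rfl, fun _ _ => rfl, h13⟩
  · rintro t s' ⟨-, -, -, hreg, h13'⟩
    simp [h13', hreg 8 (by norm_num), h8, hf.one_mod]
  · rintro t s' ⟨h12', hpos', harr, hreg, h13'⟩ ht
    refine WP.seq (WP.flip (WP.seq (WP.assign (WP.assign ⟨⟨?_, ?_, ?_, ?_, ?_⟩, ?_⟩))))
    · have hiff : (∀ t' < t + 1, ω (i * j + t') = true) ↔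
          (∀ t' < t, ω (i * j + t') = true) ∧ ω (i * j + t) = true := by
        constructor
        · exact fun h => ⟨fun t' ht' => h t' (by omega), h t (by omega)⟩
        · rintro ⟨h1, h2⟩ t' ht'
          rcases Nat.lt_succ_iff_lt_or_eq.1 ht' with h | rfl
          · exact h1 t' h
          · exact h2
      simp only [hiff]
      simp only [State.setReg, Function.update_apply, Expr.eval_mul, Expr.eval_reg, h12', hpos',
        hf.one_mod]
      have key : ∀ (A B : Prop) [Decidable A] [Decidable B],
          ((if A then 1 else 0) * (if B then 1 else 0)) % 2 ^ w = if A ∧ B then 1 else 0 := by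
        intro A B _ _
        by_cases hA : A <;> by_cases hB : B <;> simp [hA, hB, hf.one_mod]
      simp only [Nat.reduceEqDiff, if_true, if_false]
      convert key _ _
    · simp [hpos']; omega
    · exact harr
    · intro k hk
      simp [State.setReg, show k ≠ 12 by omega, show k ≠ 13 by omega,
        show k ≠ 14 by omega, hreg k hk]
    · simp only [State.setReg, Function.update_apply, Expr.eval_add, Expr.eval_reg, h13',
        Expr.eval_ofNat, hf.one_mod]
      simpa [h13'] using Nat.mod_eq_of_lt (show t + 1 < 2 ^ w by omega)
    · simp
  · rintro t s' ⟨⟨h12', hpos', harr, hreg, -⟩, ht⟩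
    refine ⟨h12', by rw [hpos']; ring, harr, hreg, ?_⟩
    simp at ht; omega

theorem Rep.addCenter (hR : Rep L c s) :
    Rep L (c.setD (Function.update c.D x true) (c.ds ++ [x]))
      (((s.setArr 3 x 1).setArr 4 c.ds.length x).setReg 6 (c.ds.length + 1)) :=
  { hR with
    reg_cd := by simp [Conf.setD]
    inD := fun u => by
      simp only [State.arr_setReg, State.arr_setArr, Conf.setD, Function.update_apply, Fin.val_inj]
      by_cases h : u = x <;> simp [h, hR.inD]
    ds := fun i y hy => by
      simp only [State.arr_setReg, State.arr_setArr, true_and]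
      by_cases hi : i = c.ds.length
      · subst hi; simp [Conf.setD] at hy; simp [hy]
      · have := (List.getElem?_eq_some_iff.1 hy).1
        simp [Conf.setD] at this
        have hy' : (c.ds ++ [x])[i]? = some y := hy
        rw [List.getElem?_append_left (by omega)] at hy'
        simp [hi, hR.ds i y hy'] }

theorem wp_sample {j : ℕ} (hf : Fits n w) (hj : j < 2 ^ w) (hR : Rep L (Conf.empty n) s)
    (h8 : s.reg 8 = j) (hpos : s.pos = 0) :
    WP w ω sampleProg s fun t s' => ∃ ds : List (Fin n),
      Rep L ((Conf.empty n).setD (centers ω j) ds) s' ∧ ds.Nodup ∧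
      (∀ r, r ∈ ds ↔ centers ω j r = true) ∧ s'.reg 7 = s.reg 7 ∧
      (∀ a < 2, s'.arr a = s.arr a) ∧ t ≤ 100 * (n * (j + 1) + 1) := by
  refine WP.seq (WP.assign ?_)
  refine (WP.for (n := n) (i := 0) (B := 20 * j + 60) (I := fun i s' => ∃ ds : List (Fin n),
      Rep L ((Conf.empty n).setD (fun r => decide ((r : ℕ) < i) && centers ω j r) ds) s' ∧ ds.Nodup ∧
      (∀ r : Fin n, r ∈ ds ↔ (r : ℕ) < i ∧ centers ω j r = true) ∧ s'.reg 7 = s.reg 7 ∧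
      (∀ a < 2, s'.arr a = s.arr a) ∧ s'.reg 8 = j ∧ s'.reg 11 = i ∧ s'.pos = i * j)
      (Nat.zero_le _) ?_ ?_ ?_).mono ?_
  · refine ⟨[], ?_, List.nodup_nil, by simp, by simp, fun _ _ => rfl, by simp [h8], by simp,
      by simp [hpos]⟩
    simpa [Conf.setD, Conf.empty] using hR.setReg (by norm_num)
  · rintro i s' ⟨ds, hR', -, -, -, -, -, h11, -⟩
    simp [h11, hR'.reg_n, hf.one_mod]
  · rintro i s' ⟨ds, hR', hnd, hmem, h7, harr, h8', h11, hpos'⟩ hi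
    have hi1 : (i + 1) % 2 ^ w = i + 1 := Nat.mod_eq_of_lt (hf.lt_sq (by nlinarith))
    have hdsn : ds.length ≤ n := by simpa using hnd.length_le_card
    have hds1 : (ds.length + 1) % 2 ^ w = ds.length + 1 :=
      Nat.mod_eq_of_lt (hf.lt_sq (by nlinarith))
    set x : Fin n := ⟨i, hi⟩ with hx
    have hxi : (x : ℕ) = i := rfl
    refine WP.seq (WP.assign (WP.seq (WP.assign (WP.seq ((wp_coin (i := i) hf hj (by simp [h8'])
      (by simp [hf.one_mod]) (by simp) (by simp [hpos'])).mono ?_)))))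
    rintro t₁ s₁ ⟨h12, hpos₁, harr₁, hreg₁, ht₁⟩
    have hreg : ∀ k < 12, s₁.reg k = s'.reg k := fun k hk => by
      rw [hreg₁ k hk]
      simp [show k ≠ 12 by omega, show k ≠ 13 by omega]
    have hR₁ : Rep L ((Conf.empty n).setD (fun r => decide ((r : ℕ) < i) && centers ω j r) ds) s₁ :=
      hR'.congr (fun k h1 h2 => hreg k (by omega)) fun a ha => by rw [harr₁]; rfl
    have harr' : ∀ a < 2, s₁.arr a = s.arr a := fun a ha => by
      rw [harr₁]; exact harr a ha
    refine WP.seq (WP.ite (fun h => ?_) fun h => ?_)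
    · rw [Expr.eval_reg, h12] at h
      have hc : centers ω j x = true := by
        by_contra hc
        simp only [centers, decide_eq_true_eq] at hc
        rw [if_neg hc] at h
        exact h rfl
      refine WP.seq (WP.store (WP.seq (WP.store (WP.assign (WP.assign ⟨⟨ds ++ [x], ?_, ?_, ?_, ?_,
        ?_, ?_, ?_, ?_⟩, ?_⟩)))))
      · refine Rep.setReg ?_ (by norm_num)
        have := hR₁.addCenter (x := x)
        have e : (Conf.setD ((Conf.empty n).setD (fun r => decide ((r : ℕ) < i) && centers ω j r) ds)
            (Function.update (fun r : Fin n => decide ((r : ℕ) < i) && centers ω j r) x true)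
            (ds ++ [x])) =
            (Conf.empty n).setD (fun r => decide ((r : ℕ) < i + 1) && centers ω j r) (ds ++ [x]) := by
          simp only [Conf.setD, Conf.mk.injEq, true_and, and_true]
          funext r
          by_cases hr : r = x
          · simp [hr, hc, hxi]
          · have hri : (r : ℕ) ≠ i := fun h => hr (Fin.ext h)
            have : ((r : ℕ) < i + 1) ↔ (r : ℕ) < i := by omega
            simp [hr, this]
        change Rep L (Conf.setD ((Conf.empty n).setD (fun r => decide ((r : ℕ) < i) && centers ω j r)
          ds) (Function.update (fun r : Fin n => decide ((r : ℕ) < i) && centers ω j r) x true)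
          (ds ++ [x])) _ at this
        rw [e] at this
        have hcd : s₁.reg 6 = ds.length := hR₁.reg_cd
        simp only [Expr.eval_reg, Expr.eval_ofNat, Expr.eval_add, State.reg_setArr, hf.one_mod,
          hreg 11 (by norm_num), h11, hcd, hds1]
        exact this
      · refine List.nodup_append.2 ⟨hnd, List.nodup_singleton _, ?_⟩
        rintro a ha b hb rfl
        rw [List.mem_singleton.1 hb, hmem] at ha
        exact absurd ha.1 (by simp [hx])
      · intro r
        rw [List.mem_append, hmem, List.mem_singleton]
        by_cases hr : r = x
        · simp [hr, hc, hxi]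
        · have hri : (r : ℕ) ≠ i := fun h => hr (Fin.ext h)
          have : ((r : ℕ) < i + 1) ↔ (r : ℕ) < i := by omega
          simp [hr, this]
      · simp [hreg 7 (by norm_num), h7]
      · intro a ha
        funext k
        simp [show a ≠ 3 by omega, show a ≠ 4 by omega, harr' a ha]
      · simp [hreg 8 (by norm_num), h8']
      · simp [hreg 11 (by norm_num), h11, hf.one_mod, hi1]
      · simp [hpos₁]
      · simp; omega
    · rw [Expr.eval_reg, h12] at h
      have hc : centers ω j x = false := by
        simp only [centers, decide_eq_false_iff_not]
        intro hc
        rw [if_pos hc] at h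
        exact one_ne_zero h
      refine WP.skip (WP.assign ⟨⟨ds, ?_, hnd, ?_, ?_, ?_, ?_, ?_, ?_⟩, ?_⟩)
      · have e : (fun r : Fin n => decide ((r : ℕ) < i + 1) && centers ω j r) =
            fun r : Fin n => decide ((r : ℕ) < i) && centers ω j r := by
          funext r
          by_cases hr : r = x
          · simp [hr, hc]
          · have hri : (r : ℕ) ≠ i := fun h => hr (Fin.ext h)
            have : ((r : ℕ) < i + 1) ↔ (r : ℕ) < i := by omega
            simp [this]
        rw [e]
        exact hR₁.setReg (by norm_num)
      · intro r
        rw [hmem]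
        by_cases hr : r = x
        · simp [hr, hc]
        · have hri : (r : ℕ) ≠ i := fun h => hr (Fin.ext h)
          have : ((r : ℕ) < i + 1) ↔ (r : ℕ) < i := by omega
          simp [this]
      · simp [hreg 7 (by norm_num), h7]
      · exact harr'
      · simp [hreg 8 (by norm_num), h8']
      · simp [hreg 11 (by norm_num), h11, hf.one_mod, hi1]
      · simp [hpos₁]
      · simp; omega
  · rintro t s' ⟨⟨ds, hR', hnd, hmem, h7, harr, -⟩, ht⟩
    refine ⟨ds, ?_, hnd, fun r => ?_, h7, harr, ?_⟩
    · simpa using hR'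
    · rw [hmem]; simp
    · simp at ht ⊢; nlinarith

end

/-! ### Reading the graph and the first refresh of all vertices -/

section
variable {n w L d : ℕ} {ω : Tape} {c : Conf n} {s : State} {x y u v : Fin n}
  {E : List (Fin n × Fin n)} {D : Fin n → Bool} {ds : List (Fin n)}

/-- The configuration `c` stores the graph with the listed edges, and nothing has been computed. -/
structure EdgesRead (D : Fin n → Bool) (ds : List (Fin n)) (E : List (Fin n × Fin n))
    (c : Conf n) : Prop where
  D : c.D = D
  ds : c.ds = ds
  slF : ∀ v, c.sl false v = []
  dlF : ∀ v, c.dl false v = []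
  dlT : c.dl true = c.sl true
  zp : ∀ v, c.zp v = 0
  lev : ∀ r v, c.lev r v = 0
  ptr : ∀ r v, c.ptr r v = 0
  stk : c.stk = []
  adj : ∀ x y, c.G.Adj x y ↔ s(x, y) ∈ E.map fun e => s(e.1, e.2)
  mem_sl : ∀ x y, y ∈ c.sl true x ↔ s(x, y) ∈ E.map fun e => s(e.1, e.2)
  sl_nodup : ∀ v, (c.sl true v).Nodup

/-- The configuration with one more edge. -/
def Conf.addEdge (c : Conf n) (a b : Fin n) : Conf n :=
  (({ c with G := c.G ⊔ SimpleGraph.edge a b } : Conf n).app true a b).app true b a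

theorem EdgesRead.addEdge {a b : Fin n} (h : EdgesRead D ds E c) (hab : a ≠ b)
    (hnew : s(a, b) ∉ E.map fun e => s(e.1, e.2)) :
    EdgesRead D ds (E ++ [(a, b)]) (c.addEdge a b) := by
  have hsl : ∀ v, (c.addEdge a b).sl true v =
      if v = a then c.sl true a ++ [b] else if v = b then c.sl true b ++ [a] else c.sl true v := by
    intro v
    simp only [Conf.addEdge, Conf.app, upd2, true_and]
    split_ifs <;> simp_all
  have hdl : ∀ v, (c.addEdge a b).dl true v =
      if v = a then c.sl true a ++ [b] else if v = b then c.sl true b ++ [a] else c.sl true v := by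
    intro v
    simp only [Conf.addEdge, Conf.app, upd2, true_and, h.dlT]
    split_ifs <;> simp_all
  have hmem : ∀ x y, s(x, y) ∈ ((E ++ [(a, b)]).map fun e => s(e.1, e.2)) ↔
      s(x, y) ∈ (E.map fun e => s(e.1, e.2)) ∨ (x = a ∧ y = b ∨ x = b ∧ y = a) := by
    intro x y
    rw [List.map_append, List.mem_append, List.map_singleton, List.mem_singleton, Sym2.eq_iff]
  refine ⟨h.D, h.ds, fun v => ?_, fun v => ?_, ?_, h.zp, h.lev, h.ptr, h.stk, fun x y => ?_,
    fun x y => ?_, fun v => ?_⟩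
  · simpa [Conf.addEdge, Conf.app, upd2] using h.slF v
  · simpa [Conf.addEdge, Conf.app, upd2] using h.dlF v
  · funext v; rw [hsl, hdl]
  · change (c.G ⊔ SimpleGraph.edge a b).Adj x y ↔ _
    rw [SimpleGraph.sup_adj, SimpleGraph.edge_adj, h.adj, hmem]
    refine or_congr_right ⟨fun h => h.1, fun h => ⟨h, ?_⟩⟩
    rcases h with ⟨rfl, rfl⟩ | ⟨rfl, rfl⟩
    · exact hab
    · exact hab.symm
  · rw [hsl, hmem]
    split_ifs with h1 h2
    · subst h1; simp [h.mem_sl, hab]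
    · subst h2; simp [h.mem_sl, hab.symm]
    · simp [h.mem_sl, h1, h2]
  · rw [hsl]
    have hb : b ∉ c.sl true a := by rwa [h.mem_sl]
    have ha : a ∉ c.sl true b := by rwa [h.mem_sl, Sym2.eq_swap]
    split_ifs with h1 h2
    · refine List.nodup_append.2 ⟨h.sl_nodup _, List.nodup_singleton _, ?_⟩
      rintro x hx y hy rfl; rw [List.mem_singleton.1 hy] at hx; exact hb hx
    · refine List.nodup_append.2 ⟨h.sl_nodup _, List.nodup_singleton _, ?_⟩
      rintro x hx y hy rfl; rw [List.mem_singleton.1 hy] at hx; exact ha hx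
    · exact h.sl_nodup v

theorem EdgesRead.length_sl_le (h : EdgesRead D ds E c) (b) (v : Fin n) :
    (c.sl b v).length ≤ n := by
  cases b
  · simp [h.slF]
  · simpa using (h.sl_nodup v).length_le_card

theorem EdgesRead.length_dl_le (h : EdgesRead D ds E c) (b) (v : Fin n) :
    (c.dl b v).length ≤ n := by
  cases b
  · simp [h.dlF]
  · rw [h.dlT]; exact h.length_sl_le true v

theorem Rep.addEdgeGraph (hR : Rep L c s) (huv : u ≠ v) :
    Rep L { c with G := c.G ⊔ SimpleGraph.edge u v }
      ((s.setArr 2 (u * n + v) 1).setArr 2 (v * n + u) 1) :=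
  { hR with
    alive := fun x y => by
      simp only [State.arr_setArr, true_and, idx_inj y.2 u.2, idx_inj y.2 v.2, Fin.val_inj]
      rw [SimpleGraph.sup_adj, SimpleGraph.edge_adj]
      have := hR.alive x y
      by_cases h1 : x = v ∧ y = u
      · left; obtain ⟨rfl, rfl⟩ := h1; simp [huv.symm]
      by_cases h2 : x = u ∧ y = v
      · left; obtain ⟨rfl, rfl⟩ := h2; simp [huv]
      simpa [h1, h2] using this }

theorem wp_addEdge (hf : Fits n w) (hR : Rep L c s) (h : EdgesRead D ds E c) (huv : u ≠ v)
    (hnew : s(u, v) ∉ E.map fun e => s(e.1, e.2)) (h12 : s.reg 12 = u) (h13 : s.reg 13 = v) :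
    WP w ω addEdgeProg s fun t s' =>
      Rep L (c.addEdge u v) s' ∧ s'.reg = s.reg ∧ (∀ a < 2, s'.arr a = s.arr a) ∧ t ≤ 300 := by
  have hread := h.addEdge huv hnew
  have hlu : (c.sl true u).length < n := by
    have h1 := hread.length_sl_le true u
    have h2 : (c.addEdge u v).sl true u = c.sl true u ++ [v] := by
      simp [Conf.addEdge, Conf.app, upd2, huv]
    rw [h2] at h1; simpa using h1
  have hlv : (c.sl true v).length < n := by
    have h1 := hread.length_sl_le true v
    have h2 : (c.addEdge u v).sl true v = c.sl true v ++ [u] := by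
      simp [Conf.addEdge, Conf.app, upd2, huv.symm]
    rw [h2] at h1; simpa using h1
  refine WP.seq (WP.store (WP.seq (WP.store ?_)))
  rw [eval_idx (a := .reg 12) (b := .reg 13) hf hR.reg_n h12 (Fin.lt_two_mul u) h13 v.2,
    Expr.eval_ofNat, hf.one_mod, eval_idx (a := .reg 13) (b := .reg 12) hf
      (s := s.setArr 2 (u * n + v) 1) hR.reg_n h13 (Fin.lt_two_mul v) h12 u.2,
    Expr.eval_ofNat, hf.one_mod]
  have hR₁ := hR.addEdgeGraph huv
  set s₁ := (s.setArr 2 (u * n + v) 1).setArr 2 (v * n + u) 1 with hs₁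
  have hreg₁ : s₁.reg = s.reg := rfl
  have harr₁ : ∀ a < 2, s₁.arr a = s.arr a := fun a ha => by
    funext k; simp [hs₁, show a ≠ 2 by omega]
  clear_value s₁
  set c₁ : Conf n := { c with G := c.G ⊔ SimpleGraph.edge u v } with hc₁
  have hn₁ := hR₁.reg_n
  refine WP.seq ((wp_appProg hf hR₁ (b := true) (x := u) (y := v)
    (fun s' hE => eval_row_true (e := .reg 12) hf (by rw [hE.1, hn₁]) (by simp [hE.1, hreg₁, h12]))
    (fun s' hE => eval_row_true (e := .reg 13) hf (by rw [hE.1, hn₁]) (by simp [hE.1, hreg₁, h13]))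
    (fun s' hE => by simp [hE.1, hreg₁, h12]) (fun s' hE => by simp [hE.1, hreg₁, h13])
    h.length_sl_le h.length_dl_le hlu (by change (c.dl true v).length < n; rwa [h.dlT])).mono ?_)
  rintro t₂ s₂ ⟨hE₂, hR₂, ht₂⟩
  have hreg₂ : s₂.reg = s.reg := hE₂.1.trans hreg₁
  have hn₂ := hR₂.reg_n
  have h2sl : (c₁.app true u v).sl true v = c.sl true v := by
    simp [Conf.app, upd2, huv.symm, hc₁]
  have h2dl : (c₁.app true u v).dl true u = c.dl true u := by
    simp [Conf.app, upd2, huv, hc₁]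
  refine (wp_appProg hf hR₂ (b := true) (x := v) (y := u)
    (fun s' hE => eval_row_true (e := .reg 13) hf (by rw [hE.1, hn₂]) (by simp [hE.1, hreg₂, h13]))
    (fun s' hE => eval_row_true (e := .reg 12) hf (by rw [hE.1, hn₂]) (by simp [hE.1, hreg₂, h12]))
    (fun s' hE => by simp [hE.1, hreg₂, h13]) (fun s' hE => by simp [hE.1, hreg₂, h12])
    (fun b x => ?_) (fun b x => ?_) (by rwa [h2sl]) (by rwa [h2dl, h.dlT])).mono ?_
  · simp only [Conf.app, upd2]
    split_ifs with hh
    · simp [hc₁]; omega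
    · exact h.length_sl_le b x
  · simp only [Conf.app, upd2]
    split_ifs with hh
    · simp [hc₁, h.dlT]; omega
    · exact h.length_dl_le b x
  rintro t₃ s₃ ⟨hE₃, hR₃, ht₃⟩
  refine ⟨hR₃, hE₃.1.trans hreg₂, fun a ha => ?_, ?_⟩
  · rw [hE₃.2.2 a (by omega), hE₂.2.2 a (by omega), harr₁ a ha]
  · simp at ht₂ ht₃ ⊢; omega

/-- With every vertex in `X` nothing is claimed about centers and witnesses. Completeness of the
empty scan lists is only required where the position `0` is the end of the static list, that is, at
isolated vertices. -/
theorem EdgesRead.inv {G : SimpleGraph (Fin n)} (h : EdgesRead D ds E c) (hE : IsEdgeList G E) :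
    c.G = G ∧ c.Inv L Set.univ ∅ := by
  have hG : c.G = G := by
    ext x y
    rw [h.adj, ← hE.2, SimpleGraph.mem_edgeSet]
  refine ⟨hG, ?_⟩
  constructor
  · intro b v; cases b
    · simp [h.slF]
    · exact h.sl_nodup v
  · intro b v; cases b
    · simp [h.dlF]
    · rw [h.dlT]; exact h.sl_nodup v
  · intro v y hy; rw [h.mem_sl, ← h.adj]; exact hy
  · intro b v y; cases b
    · simp [h.slF, h.dlF]
    · rw [h.dlT, h.mem_sl, h.mem_sl, Sym2.eq_swap]
  · intro v y hy; simp [h.slF] at hy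
  · intro v; simp [h.zp]
  · intro v i y hi; simp [h.zp] at hi
  · intro v hv; simp at hv
  · intro v _; exact h.slF v
  · intro v _ hz y hy
    rw [h.adj, ← h.mem_sl, List.length_eq_zero_iff.1 (hz.symm.trans (h.zp v))] at hy
    simp at hy
  · intro v; exact h.lev v v
  · intro r v; simp [h.lev]
  · intro r v; simp [h.lev]
  · intro r v; simp [h.ptr]
  · intro r v i y hi; simp [h.ptr] at hi
  · intro r v hv; simp at hv

theorem EdgesRead.empty : EdgesRead D ds [] ((Conf.empty n).setD D ds) := by
  constructor <;> simp [Conf.empty, Conf.setD]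

theorem wp_edges {G : SimpleGraph (Fin n)} (hf : Fits n w) (hE : IsEdgeList G E)
    (hm : E.length ≤ n * n) (hR : Rep L ((Conf.empty n).setD D ds) s) (h7 : s.reg 7 = E.length)
    (harr : ∀ a < 2, s.arr a = (inputState n d E).arr a) :
    WP w ω edgesProg s fun t s' => ∃ c, Rep L c s' ∧ EdgesRead D ds E c ∧
      t ≤ 400 * (E.length + 1) := by
  refine WP.seq (WP.assign ?_)
  refine (WP.for (n := E.length) (i := 0) (B := 350) (I := fun i s' => ∃ c, Rep L c s' ∧
    EdgesRead D ds (E.take i) c ∧ s'.reg 7 = E.length ∧ s'.reg 11 = i ∧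
    ∀ a < 2, s'.arr a = (inputState n d E).arr a) (Nat.zero_le _) ?_ ?_ ?_).mono ?_
  · exact ⟨_, hR.setReg (by norm_num), by simpa using EdgesRead.empty, by simp [h7], by simp, harr⟩
  · rintro i s' ⟨c, hR', -, h7', h11, -⟩
    simp [h7', h11, hf.one_mod]
  · rintro i s' ⟨c, hR', hread, h7', h11, harr'⟩ hi
    have hi1 : (i + 1) % 2 ^ w = i + 1 := Nat.mod_eq_of_lt (hf.lt_sq (by nlinarith))
    rcases he : E[i] with ⟨a, b⟩
    have he' : E[i]? = some (a, b) := by rw [List.getElem?_eq_getElem hi, he]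
    have htake : E.take (i + 1) = E.take i ++ [(a, b)] := by
      rw [List.take_add_one, he']; rfl
    have hab : a ≠ b := by
      have : s(a, b) ∈ G.edgeSet := by
        rw [hE.2]; exact List.mem_map.2 ⟨(a, b), List.mem_of_getElem? he', rfl⟩
      exact ((SimpleGraph.mem_edgeSet G).1 this).ne
    have hnew : s(a, b) ∉ (E.take i).map fun e => s(e.1, e.2) := by
      have h1 : ((E.take (i + 1)).map fun e => s(e.1, e.2)).Nodup := by
        rw [List.map_take]; exact hE.1.sublist (List.take_sublist _ _)
      rw [htake, List.map_append, List.nodup_append] at h1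
      exact fun hmem => h1.2.2 _ hmem _ (by simp) rfl
    have e1 : (Expr.load 0 (.reg 11)).eval w s' = a := by
      simp [h11, harr' 0 (by norm_num), inputState, he']
    have e2 : ∀ k, (Expr.load 1 (.reg 11)).eval w (s'.setReg 12 k) = b := fun k => by
      simp [h11, harr' 1 (by norm_num), inputState, he']
    refine WP.seq (WP.assign (WP.seq (WP.assign ?_)))
    rw [e1, e2]
    refine WP.seq ((wp_addEdge (u := a) (v := b) hf ((hR'.setReg (by norm_num)).setReg
      (by norm_num)) hread hab hnew (by simp) (by simp)).mono ?_)
    rintro t₁ s₁ ⟨hR₁, hreg₁, harr₁, ht₁⟩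
    refine WP.assign ⟨⟨_, hR₁.setReg (by norm_num), ?_, by simp [hreg₁, h7'],
      by simp [hreg₁, h11, hf.one_mod, hi1], fun a ha => ?_⟩, ?_⟩
    · rw [htake]; exact hread.addEdge hab hnew
    · rw [State.arr_setReg, harr₁ a ha]; exact harr' a ha
    · simp; omega
  · rintro t s' ⟨⟨c, hR', hread, -⟩, ht⟩
    refine ⟨c, hR', by simpa using hread, ?_⟩
    simp at ht ⊢; omega

open Classical in
/-- Work caused by `x` if it has no adjacent center in the initial graph. -/
noncomputable def initCost (L : ℕ) (D : Fin n → Bool) (G : SimpleGraph (Fin n)) (x : Fin n) : ℕ :=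
  if ∀ y, G.Adj x y → D y = false then (G.neighborSet x).ncard * (n * (3 * L + 1)) else 0

theorem wp_refreshAll (hf : Fits n w) (hR : Rep L c s) (hI : c.Inv L Set.univ ∅)
    (hstk : c.stk = []) :
    WP w ω refreshAllProg s fun t s' => ∃ c', Rep L c' s' ∧ c'.Inv L ∅ ∅ ∧ c'.G = c.G ∧
      c'.D = c.D ∧ c'.ds = c.ds ∧ c'.stk.length ≤ n * n ∧
      t + 500 * c'.tot L ≤ 500 * (c.tot L + ∑ x, (initCost L c.D c.G x + (2 * n + 2)) + 1) := by
  refine WP.seq (WP.assign ?_)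
  -- The vertices from `p.1` on are still to be refreshed; they form the exceptional set, and the
  -- potential contains their future costs.
  refine (WP.while (c := (0, c)) (fun p s' => p.1 ≤ n ∧ Rep L p.2 s' ∧
    p.2.Inv L {x | p.1 ≤ (x : ℕ)} ∅ ∧ p.2.G = c.G ∧ p.2.D = c.D ∧ p.2.ds = c.ds ∧
    p.2.stk.length ≤ p.1 * n ∧ s'.reg 11 = p.1)
    (fun p => 500 * (p.2.tot L + ∑ x ∈ Finset.univ.filter fun y : Fin n => p.1 ≤ (y : ℕ),
      (initCost L c.D c.G x + (2 * n + 2)))) ?_ ?_).mono ?_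
  · refine ⟨Nat.zero_le _, hR.setReg (by norm_num), ?_, rfl, rfl, rfl, by simp [hstk], by simp⟩
    convert hI using 1
    ext x; simp
  · rintro ⟨i, c'⟩ s' ⟨hi, hR', hI', hG, hD, hds, hlen, h11⟩ he
    change c'.stk.length ≤ i * n at hlen
    have hi : i < n := by
      by_contra h
      simp [show s'.reg 11 = i from h11, hR'.reg_n, h] at he
    have hi1 : (i + 1) % 2 ^ w = i + 1 := Nat.mod_eq_of_lt (hf.lt_sq (by nlinarith))
    set x : Fin n := ⟨i, hi⟩ with hx
    refine WP.seq ((wp_refresh (x := x) hf hR' hI' (by simp [hx])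
      (hf.lt_sq (by change c'.stk.length + n ≤ _; nlinarith)) h11).mono ?_)
    rintro t s₁ ⟨c₁, hR₁, hI₁, hE₁, hlen₁, hreg₁, -, ht₁⟩
    have h11₁ : s₁.reg 11 = i := by
      rw [hreg₁ 11 (by norm_num) (by norm_num) (by norm_num) (by norm_num)]; exact h11
    refine WP.assign ⟨(i + 1, c₁), ⟨hi, hR₁.setReg (by norm_num), ?_, hE₁.G.trans hG,
      hE₁.D.trans hD, hE₁.ds.trans hds, ?_, by simp [h11₁, hf.one_mod, hi1]⟩, ?_⟩
    · convert hI₁ using 1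
      ext y
      simp only [Set.mem_ofPred_eq, Set.mem_sdiff, Set.mem_singleton_iff, hx, Fin.ext_iff]
      omega
    · change c₁.stk.length = c'.stk.length + n at hlen₁
      change c₁.stk.length ≤ (i + 1) * n
      rw [Nat.succ_mul]; omega
    · have hsplit : (Finset.univ.filter fun y : Fin n => i ≤ (y : ℕ)) =
          insert x (Finset.univ.filter fun y : Fin n => i + 1 ≤ (y : ℕ)) := by
        ext y
        simp only [Finset.mem_filter, Finset.mem_univ, true_and, Finset.mem_insert, hx, Fin.ext_iff]
        omega
      have hcost : c'.buildCost L x ≤ initCost L c.D c.G x := by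
        rw [Conf.buildCost, initCost, Conf.deg, hG, hD]
        split_ifs with h1 h2 h2
        · rfl
        · exact absurd h1.2 h2
        · exact Nat.zero_le _
        · exact Nat.zero_le _
      change t + 500 * c₁.tot L ≤ 500 * (c'.tot L + c'.buildCost L x + 2 * n + 1) at ht₁
      simp only [hsplit]
      rw [Finset.sum_insert (by simp [hx])]
      simp
      omega
  · rintro t s' ⟨⟨i, c'⟩, ⟨hi, hR', hI', hG, hD, hds, hlen, h11⟩, he, ht⟩
    have hin : i = n := by
      by_contra h
      have : i < n := lt_of_le_of_ne hi h
      simp [show s'.reg 11 = i from h11, hR'.reg_n, this, hf.one_mod] at he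
    subst hin
    refine ⟨c', hR', ?_, hG, hD, hds, hlen, ?_⟩
    · convert hI' using 1
      ext x; simp
    · simp at ht ⊢; omega

open Classical in
/-- Bound for the potential and the work at the start, `n` being the number of vertices. -/
noncomputable def startCost (L : ℕ) (D : Fin n → Bool) (G : SimpleGraph (Fin n)) : ℕ :=
  n * n * L + ∑ r, (if D r = true then
      4 * L * (∑ v, (G.neighborSet v).ncard + n * (G.neighborSet r).ncard) else 0) +
    2 * ∑ v, (G.neighborSet v).ncard + ∑ x, (initCost L D G x + (2 * n + 2))

/-- At the start a root that is not a center has only empty lists and contributes `L` for each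
vertex. Only center roots see the edges. -/
theorem EdgesRead.tot_le {G : SimpleGraph (Fin n)} (h : EdgesRead D ds E c) (hE : IsEdgeList G E)
    (hL : 0 < L) : c.tot L + ∑ x, (initCost L D G x + (2 * n + 2)) ≤ startCost L D G := by
  classical
  have hlen : ∀ v, (c.sl true v).length = (G.neighborSet v).ncard := fun v => by
    rw [← List.toFinset_card_of_nodup (h.sl_nodup v), ← Set.ncard_coe_finset]
    congr 1; ext y
    simp [h.mem_sl, ← (h.inv (L := L) hE).1, h.adj]
  have hp : ∀ r v, c.pairPot L r v ≤ L + if D r = true then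
      4 * L * ((G.neighborSet v).ncard + (G.neighborSet r).ncard) else 0 := fun r v => by
    rw [← hlen, ← hlen]
    cases hD : D r
    · simp [Conf.pairPot, Conf.wt, Conf.deps, h.D, hD, h.slF, h.dlF, h.lev]
    · simp only [Conf.pairPot, Conf.wt, Conf.deps, h.D, hD, h.dlT, h.lev, h.ptr, cond_true,
        List.length_append, List.length_map, if_true, Nat.sub_zero]
      have : (c.sl true v).length ≤ L * (c.sl true v).length := Nat.le_mul_of_pos_left _ hL
      nlinarith [Nat.zero_le (L * (c.sl true r).length)]
  have hz : ∀ v, c.zpot v ≤ 2 * (G.neighborSet v).ncard := fun v => by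
    rw [← hlen, Conf.zpot]; split_ifs <;> omega
  have h1 : ∑ p : Fin n × Fin n, c.pairPot L p.1 p.2 ≤ n * n * L + ∑ r, (if D r = true then
      4 * L * (∑ v, (G.neighborSet v).ncard + n * (G.neighborSet r).ncard) else 0) := by
    refine (Finset.sum_le_sum fun p _ => hp p.1 p.2).trans (le_of_eq ?_)
    rw [Fintype.sum_prod_type (f := fun p : Fin n × Fin n => L + if D p.1 = true then
      4 * L * ((G.neighborSet p.2).ncard + (G.neighborSet p.1).ncard) else 0)]
    have : ∀ r, (∑ v, (L + if D r = true then
        4 * L * ((G.neighborSet v).ncard + (G.neighborSet r).ncard) else 0)) = n * L +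
        if D r = true then 4 * L * (∑ v, (G.neighborSet v).ncard + n * (G.neighborSet r).ncard)
        else 0 := fun r => by
      split_ifs
      · rw [Finset.sum_add_distrib, ← Finset.mul_sum, Finset.sum_add_distrib]; simp
      · simp
    simp only [this]
    rw [Finset.sum_add_distrib]
    simp [mul_assoc]
  have h2 : ∑ v, c.zpot v ≤ 2 * ∑ v, (G.neighborSet v).ncard := by
    rw [Finset.mul_sum]; exact Finset.sum_le_sum fun v _ => hz v
  have h3 : c.stk.length = 0 := by rw [h.stk]; rfl
  rw [Conf.tot, Conf.pot, startCost]
  omega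

theorem wp_init {G : SimpleGraph (Fin n)} (hf : Fits n w) (hn : 0 < n) (hE : IsEdgeList G E)
    (hm : E.length ≤ n * n) (hj : sampleExp n E.length < 2 ^ w) :
    WP w ω initProg (inputState n d E) fun t s' => ∃ c, Ready (min d n + 3) c s' ∧ c.G = G ∧
      c.D = centers ω (sampleExp n E.length) ∧ t + 500 * c.tot (min d n + 3) ≤
        500 * (startCost (min d n + 3) (centers ω (sampleExp n E.length)) G +
          n * (sampleExp n E.length + 1) + E.length + 4) := by
  refine WP.seq ((wp_setup hf hn hm).mono ?_)
  rintro t₁ s₁ ⟨hR₁, h7₁, h8₁, hpos₁, harr₁, ht₁⟩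
  refine WP.seq ((wp_sample hf hj hR₁ h8₁ hpos₁).mono ?_)
  rintro t₂ s₂ ⟨ds, hR₂, hnd, hmem, h7₂, harr₂, ht₂⟩
  refine WP.seq ((wp_edges (d := d) hf hE hm hR₂ (h7₂.trans h7₁)
    fun a ha => by rw [harr₂ a ha, harr₁]).mono ?_)
  rintro t₃ s₃ ⟨c₃, hR₃, hread, ht₃⟩
  obtain ⟨hG₃, hI₃⟩ := hread.inv (L := min d n + 3) hE
  refine WP.seq ((wp_refreshAll hf hR₃ hI₃ hread.stk).mono ?_)
  rintro t₄ s₄ ⟨c₄, hR₄, hI₄, hG₄, hD₄, hds₄, hlen₄, ht₄⟩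
  refine (wp_run hf (by omega) hR₄ hI₄ (hI₄.pot_lt hf (by omega) (by nlinarith))).mono ?_
  rintro t₅ s₅ ⟨c₅, hR₅, hI₅, hS, hstk₅, ht₅⟩
  have hD₅ : c₅.D = centers ω (sampleExp n E.length) := by
    rw [hS]; exact hD₄.trans hread.D
  have hds₅ : c₅.ds = ds := by rw [hS]; exact hds₄.trans hread.ds
  refine ⟨c₅, ⟨hR₅, hI₅, hstk₅, by rw [hds₅, hD₅]; exact hmem, by rw [hds₅]; exact hnd⟩,
    by rw [hS]; exact hG₄.trans hG₃, hD₅, ?_⟩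
  have hzsum : ∑ x, c₅.zpot x = ∑ x, c₄.zpot x := by rw [hS]; rfl
  have hc₅ : c₅.tot (min d n + 3) = c₅.pot (min d n + 3) + ∑ x, c₄.zpot x := by
    rw [Conf.tot, hzsum]
  have hc₄ : c₄.tot (min d n + 3) = c₄.pot (min d n + 3) + ∑ x, c₄.zpot x := rfl
  have hstart := hread.tot_le (L := min d n + 3) hE (by omega)
  rw [hread.D, hG₃] at ht₄
  omega

end

/-! ## The law of the centers -/

/-- The law of the set of centers when each vertex flips `j` coins. -/
noncomputable def centersLaw (n j : ℕ) : Measure (Fin n → Bool) :=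
  coinLaw.map fun ω => centers ω j

theorem measurable_centers {n j : ℕ} : Measurable fun ω : Tape => (centers ω j : Fin n → Bool) := by
  refine measurable_pi_lambda _ fun r => measurable_to_bool ?_
  have : (fun ω : Tape => (centers ω j : Fin n → Bool) r) ⁻¹' {true} =
      ⋂ t ∈ Set.Iio j, (fun ω : Tape => ω (r * j + t)) ⁻¹' {true} := by
    ext ω; simp [centers]
  rw [this]
  exact MeasurableSet.biInter (Set.to_countable _) fun t _ =>
    measurable_pi_apply _ (measurableSet_singleton _)

instance : IsProbabilityMeasure coinLaw := by
  unfold coinLaw; infer_instance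

instance {n j : ℕ} : IsProbabilityMeasure (centersLaw n j) :=
  Measure.isProbabilityMeasure_map measurable_centers.aemeasurable

/-- The blocks of coins of different vertices are disjoint (`hinj`), so the event is a cylinder
prescribing `A.card * j` fair coins. -/
theorem centersLaw_forall_true {n j : ℕ} (A : Finset (Fin n)) :
    (centersLaw n j).real {D | ∀ i ∈ A, D i = true} = ((1 / 2 : ℝ) ^ j) ^ A.card := by
  have hinj : Set.InjOn (fun x : Fin n × ℕ => (x.1 : ℕ) * j + x.2) (A ×ˢ Finset.range j) := by
    rintro ⟨a, s⟩ hs ⟨b, t⟩ ht h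
    simp only [Set.mem_prod, Finset.mem_coe, Finset.mem_range] at hs ht h
    have hab : (a : ℕ) = b := by
      have h1 : ((a : ℕ) * j + s) / j = a := by
        rw [mul_comm, Nat.mul_add_div (by omega), Nat.div_eq_of_lt hs.2, add_zero]
      have h2 : ((b : ℕ) * j + t) / j = b := by
        rw [mul_comm, Nat.mul_add_div (by omega), Nat.div_eq_of_lt ht.2, add_zero]
      rw [← h1, ← h2, h]
    rw [hab] at h
    exact Prod.ext (Fin.ext hab) (by simpa using h)
  have hpre : (fun ω : Tape => (centers ω j : Fin n → Bool)) ⁻¹' {D | ∀ i ∈ A, D i = true} =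
      Set.pi ((A ×ˢ Finset.range j).image fun x : Fin n × ℕ => (x.1 : ℕ) * j + x.2)
        fun _ => {true} := by
    ext ω
    simp only [Set.mem_preimage, Set.mem_ofPred_eq, centers, decide_eq_true_eq, Set.mem_pi,
      Finset.coe_image, Set.mem_image, Finset.mem_coe, Finset.mem_product, Finset.mem_range,
      Set.mem_singleton_iff]
    constructor
    · rintro h _ ⟨⟨a, t⟩, ⟨ha, ht⟩, rfl⟩
      exact h a ha t ht
    · intro h a ha t ht
      exact h _ ⟨(a, t), ⟨ha, ht⟩, rfl⟩
  rw [measureReal_def, centersLaw, Measure.map_apply measurable_centers (Set.toFinite _).measurableSet,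
    hpre, coinLaw, Measure.infinitePi_pi _ fun _ _ => measurableSet_singleton _,
    Finset.prod_const, Finset.card_image_of_injOn (by exact_mod_cast hinj), Finset.card_product, Finset.card_range,
    PMF.toMeasure_uniformOfFintype_apply _ (measurableSet_singleton _)]
  simp [mul_comm, pow_mul]

/-- `D` is a random subset of the vertices: each one is chosen independently with probability
`p`. -/
def IsSampling {n : ℕ} (p : ℝ) (μ : Measure (Fin n → Bool)) : Prop :=
  ∀ A S : Finset (Fin n), Disjoint A S →
    μ.real {D | (∀ i ∈ A, D i = true) ∧ ∀ i ∈ S, D i = false} = p ^ A.card * (1 - p) ^ S.card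

/-- Vertices required to be no centers are added one at a time: the probability with `D x = false`
is the one without a condition on `x` minus the one with `D x = true`. -/
theorem isSampling_centersLaw (n j : ℕ) : IsSampling ((1 / 2 : ℝ) ^ j) (centersLaw n j) := by
  intro A S
  induction S using Finset.induction_on generalizing A with
  | empty => intro _; simp [centersLaw_forall_true]
  | insert x S hx ih =>
    intro hd
    rw [Finset.disjoint_insert_right] at hd
    have h1 := ih A hd.2
    have h2 := ih (insert x A) (by rw [Finset.disjoint_insert_left]; exact ⟨hx, hd.2⟩)
    rw [Finset.card_insert_of_notMem hd.1] at h2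
    rw [Finset.card_insert_of_notMem hx]
    have hu : {D : Fin n → Bool | (∀ i ∈ A, D i = true) ∧ ∀ i ∈ S, D i = false} =
        {D | (∀ i ∈ A, D i = true) ∧ ∀ i ∈ insert x S, D i = false} ∪
        {D | (∀ i ∈ insert x A, D i = true) ∧ ∀ i ∈ S, D i = false} := by
      ext D
      simp only [Set.mem_ofPred_eq, Set.mem_union, Finset.forall_mem_insert]
      cases D x <;> simp
    have hdj : Disjoint {D : Fin n → Bool | (∀ i ∈ A, D i = true) ∧ ∀ i ∈ insert x S, D i = false}
        {D | (∀ i ∈ insert x A, D i = true) ∧ ∀ i ∈ S, D i = false} := by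
      rw [Set.disjoint_left]
      rintro D ⟨_, h⟩ ⟨h', _⟩
      simp [h' x (Finset.mem_insert_self _ _)] at h
    rw [hu, measureReal_union hdj (Set.toFinite _).measurableSet, h2] at h1
    rw [eq_sub_of_add_eq h1]
    ring

/-! ### Probabilities of the events that cause work -/

section
variable {n L : ℕ} {p : ℝ} {μ : Measure (Fin n → Bool)}

theorem IsSampling.prob_mem (h : IsSampling p μ) (y : Fin n) : μ.real {D | D y = true} = p := by
  simpa using h {y} ∅ (by simp)

theorem IsSampling.prob_disjoint (h : IsSampling p μ) (S : Set (Fin n)) :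
    μ.real {D | ∀ z ∈ S, D z = false} = (1 - p) ^ S.ncard := by
  classical
  simpa [Set.ncard_eq_toFinset_card'] using h ∅ S.toFinset (by simp)

theorem IsSampling.prob_mem_disjoint (h : IsSampling p μ) {y : Fin n} {S : Set (Fin n)} (hy : y ∉ S) :
    μ.real {D | D y = true ∧ ∀ z ∈ S, D z = false} = p * (1 - p) ^ S.ncard := by
  classical
  simpa [Set.ncard_eq_toFinset_card'] using h {y} S.toFinset (by simpa using hy)

theorem integral_ite [IsProbabilityMeasure μ] (P : (Fin n → Bool) → Prop) [DecidablePred P] (a : ℝ) :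
    ∫ D, (if P D then a else 0) ∂μ = μ.real {D | P D} * a := by
  classical
  rw [← smul_eq_mul, ← integral_indicator_const a (Set.toFinite {D | P D}).measurableSet]
  simp [Set.indicator_apply]

/-! ## Expected costs -/

/-- Bound for the expected work caused at a vertex while its degree drops from `k` to `0`. -/
noncomputable def degPot (p : ℝ) (k : ℕ) : ℝ := 2 / p - (1 - p) ^ k * (k + 2 / p)

/-- The increment dominates both expected costs when the degree drops from `k + 1` to `k`: the
summand `1` covers pushing all pairs of a vertex without center, the summand `p * k` covers building
a list of length `k`. -/
theorem degPot_succ (hp : 0 < p) (k : ℕ) :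
    degPot p (k + 1) = degPot p k + (1 - p) ^ k * (1 + p * k + p) := by
  simp only [degPot]
  push_cast
  field_simp
  ring

theorem degPot_nonneg (hp : 0 < p) (hp1 : p ≤ 1) (k : ℕ) : 0 ≤ degPot p k := by
  induction k with
  | zero => simp [degPot]
  | succ k ih =>
    rw [degPot_succ hp]
    have := sub_nonneg.2 hp1
    positivity

theorem degPot_le (hp : 0 < p) (hp1 : p ≤ 1) (k : ℕ) : degPot p k ≤ 2 / p := by
  have := sub_nonneg.2 hp1
  have : 0 ≤ (1 - p) ^ k * (k + 2 / p) := by positivity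
  rw [degPot]; linarith

theorem mul_pow_le (hp : 0 < p) (hp1 : p ≤ 1) (k : ℕ) : k * (1 - p) ^ k ≤ 2 / p := by
  have h := degPot_nonneg hp hp1 k
  have := sub_nonneg.2 hp1
  have : 0 ≤ (1 - p) ^ k * (2 / p) := by positivity
  rw [degPot] at h; linarith

/-- The term `3 * n * p` pays for the pushes when `y` is a center. All costs caused by the absence
of adjacent centers are charged to `degPot`, whose total decrease is bounded however many deletions
there are. -/
theorem integral_vertexCost_le [IsProbabilityMeasure μ] (h : IsSampling p μ) (hp : 0 < p)
    (hp1 : p ≤ 1) (hL : 0 < L) {G G' : SimpleGraph (Fin n)} {x y : Fin n}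
    (hcard : (G.neighborSet x).ncard = (G'.neighborSet x).ncard + 1) (hy : ¬ G'.Adj x y) :
    ∫ D, (vertexCost L D G G' x y : ℝ) ∂μ ≤ 3 * n * p + n * (3 * L + 1) *
      (degPot p (G.neighborSet x).ncard - degPot p (G'.neighborSet x).ncard) := by
  classical
  have hn : (1 : ℝ) ≤ n := by exact_mod_cast x.pos
  have hL : (1 : ℝ) ≤ L := by exact_mod_cast hL
  have hq := sub_nonneg.2 hp1
  set k := (G'.neighborSet x).ncard with hk
  have hle : ∀ D : Fin n → Bool, (vertexCost L D G G' x y : ℝ) ≤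
      ((if D y = true then (2 * n + 1 : ℝ) else 0) +
      (if ∀ z ∈ G.neighborSet x, D z = false then (2 * n + 1 : ℝ) else 0)) +
      (if D y = true ∧ ∀ z ∈ G'.neighborSet x, D z = false then (k * (n * (3 * L + 1)) : ℝ)
        else 0) := by
    intro D
    rw [vertexCost]
    push_cast
    have : (0 : ℝ) ≤ 2 * n + 1 := by positivity
    refine add_le_add ?_ (le_of_eq ?_)
    · simp only [SimpleGraph.mem_neighborSet]
      split_ifs <;> first | tauto | linarith
    · simp only [SimpleGraph.mem_neighborSet, hk]
  refine (integral_mono .of_finite .of_finite hle).trans ?_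
  rw [integral_add .of_finite .of_finite, integral_add .of_finite .of_finite, integral_ite,
    integral_ite, integral_ite, h.prob_mem, h.prob_disjoint, h.prob_mem_disjoint (by simpa using hy), hcard,
    degPot_succ hp, ← hk]
  have h1 : (0 : ℝ) ≤ (1 - p) ^ k := by positivity
  have h2 : (1 - p) ^ (k + 1) * (2 * n + 1) ≤ (1 - p) ^ k * (n * (3 * L + 1)) := by
    rw [pow_succ, mul_assoc]
    refine mul_le_mul_of_nonneg_left ?_ h1
    nlinarith [mul_nonneg hq (by linarith : (0 : ℝ) ≤ n), mul_le_mul_of_nonneg_left hL (by linarith : (0 : ℝ) ≤ n)]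
  have h3 : p * (2 * n + 1) ≤ 3 * n * p := by nlinarith
  have h4 : 0 ≤ (1 - p) ^ k * p * (n * (3 * L + 1)) := by positivity
  linarith

theorem neighborSet_cutEdge_left (G : SimpleGraph (Fin n)) (u v : Fin n) :
    (cutEdge G u v).neighborSet u = G.neighborSet u \ {v} := by
  ext z
  simp only [cutEdge, SimpleGraph.mem_neighborSet, SimpleGraph.deleteEdges_adj, Set.mem_sdiff,
    Set.mem_singleton_iff, Sym2.eq_iff]
  grind

theorem cutEdge_comm (G : SimpleGraph (Fin n)) (u v : Fin n) : cutEdge G u v = cutEdge G v u := by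
  rw [cutEdge, cutEdge, Sym2.eq_swap]

theorem neighborSet_cutEdge_of_ne (G : SimpleGraph (Fin n)) {u v x : Fin n} (hu : x ≠ u)
    (hv : x ≠ v) : (cutEdge G u v).neighborSet x = G.neighborSet x := by
  ext z
  simp only [cutEdge, SimpleGraph.mem_neighborSet, SimpleGraph.deleteEdges_adj,
    Set.mem_singleton_iff, Sym2.eq_iff]
  grind

theorem ncard_neighborSet_cutEdge {G : SimpleGraph (Fin n)} {u v : Fin n} (h : G.Adj u v) :
    (G.neighborSet u).ncard = ((cutEdge G u v).neighborSet u).ncard + 1 := by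
  rw [neighborSet_cutEdge_left, Set.ncard_sdiff_singleton_add_one (by simpa using h)]

theorem ncard_edgeSet_cutEdge {G : SimpleGraph (Fin n)} {u v : Fin n} (h : G.Adj u v) :
    G.edgeSet.ncard = (cutEdge G u v).edgeSet.ncard + 1 := by
  rw [cutEdge, SimpleGraph.edgeSet_deleteEdges, Set.ncard_sdiff_singleton_add_one (by simpa using h)]

theorem integral_card_centers [IsProbabilityMeasure μ] (h : IsSampling p μ) :
    ∫ D, ({r | D r = true}.ncard : ℝ) ∂μ = n * p := by
  classical
  have : ∀ D : Fin n → Bool, ({r | D r = true}.ncard : ℝ) = ∑ r, if D r = true then (1 : ℝ) else 0 := by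
    intro D
    rw [Set.ncard_eq_toFinset_card', Finset.sum_boole]
    congr 2
    ext; simp
  simp_rw [this]
  rw [integral_finsetSum _ fun _ _ => .of_finite]
  simp_rw [integral_ite, h.prob_mem]
  simp

theorem integral_deleteCost_le [IsProbabilityMeasure μ] (h : IsSampling p μ) (hp : 0 < p)
    (hp1 : p ≤ 1) (hL : 0 < L) {G : SimpleGraph (Fin n)} {u v : Fin n} (huv : G.Adj u v) :
    ∫ D, (deleteCost L D G u v : ℝ) ∂μ ≤ 10 * n * p + 6 + n * (3 * L + 1) *
      (∑ x, degPot p (G.neighborSet x).ncard -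
        ∑ x, degPot p ((cutEdge G u v).neighborSet x).ncard) := by
  have hu := integral_vertexCost_le h hp hp1 hL (ncard_neighborSet_cutEdge huv) (y := v)
    (by simp [cutEdge])
  have hv := integral_vertexCost_le h hp hp1 hL (G := G) (G' := cutEdge G u v) (x := v) (y := u)
    (by rw [cutEdge_comm]; exact ncard_neighborSet_cutEdge huv.symm) (by simp [cutEdge, Sym2.eq_swap])
  have hs : ∑ x, degPot p (G.neighborSet x).ncard -
        ∑ x, degPot p ((cutEdge G u v).neighborSet x).ncard =
      (degPot p (G.neighborSet u).ncard - degPot p ((cutEdge G u v).neighborSet u).ncard) +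
      (degPot p (G.neighborSet v).ncard - degPot p ((cutEdge G u v).neighborSet v).ncard) := by
    rw [← Finset.sum_sub_distrib]
    refine Fintype.sum_eq_add u v huv.ne ?_
    rintro x ⟨h1, h2⟩
    rw [neighborSet_cutEdge_of_ne G h1 h2, sub_self]
  simp only [deleteCost]
  push_cast
  rw [integral_add .of_finite .of_finite, integral_add .of_finite .of_finite,
    integral_add .of_finite .of_finite, integral_const_mul, integral_card_centers h, hs]
  simp only [integral_const, probReal_univ, one_smul]
  linarith

/-- The bounds for single deletions telescope. The sequence is fixed before the centers are drawn,
so each deletion is integrated with its graphs held constant. -/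
theorem integral_opsCost_le [IsProbabilityMeasure μ] (h : IsSampling p μ) (hp : 0 < p)
    (hp1 : p ≤ 1) (hL : 0 < L) {G : SimpleGraph (Fin n)} {ops : List (Op n)} (hleg : Legal G ops) :
    ∫ D, (opsCost L D G ops : ℝ) ∂μ ≤ G.edgeSet.ncard * (10 * n * p + 6) +
      n * (3 * L + 1) * ∑ x, degPot p (G.neighborSet x).ncard := by
  induction ops generalizing G with
  | nil =>
    simp only [opsCost]
    have := Finset.sum_nonneg fun x (_ : x ∈ Finset.univ) =>
      degPot_nonneg hp hp1 (G.neighborSet x).ncard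
    simp only [Nat.cast_zero, integral_zero]
    positivity
  | cons op ops ih =>
    cases op with
    | query u v => exact ih hleg
    | delete u v =>
      have h1 := integral_deleteCost_le h hp hp1 hL hleg.1
      have h2 := ih (G := cutEdge G u v) hleg.2
      simp only [opsCost]
      push_cast
      rw [integral_add .of_finite .of_finite, ncard_edgeSet_cutEdge hleg.1]
      push_cast
      linarith

theorem sum_ncard_neighborSet (G : SimpleGraph (Fin n)) :
    ∑ v, (G.neighborSet v).ncard = 2 * G.edgeSet.ncard := by
  classical
  simp_rw [Set.ncard_eq_toFinset_card']
  exact G.sum_degrees_eq_twice_card_edges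

theorem integral_initCost_le [IsProbabilityMeasure μ] (h : IsSampling p μ) (hp : 0 < p)
    (hp1 : p ≤ 1) {G : SimpleGraph (Fin n)} (x : Fin n) :
    ∫ D, (initCost L D G x : ℝ) ∂μ ≤ n * (3 * L + 1) * (2 / p) := by
  classical
  have : ∀ D : Fin n → Bool, (initCost L D G x : ℝ) = if ∀ y ∈ G.neighborSet x, D y = false then
      ((G.neighborSet x).ncard * (n * (3 * L + 1)) : ℝ) else 0 := by
    intro D
    simp only [initCost, SimpleGraph.mem_neighborSet]
    push_cast
    rfl
  simp_rw [this]
  rw [integral_ite, h.prob_disjoint]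
  have h1 := mul_le_mul_of_nonneg_left (mul_pow_le hp hp1 (G.neighborSet x).ncard)
    (by positivity : (0 : ℝ) ≤ n * (3 * L + 1))
  linarith

theorem integral_startCost_le [IsProbabilityMeasure μ] (h : IsSampling p μ) (hp : 0 < p)
    (hp1 : p ≤ 1) {G : SimpleGraph (Fin n)} :
    ∫ D, (startCost L D G : ℝ) ∂μ ≤ n * n * L + 16 * L * n * G.edgeSet.ncard * p +
      4 * G.edgeSet.ncard + n * (n * (3 * L + 1) * (2 / p) + (2 * n + 2)) := by
  classical
  have hsum : (∑ v, ((G.neighborSet v).ncard : ℝ)) = 2 * G.edgeSet.ncard := by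
    exact_mod_cast sum_ncard_neighborSet G
  have hinit := Finset.sum_le_sum fun x (_ : x ∈ Finset.univ) =>
    integral_initCost_le (L := L) (G := G) h hp hp1 x
  simp only [startCost]
  push_cast
  rw [integral_add .of_finite .of_finite, integral_add .of_finite .of_finite,
    integral_add .of_finite .of_finite, integral_finsetSum _ fun _ _ => .of_finite,
    integral_finsetSum _ fun _ _ => .of_finite, hsum]
  simp_rw [integral_ite, h.prob_mem, integral_add (Integrable.of_finite) (integrable_const _)]
  simp only [← Finset.mul_sum, Finset.sum_add_distrib, hsum]
  simp only [integral_const, probReal_univ, one_smul, Finset.sum_const, Finset.card_univ,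
    Fintype.card_fin, nsmul_eq_mul] at hinit ⊢
  linarith

end

/-! ## The main theorem -/

/-- The data structure. -/
def dataStructure : DataStructure := ⟨initProg, deleteProg, queryProg⟩

section
variable {n m : ℕ}

theorem le_four_pow_sampleExp (hn : 0 < n) : m ≤ 4 ^ sampleExp n m * n := by
  refine Nat.sInf_mem (s := {j | m ≤ 4 ^ j * n}) ⟨m, ?_⟩
  exact (Nat.lt_pow_self (by norm_num)).le.trans (Nat.le_mul_of_pos_right _ hn)

theorem four_pow_lt_of_sampleExp_eq_succ {j : ℕ} (h : sampleExp n m = j + 1) : 4 ^ j * n < m := by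
  by_contra hc
  have : sampleExp n m ≤ j := Nat.sInf_le (not_lt.1 hc)
  omega

theorem sampleExp_le (hm : m ≤ n * n) : sampleExp n m ≤ n := by
  rcases hj : sampleExp n m with _ | j
  · exact Nat.zero_le _
  · have h := four_pow_lt_of_sampleExp_eq_succ hj
    have h1 : 4 ^ j < n := lt_of_mul_lt_mul_right (h.trans_le hm) (Nat.zero_le _)
    exact (Nat.lt_pow_self (by norm_num)).trans h1

theorem IsEdgeList.length_eq {G : SimpleGraph (Fin n)} {E : List (Fin n × Fin n)}
    (hE : IsEdgeList G E) : E.length = G.edgeSet.ncard := by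
  classical
  rw [← List.length_map (f := fun e => s(e.1, e.2)), ← List.toFinset_card_of_nodup hE.1,
    ← Set.ncard_coe_finset]
  congr 1; ext x
  simpa using (hE.2 x).symm

theorem IsEdgeList.length_le {G : SimpleGraph (Fin n)} {E : List (Fin n × Fin n)}
    (hE : IsEdgeList G E) : E.length ≤ n * n := by
  simpa using (List.Nodup.of_map _ hE.1).length_le_card

theorem pow_half_mul_pow (x y : ℝ) (hy : 0 < y) :
    x ^ (1 / 2 : ℝ) * y ^ (3 / 2 : ℝ) = √x * (y * √y) := by
  rw [Real.sqrt_eq_rpow, Real.sqrt_eq_rpow, ← Real.rpow_one_add' hy.le (by norm_num)]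
  norm_num

/-- With `p = (1 / 2) ^ j`, the choice of `j` gives `√m ≤ 2 ^ j * √n`, which bounds the work `m * n
* p` of the center roots. Minimality gives the reverse inequality up to a factor `2`, which bounds
`n * n / p`. The density `m ≥ κ * n` makes the plain `n * n` terms admissible. -/
theorem work_le {κ m n : ℝ} {j : ℕ} (hκ : 0 < κ) (hn : 1 ≤ n) (hκm : κ * n ≤ m) (hmn : m ≤ n * n)
    (hm : m ≤ 4 ^ j * n) (hj : ∀ i, j = i + 1 → 4 ^ i * n < m) (hjn : j ≤ n) :
    n * n ≤ (√κ)⁻¹ * (√m * (n * √n)) ∧ m ≤ √m * (n * √n) ∧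
    m * n * (1 / 2) ^ j ≤ √m * (n * √n) ∧
    n * n * 2 ^ j ≤ (2 + (√κ)⁻¹) * (√m * (n * √n)) ∧
    n * j ≤ (√κ)⁻¹ * (√m * (n * √n)) := by
  have hn0 : 0 < n := by linarith
  have hm0 : 0 < m := lt_of_lt_of_le (by positivity) hκm
  have hsn : √n * √n = n := Real.mul_self_sqrt hn0.le
  have hsm : √m * √m = m := Real.mul_self_sqrt hm0.le
  have hsκ : 0 < √κ := Real.sqrt_pos.2 hκ
  have hn1 : 0 < √n := Real.sqrt_pos.2 hn0
  have hm1 : 0 < √m := Real.sqrt_pos.2 hm0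
  have h4 : ∀ i : ℕ, √((4 : ℝ) ^ i) = 2 ^ i := fun i => by
    rw [show (4 : ℝ) ^ i = (2 ^ i) ^ 2 by rw [← pow_mul, mul_comm, pow_mul]; norm_num]
    exact Real.sqrt_sq (by positivity)
  have h1 : √κ * √n ≤ √m := by
    rw [← Real.sqrt_mul hκ.le]; exact Real.sqrt_le_sqrt hκm
  have h2 : √m ≤ n := by
    rw [← Real.sqrt_mul_self hn0.le]; exact Real.sqrt_le_sqrt hmn
  have h3 : √m ≤ 2 ^ j * √n := by
    rw [← h4, ← Real.sqrt_mul (by positivity)]; exact Real.sqrt_le_sqrt hm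
  have hA : n * n ≤ (√κ)⁻¹ * (√m * (n * √n)) := by
    rw [← mul_le_mul_iff_right₀ hsκ, mul_inv_cancel_left₀ hsκ.ne']
    calc √κ * (n * n) = (√κ * √n) * (n * √n) := by linear_combination -(√κ * n) * hsn
      _ ≤ _ := by gcongr
  have hn2 : 1 ≤ √n := Real.one_le_sqrt.2 hn
  refine ⟨hA, ?_, ?_, ?_, ?_⟩
  · calc m = √m * (√m * 1) := by linear_combination -hsm
      _ ≤ _ := by gcongr
  · rw [one_div, inv_pow, ← div_eq_mul_inv, div_le_iff₀ (by positivity)]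
    calc m * n = √m * n * √m := by linear_combination -n * hsm
      _ ≤ √m * n * (2 ^ j * √n) := by gcongr
      _ = _ := by ring
  -- For `j = 0` there is no smaller exponent to compare with, and `n * n` is bounded through `κ`
  -- instead.
  · rcases j with _ | i
    · rw [pow_zero, mul_one, add_mul]
      have : 0 ≤ 2 * (√m * (n * √n)) := by positivity
      linarith
    · have h5 : 2 ^ i * √n ≤ √m := by
        rw [← h4, ← Real.sqrt_mul (by positivity)]; exact Real.sqrt_le_sqrt (hj i rfl).le
      calc n * n * 2 ^ (i + 1) = 2 * ((2 ^ i * √n) * (n * √n)) := by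
            rw [pow_succ]; linear_combination -(2 * 2 ^ i * n) * hsn
        _ ≤ 2 * (√m * (n * √n)) := by gcongr
        _ ≤ _ := by
          have : 0 ≤ (√κ)⁻¹ * (√m * (n * √n)) := by positivity
          linarith
  · exact (mul_le_mul_of_nonneg_left hjn hn0.le).trans hA

theorem lintegral_centers {j : ℕ} (f : (Fin n → Bool) → ℕ) :
    ∫⁻ ω, (f (centers ω j) : ℝ≥0∞) ∂coinLaw =
      ENNReal.ofReal (∫ D, (f D : ℝ) ∂centersLaw n j) := by
  rw [ofReal_integral_eq_lintegral_ofReal .of_finite (.of_forall fun _ => Nat.cast_nonneg _),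
    centersLaw, lintegral_map (measurable_of_finite _) measurable_centers]
  simp

theorem integral_cost_le {L : ℕ} {κ : ℝ} {G : SimpleGraph (Fin n)} {ops : List (Op n)}
    (hκ : 0 < κ) (hn : 0 < n) (hL : 0 < L) (hm : m = G.edgeSet.ncard) (hmn : m ≤ n * n)
    (hκm : κ * n ≤ m) (hleg : Legal G ops) :
    ∫ D, ((startCost L D G + n * (sampleExp n m + 1) + m + 4 + opsCost L D G ops : ℕ) : ℝ)
      ∂centersLaw n (sampleExp n m) ≤
      L * ((100 + 100 * (√κ)⁻¹) * (√m * (n * √n))) := by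
  set j := sampleExp n m with hj
  set p : ℝ := (1 / 2) ^ j with hp
  have hp0 : 0 < p := by positivity
  have hp1 : p ≤ 1 := pow_le_one₀ (by norm_num) (by norm_num)
  have h := isSampling_centersLaw n j
  have hn1 : (1 : ℝ) ≤ n := by exact_mod_cast hn
  have hL1 : (1 : ℝ) ≤ L := by exact_mod_cast hL
  have h2p : 2 / p = 2 * 2 ^ j := by rw [hp]; simp
  have h1 := integral_startCost_le (L := L) (G := G) h hp0 hp1
  have h2 := integral_opsCost_le h hp0 hp1 hL hleg
  have h3 : ∑ x, degPot p (G.neighborSet x).ncard ≤ n * (2 / p) :=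
    (Finset.sum_le_sum fun x _ => degPot_le hp0 hp1 _).trans (by simp)
  obtain ⟨w1, w2, w3, w4, w5⟩ := work_le (κ := κ) (m := m) (n := n) (j := j) hκ hn1 hκm
    (by exact_mod_cast hmn) (by exact_mod_cast le_four_pow_sampleExp hn)
    (fun i hi => by exact_mod_cast four_pow_lt_of_sampleExp_eq_succ hi)
    (by exact_mod_cast sampleExp_le hmn)
  rw [← hm] at h1 h2
  rw [h2p] at h1 h3
  rw [← hp] at w3
  push_cast
  rw [integral_add .of_finite .of_finite, integral_add .of_finite .of_finite,
    integral_add .of_finite .of_finite, integral_add .of_finite .of_finite]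
  simp only [integral_const, probReal_univ, one_smul]
  set X := √(m : ℝ) * (n * √(n : ℝ))
  set M : ℝ := (m : ℝ)
  set N : ℝ := (n : ℝ)
  set B : ℝ := (2 : ℝ) ^ j
  have hB : 0 ≤ B := by positivity
  have hM : 0 ≤ M := by positivity
  have hX : 0 ≤ X := by positivity
  have hs : 0 ≤ (√κ)⁻¹ := by positivity
  have h4 : N * (3 * L + 1) * ∑ x, degPot p (G.neighborSet x).ncard ≤
      N * (3 * L + 1) * (N * (2 * B)) := by gcongr
  have hNN : N ≤ N * N := by nlinarith
  have h5 : N * (3 * L + 1) * (N * (2 * B)) ≤ L * (8 * (N * N * B)) := by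
    have : 0 ≤ (L - 1) * (2 * (N * N * B)) := mul_nonneg (by linarith) (by positivity)
    linarith
  have hN1 : 1 ≤ N * N := by linarith
  have hup : N * N * L + 16 * L * N * M * p + 4 * M + N * (N * (3 * L + 1) * (2 * B) + (2 * N + 2)) +
      N * (j + 1) + M + 4 + (M * (10 * N * p + 6) + N * (3 * L + 1) * (N * (2 * B))) ≤
      L * (10 * (N * N) + 26 * (M * N * p) + 11 * M + 16 * (N * N * B) + N * j) := by
    have e1 : 0 ≤ (L - 1) * (9 * (N * N) + 10 * (M * N * p) + 11 * M + N * j) :=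
      mul_nonneg (by linarith) (by positivity)
    linarith
  have hfin : L * (10 * (N * N) + 26 * (M * N * p) + 11 * M + 16 * (N * N * B) + N * j) ≤
      L * ((100 + 100 * (√κ)⁻¹) * X) := by
    refine mul_le_mul_of_nonneg_left ?_ (by linarith)
    have : 0 ≤ (√κ)⁻¹ * X := by positivity
    linarith
  linarith

theorem exists_run {d w : ℕ} {G : SimpleGraph (Fin n)} {E : List (Fin n × Fin n)}
    {ops : List (Op n)} (hn : 0 < n) (hw : (n + 2) ^ 40 ≤ 2 ^ w) (hE : IsEdgeList G E)
    (hleg : Legal G ops) (ω : Tape) :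
    ∃ T R, dataStructure.Run w ω d E ops T R ∧
      List.Forall₂ (fun δ r => IsAdditiveTwoEstimate d δ r.estimate ∧ r.time ≤ 30)
        (queryDists G ops) R ∧
      T ≤ 500 * (startCost (min d n + 3) (centers ω (sampleExp n E.length)) G +
        n * (sampleExp n E.length + 1) + E.length + 4 +
        opsCost (min d n + 3) (centers ω (sampleExp n E.length)) G ops) := by
  have hf := fits_of_pow_le hw
  have hj : sampleExp n E.length < 2 ^ w :=
    (sampleExp_le hE.length_le).trans_lt (hf.lt_sq (by nlinarith))
  obtain ⟨t, s, hex, c, hr, hG, hD, ht⟩ :=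
    wp_init (w := w) (d := d) (ω := ω) hf hn hE hE.length_le hj
  obtain ⟨T, R, hS, hF, hT⟩ := exists_serves (w := w) (ω := ω) (D := dataStructure) hf rfl rfl hr
    (ops := ops) (by rwa [hG])
  rw [hG] at hF hT
  rw [hD] at hT
  exact ⟨t + T, R, ⟨t, s, T, hex, hS, rfl⟩, hF, by omega⟩

end

end DecrementalAPSP

open DecrementalAPSP in
theorem mainTheorem6 :
    ∃ (D : DataStructure) (c q k : ℕ), ∀ κ : ℝ, 0 < κ → ∃ C : ℝ,
      ∀ (n d w : ℕ) (G : SimpleGraph (Fin n)) (E : List (Fin n × Fin n)) (ops : List (Op n)),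
        0 < n → 0 < d → (n + 2) ^ c ≤ 2 ^ w → d < 2 ^ w →
        IsEdgeList G E → κ * (n : ℝ) ≤ (G.edgeSet.ncard : ℝ) → Legal G ops →
        ∃ (T : Tape → ℕ) (R : Tape → List Reply),
          (∀ ω : Tape, D.Run w ω d E ops (T ω) (R ω) ∧
            List.Forall₂ (fun δ r => IsAdditiveTwoEstimate d δ r.estimate ∧ r.time ≤ q)
              (queryDists G ops) (R ω)) ∧
          ∫⁻ ω, (T ω : ℝ≥0∞) ∂coinLaw ≤
            ENNReal.ofReal (C * ((G.edgeSet.ncard : ℝ) ^ (1 / 2 : ℝ) * (n : ℝ) ^ (3 / 2 : ℝ) *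
              (d : ℝ)) * Real.log n ^ k) := by
  -- The factor `2000` is `500 * 4`: potential units are worth `500` steps, and `min d n + 3 ≤ 4 *
  -- d` because `d ≥ 1`. The exponent of the logarithm is `0`.
  refine ⟨dataStructure, 40, 30, 0, fun κ hκ => ⟨2000 * (100 + 100 * (√κ)⁻¹), ?_⟩⟩
  intro n d w G E ops hn hd hw _ hE hκm hleg
  choose T R hrun hest hT using exists_run (d := d) hn hw hE hleg
  refine ⟨T, R, fun ω => ⟨hrun ω, hest ω⟩, ?_⟩
  have hm := hE.length_eq
  rw [← hm] at hκm ⊢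
  have hcost := integral_cost_le (L := min d n + 3) hκ hn (by omega) hm hE.length_le hκm hleg
  have hL : ((min d n + 3 : ℕ) : ℝ) ≤ 4 * d := by
    exact_mod_cast (by omega : min d n + 3 ≤ 4 * d)
  calc ∫⁻ ω, (T ω : ℝ≥0∞) ∂coinLaw
      ≤ ∫⁻ ω, 500 * ((startCost (min d n + 3) (centers ω (sampleExp n E.length)) G +
        n * (sampleExp n E.length + 1) + E.length + 4 +
        opsCost (min d n + 3) (centers ω (sampleExp n E.length)) G ops : ℕ) : ℝ≥0∞) ∂coinLaw :=
        -- Measurability of `T` is not needed, since it is dominated pointwise by a function of the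
        -- finitely many possible sets of centers.
        lintegral_mono fun ω => (Nat.cast_le (α := ℝ≥0∞).2 (hT ω)).trans_eq (by push_cast; rfl)
    _ = 500 * ENNReal.ofReal (∫ D, ((startCost (min d n + 3) D G +
        n * (sampleExp n E.length + 1) + E.length + 4 + opsCost (min d n + 3) D G ops : ℕ) : ℝ)
        ∂centersLaw n (sampleExp n E.length)) := by
      rw [lintegral_const_mul' _ _ (by norm_num), lintegral_centers (n := n) fun D =>
        startCost (min d n + 3) D G + n * (sampleExp n E.length + 1) + E.length + 4 +
          opsCost (min d n + 3) D G ops]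
    _ ≤ _ := by
      rw [show (500 : ℝ≥0∞) = ENNReal.ofReal 500 by norm_num, ← ENNReal.ofReal_mul (by norm_num)]
      refine ENNReal.ofReal_le_ofReal ?_
      rw [pow_half_mul_pow _ _ (by exact_mod_cast hn), pow_zero, mul_one]
      have hX : 0 ≤ (100 + 100 * (√κ)⁻¹) * (√(E.length : ℝ) * (n * √(n : ℝ))) := by positivity
      have := mul_le_mul_of_nonneg_right hL hX
      linarith
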